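/- Let $W$ and $R$ be real random variables and let $\hat K(u)$, $u\in\mathbb R$, be a (jointly measurable) real random function on a common probability space, such that $$\mathbb E\{Wf(W)\}=\mathbb E\Bigl\{\int_{-\infty}^{\infty}f'(W+u)\hat K(u)\,du\Bigr\}+\mathbb E\{Rf(W)\}$$ for every absolutely continuous $f:\mathbb R\to\mathbb R$ for which these three expectations exist (that is, $Wf(W)$ and $Rf(W)$ are integrable and $\mathbb E\int|f'(W+u)\hat K(u)|\,du<\infty$). For $t\ge 0$ put $K(u)=\mathbb E\hat K(u)$, $\hat K_1=\int_{-\infty}^{\infty}\hat K(u)\,du$, $$\hat K_{2,t}=\int_{-\infty}^{\infty}|u|e^{t|u|}|\hat K(u)|\,du,\qquad \hat K_{3,t}=\int_{|u|\le 1}e^{2t|u|}\bigl(\hat K(u)-K(u)\bigr)^2du,$$ $$\hat K_{4,t}=\int_{|u|\le 1}|u|e^{2t|u|}\bigl(\hat K(u)-K(u)\bigr)^2du,\qquad M_t=\int_{|u|\le1}e^{t|u|}|K(u)|\,du,$$ and, for $\beta,t\ge0$, $\Psi_{\beta,t}(w)=e^{tw}+1$ if $w\le\beta$ and $\Psi_{\beta,t}(w)=2e^{t\beta}-e^{t(2\beta-w)}+1$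 if $w>\beta$. Assume (A1): there are constants $m_0>0$, $\rho>0$ and $r_j\ge0$, $\tau_j\ge0$ ($j=0,\dots,4$) such that for all $\beta,t\in[0,m_0]$ (with the convention $0^0=1$) $$\mathbb E\{|R|\Psi_{\beta,t}(W)\}\le r_0(1+t^{\tau_0})\mathbb E\Psi_{\beta,t}(W),\qquad \mathbb E\bigl\{\bigl|\mathbb E\{\hat K_1\mid W\}-1\bigr|\Psi_{\beta,t}(W)\bigr\}\le r_1(1+t^{\tau_1})\mathbb E\Psi_{\beta,t}(W),$$ $$\mathbb E\{\hat K_{j,t}\Psi_{\beta,t}(W)\}\le r_j(1+t^{\tau_j})\mathbb E\Psi_{\beta,t}(W)\quad(j=2,3,4),\qquad\text{and}\qquad \sup_{0\le t\le m_0}M_t\le\rho.$$ Let $\tau=\max\{\tau_0+1,\tau_1+2,\tau_2+3,\tau_3+1,\tau_4+1\}$, $$z_0=\min\Bigl\{m_0,\;0.02\,e^{-\tau/2}\bigl(r_0^{1/(\tau_0+1)}+r_1^{1/(\tau_1+2)}+r_2^{1/(\tau_2+3)}\bigr)^{-1}\Bigr\},$$ $$\delta(z)=r_0(1+z^{\tau_0+1})+r_1(1+z^{\tau_1+2})+r_2(1+z^{\tau_2+3})+r_3(1+z^{\tau_3+1})+r_4^{1/2}(1+z^{\tau_4+1}).$$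 Then there is an absolute constant $C>0$ (not depending on any of the above data) such that $$\Bigl|\frac{\mathbb P(W>z)}{1-\Phi(z)}-1\Bigr|\le\Bigl(\frac{4}{\delta(m_0)}+C(150^{\tau}+\rho)e^{\tau^2/2}\Bigr)\delta(z)\qquad\text{for all }0\le z\le z_0,$$ where $\Phi$ is the standard normal distribution function. -/

import Mathlib

open MeasureTheory ProbabilityTheory
open scoped ENNReal

noncomputable section

namespace SteinModerate

/-- Absolute continuity of `f : ℝ → ℝ` on the whole line (the `ε`-`δ` definition). -/
def AbsCont (f : ℝ → ℝ) : Prop :=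
  ∀ ε : ℝ, 0 < ε → ∃ δ : ℝ, 0 < δ ∧ ∀ (n : ℕ) (a b : Fin n → ℝ),
    (∀ i, a i ≤ b i) →
    (∀ i j, i ≠ j → Disjoint (Set.Ioo (a i) (b i)) (Set.Ioo (a j) (b j))) →
    ∑ i, (b i - a i) < δ → ∑ i, |f (b i) - f (a i)| < ε

section Objects

variable {Ω : Type*} [MeasurableSpace Ω]

/-- The Stein identity `E[W f(W)] = E[∫ f'(W + u) K̂(u) du] + E[R f(W)]`, required of every
absolutely continuous `f` for which the three expectations exist. The derivative of such an `f`
exists almost everywhere, so the values of `deriv f` elsewhere do not matter to the inner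
integral. -/
def SteinIdentity (μ : Measure Ω) (W R : Ω → ℝ) (Khat : Ω → ℝ → ℝ) : Prop :=
  ∀ f : ℝ → ℝ, AbsCont f →
    Integrable (fun ω => W ω * f (W ω)) μ →
    Integrable (fun p : Ω × ℝ => deriv f (W p.1 + p.2) * Khat p.1 p.2) (μ.prod volume) →
    Integrable (fun ω => R ω * f (W ω)) μ →
    ∫ ω, W ω * f (W ω) ∂μ
      = (∫ ω, (∫ u : ℝ, deriv f (W ω + u) * Khat ω u) ∂μ) + ∫ ω, R ω * f (W ω) ∂μ

/-- `K(u) = E[K̂(u)]`. -/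
def meanK (μ : Measure Ω) (Khat : Ω → ℝ → ℝ) (u : ℝ) : ℝ := ∫ ω, Khat ω u ∂μ

/-- `K̂₁ = ∫ K̂(u) du`. -/
def K1 (Khat : Ω → ℝ → ℝ) (ω : Ω) : ℝ := ∫ u : ℝ, Khat ω u

/-- `E[K̂₁ | W]`. -/
def condK1 (μ : Measure Ω) (W : Ω → ℝ) (Khat : Ω → ℝ → ℝ) : Ω → ℝ :=
  μ[K1 Khat | MeasurableSpace.comap W inferInstance]

/-- `K̂_{2,t} = ∫ |u| e^{t|u|} |K̂(u)| du`, with values in `[0, ∞]`. -/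
def K2 (Khat : Ω → ℝ → ℝ) (t : ℝ) (ω : Ω) : ℝ≥0∞ :=
  ∫⁻ u : ℝ, ENNReal.ofReal (|u| * Real.exp (t * |u|) * |Khat ω u|)

/-- `K̂_{3,t} = ∫_{|u| ≤ 1} e^{2t|u|} (K̂(u) - K(u))² du`, with values in `[0, ∞]`. -/
def K3 (μ : Measure Ω) (Khat : Ω → ℝ → ℝ) (t : ℝ) (ω : Ω) : ℝ≥0∞ :=
  ∫⁻ u in Set.Icc (-1 : ℝ) 1,
    ENNReal.ofReal (Real.exp (2 * t * |u|) * (Khat ω u - meanK μ Khat u) ^ 2)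

/-- `K̂_{4,t} = ∫_{|u| ≤ 1} |u| e^{2t|u|} (K̂(u) - K(u))² du`, with values in `[0, ∞]`. -/
def K4 (μ : Measure Ω) (Khat : Ω → ℝ → ℝ) (t : ℝ) (ω : Ω) : ℝ≥0∞ :=
  ∫⁻ u in Set.Icc (-1 : ℝ) 1,
    ENNReal.ofReal (|u| * Real.exp (2 * t * |u|) * (Khat ω u - meanK μ Khat u) ^ 2)

/-- `M_t = ∫_{|u| ≤ 1} e^{t|u|} |K(u)| du`, with values in `[0, ∞]`. -/
def M (μ : Measure Ω) (Khat : Ω → ℝ → ℝ) (t : ℝ) : ℝ≥0∞ :=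
  ∫⁻ u in Set.Icc (-1 : ℝ) 1, ENNReal.ofReal (Real.exp (t * |u|) * |meanK μ Khat u|)

/-- The smoothed truncated exponential `Ψ_{β,t}`. -/
def Psi (β t w : ℝ) : ℝ :=
  if w ≤ β then Real.exp (t * w) + 1
  else 2 * Real.exp (t * β) - Real.exp (t * (2 * β - w)) + 1

/-- `E[X Ψ_{β,t}(W)] ≤ r (1 + t^τ) E[Ψ_{β,t}(W)]` for a `[0, ∞]`-valued `X`. The right-hand side
is finite since `0 < Ψ_{β,t} ≤ 2 e^{tβ} + 1`, so finiteness of the left-hand side is included. -/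
def WeightedBound (μ : Measure Ω) (W : Ω → ℝ) (X : Ω → ℝ≥0∞) (β t r τ : ℝ) : Prop :=
  ∫⁻ ω, X ω * ENNReal.ofReal (Psi β t (W ω)) ∂μ
    ≤ ENNReal.ofReal (r * (1 + t ^ τ)) * ∫⁻ ω, ENNReal.ofReal (Psi β t (W ω)) ∂μ

/-- Condition (A1) with the constants `m₀`, `ρ`, `r_j`, `τ_j` (`j = 0, …, 4`). -/
structure CondA1 (μ : Measure Ω) (W R : Ω → ℝ) (Khat : Ω → ℝ → ℝ)
    (m₀ ρ : ℝ) (r τ : Fin 5 → ℝ) : Prop where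
  m₀_pos : 0 < m₀
  ρ_pos : 0 < ρ
  r_nonneg : ∀ j, 0 ≤ r j
  τ_nonneg : ∀ j, 0 ≤ τ j
  bound_R : ∀ β ∈ Set.Icc 0 m₀, ∀ t ∈ Set.Icc 0 m₀,
    WeightedBound μ W (fun ω => ENNReal.ofReal |R ω|) β t (r 0) (τ 0)
  bound_K1 : ∀ β ∈ Set.Icc 0 m₀, ∀ t ∈ Set.Icc 0 m₀,
    WeightedBound μ W (fun ω => ENNReal.ofReal |condK1 μ W Khat ω - 1|) β t (r 1) (τ 1)
  bound_K2 : ∀ β ∈ Set.Icc 0 m₀, ∀ t ∈ Set.Icc 0 m₀,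
    WeightedBound μ W (K2 Khat t) β t (r 2) (τ 2)
  bound_K3 : ∀ β ∈ Set.Icc 0 m₀, ∀ t ∈ Set.Icc 0 m₀,
    WeightedBound μ W (K3 μ Khat t) β t (r 3) (τ 3)
  bound_K4 : ∀ β ∈ Set.Icc 0 m₀, ∀ t ∈ Set.Icc 0 m₀,
    WeightedBound μ W (K4 μ Khat t) β t (r 4) (τ 4)
  bound_M : ∀ t ∈ Set.Icc 0 m₀, M μ Khat t ≤ ENNReal.ofReal ρ

end Objects

/-- `τ = max {τ₀ + 1, τ₁ + 2, τ₂ + 3, τ₃ + 1, τ₄ + 1}`. -/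
def tauMax (τ : Fin 5 → ℝ) : ℝ :=
  max (τ 0 + 1) (max (τ 1 + 2) (max (τ 2 + 3) (max (τ 3 + 1) (τ 4 + 1))))

/-- The error term `δ(z)`. -/
def delta (r τ : Fin 5 → ℝ) (z : ℝ) : ℝ :=
  r 0 * (1 + z ^ (τ 0 + 1)) + r 1 * (1 + z ^ (τ 1 + 2)) + r 2 * (1 + z ^ (τ 2 + 3))
    + r 3 * (1 + z ^ (τ 3 + 1)) + √(r 4) * (1 + z ^ (τ 4 + 1))

/-- The end point `z₀` of the range. Under (A1) the sum that is inverted is positive: `r₁ = r₂ = 0`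
would give `K̂ = 0` almost everywhere and hence `E[K̂₁ | W] = 0`, against the bound with `r₁ = 0`. -/
def zRange (m₀ : ℝ) (r τ : Fin 5 → ℝ) : ℝ :=
  min m₀ (0.02 * Real.exp (-tauMax τ / 2) *
    (r 0 ^ (1 / (τ 0 + 1)) + r 1 ^ (1 / (τ 1 + 2)) + r 2 ^ (1 / (τ 2 + 3)))⁻¹)

/-- The standard normal distribution function. -/
def Phi (z : ℝ) : ℝ := cdf (gaussianReal 0 1) z

end SteinModerate

end

/-! The proof is Stein's method for a relative error, run under an exponential tilt. For a bounded
Lipschitz `f` with derivative `g`, conditioning on `W` turns the Stein identity into an exact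
formula for `E[W f(W)] - E[g(W)]` (`stein_error`). Its three error terms involve `R`, `E[K̂₁ | W] -
1` and the increments `g(W + u) - g(W)` integrated against `K̂`. If `f`, `g` and the increments of
`g` are dominated by weights `Ψ_{z,t}`, then (A1) bounds each error by a small number times `E
Ψ_{z,t}(W)`.

Four estimates carry the argument. (1) `integral_Psi_le`: testing with `Ψ - 1` gives a differential
inequality in `t`, hence `E Ψ_{z,t}(W) ≤ 41 e^{t²/2}`, which is Gaussian growth. (2)
`integral_indicator_Psi_le`: under the weight `Ψ_{z,z}` the mass of a window of length `l` is at
most of order `(l + error) e^{z²/2}`. The test function is `Ψ` times the antiderivative of a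
trapezoidal bump. The increments of the bump are again controlled by window masses, so the supremum
over all windows appears on both sides, with factor `1/2` on the right. (3)
`abs_integral_kernel_le`: near the origin `K̂` is replaced by its mean, at the cost of a Young
inequality with a free weight `θ(u)`. The product of the mean and an increment is then handled by
concentration, and the squared fluctuation by the third and fourth parts of (A1). (4)
`steinWeight_le_sum`: the Stein solution for the indicator of `(-∞, z]` grows like `(1 - Φ(z))
e^{w²/2}` on `[0, z]`. No single exponential weight matches this, but a sum of `e^{-k²/2} Ψ_{z,k}`
over integers `k ≤ z` does, and by (1) each summand has bounded expectation. The sum therefore costs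
a factor `1 + z`.

For the Stein solution, the increment of `g` splits into the increment of `w f(w)`, which is
Lipschitz, and the jump of the indicator, which needs (2) and (3). All bounds are proportional to `1
- Φ(z)`, so dividing gives the relative error (`abs_tail_sub_le`). These estimates need `(1 + z)^k
e_j ≤ 1` for the pairs `(k, j) = (1, 0), (2, 1), (3, 2)`, where `e_j = r_j (1 + z^{τ_j})`. The range
of `z` ensures this, except when `z ≤ 1` and one of `r₀, r₁, r₂` exceeds `1/16`; then `δ(z)` is
bounded below and the claim is trivial. The argument yields the factor `1 + ρ`, which is smaller
than the one asked for. -/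

namespace SteinModerate

/-! ### The weight `Ψ`: size, derivatives, increments -/

/-- The derivative of `Psi β t` in its last argument. -/
noncomputable def dPsi (β t w : ℝ) : ℝ := t * Real.exp (t * (β - |w - β|))

/-- The derivative of `Psi β t w` in `t`. -/
noncomputable def dtPsi (β t w : ℝ) : ℝ :=
  if w ≤ β then w * Real.exp (t * w)
  else 2 * (β * Real.exp (t * β)) - (2 * β - w) * Real.exp (t * (2 * β - w))

lemma Psi_of_le {β t w : ℝ} (h : w ≤ β) : Psi β t w = Real.exp (t * w) + 1 := if_pos h

lemma Psi_of_gt {β t w : ℝ} (h : β < w) :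
    Psi β t w = 2 * Real.exp (t * β) - Real.exp (t * (2 * β - w)) + 1 := if_neg h.not_ge

lemma Psi_of_ge {β t w : ℝ} (h : β ≤ w) :
    Psi β t w = 2 * Real.exp (t * β) - Real.exp (t * (2 * β - w)) + 1 := by
  rcases h.eq_or_lt with rfl | h
  · rw [Psi_of_le le_rfl]; ring_nf
  · exact Psi_of_gt h

lemma dPsi_of_le {β t w : ℝ} (h : w ≤ β) : dPsi β t w = t * Real.exp (t * w) := by
  rw [dPsi, abs_of_nonpos (by linarith)]; ring_nf

lemma dPsi_of_ge {β t w : ℝ} (h : β ≤ w) : dPsi β t w = t * Real.exp (t * (2 * β - w)) := by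
  rw [dPsi, abs_of_nonneg (by linarith)]; ring_nf

/-- With `Psi_le_two_exp_min` this makes `Ψ` comparable to `exp (t * min w β)`, up to a factor 2 and
the constant 1. Most pointwise comparisons of weights below go through this truncated exponential.
-/
lemma exp_min_add_one_le_Psi {β t : ℝ} (ht : 0 ≤ t) (w : ℝ) :
    Real.exp (t * min w β) + 1 ≤ Psi β t w := by
  rcases le_or_gt w β with h | h
  · rw [Psi_of_le h, min_eq_left h]
  · rw [Psi_of_gt h, min_eq_right h.le]
    have : Real.exp (t * (2 * β - w)) ≤ Real.exp (t * β) :=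
      Real.exp_le_exp.2 (mul_le_mul_of_nonneg_left (by linarith) ht)
    linarith

lemma Psi_le_two_exp_min {β t : ℝ} (w : ℝ) :
    Psi β t w ≤ 2 * Real.exp (t * min w β) + 1 := by
  rcases le_or_gt w β with h | h
  · rw [Psi_of_le h, min_eq_left h]; linarith [Real.exp_pos (t * w)]
  · rw [Psi_of_gt h, min_eq_right h.le]; linarith [Real.exp_pos (t * (2 * β - w))]

lemma exp_min_le_Psi {β t : ℝ} (ht : 0 ≤ t) (w : ℝ) : Real.exp (t * min w β) ≤ Psi β t w := by
  linarith [exp_min_add_one_le_Psi (β := β) ht w]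

lemma one_le_Psi {β t : ℝ} (ht : 0 ≤ t) (w : ℝ) : 1 ≤ Psi β t w := by
  linarith [exp_min_add_one_le_Psi (β := β) ht w, Real.exp_pos (t * min w β)]

lemma Psi_pos {β t : ℝ} (ht : 0 ≤ t) (w : ℝ) : 0 < Psi β t w := by
  linarith [one_le_Psi (β := β) ht w]

lemma Psi_le_const {β t : ℝ} (ht : 0 ≤ t) (w : ℝ) : Psi β t w ≤ 2 * Real.exp (t * β) + 1 := by
  have : Real.exp (t * min w β) ≤ Real.exp (t * β) :=
    Real.exp_le_exp.2 (mul_le_mul_of_nonneg_left (min_le_right _ _) ht)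
  linarith [Psi_le_two_exp_min (β := β) (t := t) w]

lemma Psi_zero (β w : ℝ) : Psi β 0 w = 2 := by
  unfold Psi; split_ifs <;> norm_num

/-- Beyond `β` the exponential is continued by its point reflection, so value and slope of the two
branches agree at `β`. The slope is `t` times an exponential of a tent function peaked at `β`. -/
lemma hasDerivAt_Psi (β t w : ℝ) : HasDerivAt (Psi β t) (dPsi β t w) w := by
  have h1 : ∀ x, HasDerivAt (fun w => Real.exp (t * w) + 1) (t * Real.exp (t * x)) x := fun x => by
    have := (((hasDerivAt_id x).const_mul t).exp).add_const 1
    simpa [mul_comm] using this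
  have h2 : ∀ x, HasDerivAt (fun w => 2 * Real.exp (t * β) - Real.exp (t * (2 * β - w)) + 1)
      (t * Real.exp (t * (2 * β - x))) x := fun x => by
    have := ((((((hasDerivAt_id x).const_sub (2 * β)).const_mul t).exp).const_sub
      (2 * Real.exp (t * β)))).add_const 1
    simpa [mul_comm] using this
  have hl : HasDerivWithinAt (Psi β t) (dPsi β t w) (Set.Iic β) w ∨ β < w := by
    rcases le_or_gt w β with h | h
    · left; rw [dPsi_of_le h]
      exact (h1 w).hasDerivWithinAt.congr (fun x hx => Psi_of_le hx) (Psi_of_le h)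
    · exact Or.inr h
  have hr : HasDerivWithinAt (Psi β t) (dPsi β t w) (Set.Ici β) w ∨ w < β := by
    rcases le_or_gt β w with h | h
    · left; rw [dPsi_of_ge h]
      exact (h2 w).hasDerivWithinAt.congr (fun x hx => Psi_of_ge hx) (Psi_of_ge h)
    · exact Or.inr h
  rcases lt_trichotomy w β with h | h | h
  · exact (hl.resolve_right h.not_gt).hasDerivAt (Iic_mem_nhds h)
  · subst h
    have := (hl.resolve_right (lt_irrefl _)).union (hr.resolve_right (lt_irrefl _))
    rwa [Set.Iic_union_Ici, hasDerivWithinAt_univ] at this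
  · exact (hr.resolve_right h.not_gt).hasDerivAt (Ici_mem_nhds h)

lemma continuous_Psi (β t : ℝ) : Continuous (Psi β t) :=
  continuous_iff_continuousAt.2 fun w => (hasDerivAt_Psi β t w).continuousAt

lemma continuous_dPsi (β t : ℝ) : Continuous (dPsi β t) := by
  unfold dPsi; fun_prop

lemma dPsi_nonneg {β t : ℝ} (ht : 0 ≤ t) (w : ℝ) : 0 ≤ dPsi β t w :=
  mul_nonneg ht (Real.exp_pos _).le

lemma exp_refl_le_exp_min {β t : ℝ} (ht : 0 ≤ t) (w : ℝ) :
    Real.exp (t * (β - |w - β|)) ≤ Real.exp (t * min w β) := by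
  refine Real.exp_le_exp.2 (mul_le_mul_of_nonneg_left (le_min ?_ ?_) ht)
  · linarith [neg_abs_le (w - β)]
  · linarith [abs_nonneg (w - β)]

lemma dPsi_le_exp_min {β t : ℝ} (ht : 0 ≤ t) (w : ℝ) :
    dPsi β t w ≤ t * Real.exp (t * min w β) :=
  mul_le_mul_of_nonneg_left (exp_refl_le_exp_min ht w) ht

lemma dPsi_le {β t : ℝ} (ht : 0 ≤ t) (w : ℝ) : dPsi β t w ≤ t * Psi β t w :=
  (dPsi_le_exp_min ht w).trans (mul_le_mul_of_nonneg_left (exp_min_le_Psi ht w) ht)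

lemma dPsi_le_const {β t : ℝ} (ht : 0 ≤ t) (w : ℝ) : dPsi β t w ≤ t * Real.exp (t * β) :=
  mul_le_mul_of_nonneg_left (Real.exp_le_exp.2 (mul_le_mul_of_nonneg_left
    (by linarith [abs_nonneg (w - β)]) ht)) ht

lemma abs_exp_sub_exp_le (a b c : ℝ) (ha : a ≤ c) (hb : b ≤ c) :
    |Real.exp a - Real.exp b| ≤ |a - b| * Real.exp c := by
  wlog h : b ≤ a generalizing a b with H
  · rw [abs_sub_comm, abs_sub_comm a]; exact H b a hb ha (le_of_not_ge h)
  rw [abs_of_nonneg (by linarith [Real.exp_le_exp.2 h]), abs_of_nonneg (by linarith)]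
  have h1 : Real.exp b = Real.exp a * Real.exp (b - a) := by rw [← Real.exp_add]; ring_nf
  have h2 := Real.add_one_le_exp (b - a)
  have h3 := Real.exp_le_exp.2 ha
  have := Real.exp_pos a
  nlinarith [mul_le_mul_of_nonneg_left h3 (sub_nonneg.2 h)]

/-- The exponent of `dPsi` is `t` times a 1-Lipschitz tent, so an increment gains a second factor
`t` and a factor `|u|`. Moving from `w + u` back to `w` costs `e^{t|u|}`. This is the shape of the
weight in `K2`. -/
lemma abs_dPsi_sub_le {β t : ℝ} (ht : 0 ≤ t) (w u : ℝ) :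
    |dPsi β t (w + u) - dPsi β t w| ≤ t ^ 2 * (|u| * Real.exp (t * |u|) * Psi β t w) := by
  have habs : |(|w + u - β| - |w - β|)| ≤ |u| := by
    have := abs_abs_sub_abs_le_abs_sub (w + u - β) (w - β)
    rwa [show w + u - β - (w - β) = u by ring] at this
  have hab := abs_le.1 habs
  have h := abs_exp_sub_exp_le (t * (β - |w + u - β|)) (t * (β - |w - β|))
    (t * (β - |w - β|) + t * |u|)
    (by rw [← mul_add]; exact mul_le_mul_of_nonneg_left (by linarith) ht)
    (by linarith [mul_nonneg ht (abs_nonneg u)])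
  rw [← mul_sub, abs_mul, abs_of_nonneg ht, Real.exp_add] at h
  have h3 : |β - |w + u - β| - (β - |w - β|)| ≤ |u| := by
    rw [show β - |w + u - β| - (β - |w - β|) = -(|w + u - β| - |w - β|) by ring, abs_neg]
    exact habs
  have h4 := (exp_refl_le_exp_min (β := β) ht w).trans (exp_min_le_Psi (β := β) ht w)
  rw [dPsi, dPsi, ← mul_sub, abs_mul, abs_of_nonneg ht, pow_two, mul_assoc]
  refine mul_le_mul_of_nonneg_left (h.trans ?_) ht
  rw [mul_assoc]
  refine mul_le_mul_of_nonneg_left ?_ ht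
  calc _ ≤ |u| * (Psi β t w * Real.exp (t * |u|)) := by gcongr
    _ = _ := by ring

/-- Assuming only `x ≤ w + |u|` covers every point between `w` and `w + u`, as the mean value
inequality requires. -/
lemma exp_min_add_le {β t : ℝ} (ht : 0 ≤ t) {w x u : ℝ} (hx : x ≤ w + |u|) :
    Real.exp (t * min x β) ≤ Real.exp (t * |u|) * Real.exp (t * min w β) := by
  rw [← Real.exp_add, ← mul_add]
  refine Real.exp_le_exp.2 (mul_le_mul_of_nonneg_left ?_ ht)
  rcases le_total w β with h | h
  · rw [min_eq_left h]; linarith [min_le_left x β]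
  · rw [min_eq_right h]; linarith [min_le_right x β, abs_nonneg u]

lemma Psi_add_le {β t : ℝ} (ht : 0 ≤ t) {w x u : ℝ} (hx : x ≤ w + |u|) :
    Psi β t x ≤ 2 * (Real.exp (t * |u|) * Psi β t w) := by
  have h1 := Psi_le_two_exp_min (β := β) (t := t) x
  have h2 := exp_min_add_le (β := β) ht hx
  have h3 := exp_min_add_one_le_Psi (β := β) ht w
  have h4 : 1 ≤ Real.exp (t * |u|) := Real.one_le_exp (mul_nonneg ht (abs_nonneg u))
  nlinarith [mul_le_mul_of_nonneg_left h3 (zero_le_one.trans h4)]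

lemma abs_Psi_sub_le {β t : ℝ} (ht : 0 ≤ t) (w u : ℝ) :
    |Psi β t (w + u) - Psi β t w| ≤ t * (|u| * Real.exp (t * |u|) * Psi β t w) := by
  have := (convex_uIcc w (w + u)).norm_image_sub_le_of_norm_hasDerivWithin_le
    (f := Psi β t) (f' := dPsi β t) (C := t * (Real.exp (t * |u|) * Psi β t w))
    (fun x _ => (hasDerivAt_Psi β t x).hasDerivWithinAt) (fun x hx => ?_)
    Set.left_mem_uIcc Set.right_mem_uIcc
  · simp only [Real.norm_eq_abs, add_sub_cancel_left] at this
    calc _ ≤ _ := this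
      _ = _ := by ring
  · rw [Real.norm_eq_abs, abs_of_nonneg (dPsi_nonneg ht x)]
    refine (dPsi_le_exp_min ht x).trans (mul_le_mul_of_nonneg_left ?_ ht)
    have hx' : x ≤ w + |u| := by
      have := hx.2
      refine this.trans (max_le (by linarith [abs_nonneg u]) (by linarith [le_abs_self u]))
    refine (exp_min_add_le ht hx').trans (mul_le_mul_of_nonneg_left (exp_min_le_Psi ht w)
      (Real.exp_pos _).le)

lemma hasDerivAt_Psi_param (β t w : ℝ) : HasDerivAt (fun t => Psi β t w) (dtPsi β t w) t := by
  rcases le_or_gt w β with h | h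
  · simp only [Psi_of_le h, dtPsi, if_pos h]
    have := (((hasDerivAt_id t).mul_const w).exp).add_const 1
    simpa [mul_comm] using this
  · simp only [Psi_of_gt h, dtPsi, if_neg h.not_ge]
    have := (((((hasDerivAt_id t).mul_const β).exp).const_mul 2).sub
      (((hasDerivAt_id t).mul_const (2 * β - w)).exp)).add_const 1
    simpa [mul_comm] using this

lemma measurable_dtPsi (β t : ℝ) : Measurable (dtPsi β t) := by
  unfold dtPsi
  exact Measurable.ite measurableSet_Iic (by fun_prop) (by fun_prop)

lemma abs_dtPsi_le {β t : ℝ} (hβ : 0 ≤ β) (ht : 0 ≤ t) (w : ℝ) :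
    |dtPsi β t w| ≤ (4 * β + |w|) * Real.exp (t * β) := by
  have hE := Real.exp_pos (t * β)
  rcases le_or_gt w β with h | h
  · rw [dtPsi, if_pos h, abs_mul, abs_of_pos (Real.exp_pos _)]
    have : Real.exp (t * w) ≤ Real.exp (t * β) :=
      Real.exp_le_exp.2 (mul_le_mul_of_nonneg_left h ht)
    nlinarith [abs_nonneg w, Real.exp_pos (t * w)]
  · rw [dtPsi, if_neg h.not_ge]
    have : Real.exp (t * (2 * β - w)) ≤ Real.exp (t * β) :=
      Real.exp_le_exp.2 (mul_le_mul_of_nonneg_left (by linarith) ht)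
    have h2 : |2 * β - w| ≤ 2 * β + |w| := by
      refine (abs_sub _ _).trans ?_
      rw [abs_of_nonneg (by linarith : 0 ≤ 2 * β)]
    have h3 : |(2 * β - w) * Real.exp (t * (2 * β - w))| ≤ (2 * β + |w|) * Real.exp (t * β) := by
      rw [abs_mul, abs_of_pos (Real.exp_pos _)]
      gcongr
    refine (abs_sub _ _).trans ?_
    rw [abs_of_nonneg (by positivity : 0 ≤ 2 * (β * Real.exp (t * β)))]
    linarith

/-- This lets the Stein identity for `Ψ - 1` control the `t`-derivative of `E Ψ`. Below `β` it is an
equality. -/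
lemma dtPsi_le {β t : ℝ} (ht : 0 ≤ t) (w : ℝ) : dtPsi β t w ≤ w * (Psi β t w - 1) := by
  rcases le_or_gt w β with h | h
  · rw [dtPsi, if_pos h, Psi_of_le h]; simp
  · rw [dtPsi, if_neg h.not_ge, Psi_of_gt h]
    have : Real.exp (t * (2 * β - w)) ≤ Real.exp (t * β) :=
      Real.exp_le_exp.2 (mul_le_mul_of_nonneg_left (by linarith) ht)
    -- The difference of the two sides is `2 (w - β) (e^{tβ} - e^{t(2β - w)})`.
    nlinarith [mul_nonneg (sub_nonneg.2 h.le) (sub_nonneg.2 this)]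

lemma continuous_Psi_param (β w : ℝ) : Continuous (fun t => Psi β t w) :=
  continuous_iff_continuousAt.2 fun t => (hasDerivAt_Psi_param β t w).continuousAt

/-! ### Admissible test functions and integrability from (A1) -/

lemma absCont_of_lipschitzWith {f : ℝ → ℝ} {L : NNReal} (hf : LipschitzWith L f) : AbsCont f := by
  intro ε hε
  refine ⟨ε / (L + 1), by positivity, fun n a b hab _ hsum => ?_⟩
  have hL : (0 : ℝ) < L + 1 := by positivity
  calc ∑ i, |f (b i) - f (a i)| ≤ ∑ i, (L + 1) * (b i - a i) := by
        refine Finset.sum_le_sum fun i _ => ?_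
        have := hf.dist_le_mul (b i) (a i)
        rw [Real.dist_eq, Real.dist_eq, abs_of_nonneg (sub_nonneg.2 (hab i))] at this
        nlinarith [hab i]
    _ = (L + 1) * ∑ i, (b i - a i) := by rw [Finset.mul_sum]
    _ < (L + 1) * (ε / (L + 1)) := by gcongr
    _ = ε := by field_simp

section

variable {Ω : Type*} [MeasurableSpace Ω] {μ : Measure Ω} [IsProbabilityMeasure μ]
  {W R : Ω → ℝ} {Khat : Ω → ℝ → ℝ}

lemma integrable_Psi (hW : Measurable W) {β t : ℝ} (ht : 0 ≤ t) :
    Integrable (fun ω => Psi β t (W ω)) μ :=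
  Integrable.of_bound ((continuous_Psi β t).measurable.comp hW).aestronglyMeasurable
    (2 * Real.exp (t * β) + 1) (ae_of_all _ fun ω => by
      rw [Real.norm_eq_abs, abs_of_pos (Psi_pos ht _)]; exact Psi_le_const ht _)

lemma lintegral_Psi (hW : Measurable W) {β t : ℝ} (ht : 0 ≤ t) :
    ∫⁻ ω, ENNReal.ofReal (Psi β t (W ω)) ∂μ = ENNReal.ofReal (∫ ω, Psi β t (W ω) ∂μ) :=
  (ofReal_integral_eq_lintegral_ofReal (integrable_Psi hW ht)
    (ae_of_all _ fun _ => (Psi_pos ht _).le)).symm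

lemma integrable_and_integral_le_of_lintegral_le {α : Type*} [MeasurableSpace α] {ν : Measure α}
    {F : α → ℝ} (hF : AEStronglyMeasurable F ν) (h0 : ∀ x, 0 ≤ F x) {c : ℝ} (hc : 0 ≤ c)
    (h : ∫⁻ x, ENNReal.ofReal (F x) ∂ν ≤ ENNReal.ofReal c) :
    Integrable F ν ∧ ∫ x, F x ∂ν ≤ c := by
  have hi : Integrable F ν :=
    ⟨hF, (hasFiniteIntegral_iff_ofReal (ae_of_all _ h0)).2 (h.trans_lt ENNReal.ofReal_lt_top)⟩
  refine ⟨hi, ?_⟩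
  rw [← ofReal_integral_eq_lintegral_ofReal hi (ae_of_all _ h0)] at h
  exact (ENNReal.ofReal_le_ofReal_iff hc).1 h

/-- Real form of a weighted bound for a random variable. -/
lemma WeightedBound.integral_le (hW : Measurable W) {X : Ω → ℝ}
    (hX : AEStronglyMeasurable X μ) (hX0 : ∀ ω, 0 ≤ X ω) {β t r τ : ℝ} (ht : 0 ≤ t) (hr : 0 ≤ r)
    (h : WeightedBound μ W (fun ω => ENNReal.ofReal (X ω)) β t r τ) :
    Integrable (fun ω => X ω * Psi β t (W ω)) μ ∧
      ∫ ω, X ω * Psi β t (W ω) ∂μ ≤ r * (1 + t ^ τ) * ∫ ω, Psi β t (W ω) ∂μ := by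
  have h1 : 0 ≤ r * (1 + t ^ τ) := mul_nonneg hr (by have := Real.rpow_nonneg ht τ; linarith)
  have h2 : 0 ≤ ∫ ω, Psi β t (W ω) ∂μ := integral_nonneg fun _ => (Psi_pos ht _).le
  refine integrable_and_integral_le_of_lintegral_le
    (hX.mul ((continuous_Psi β t).measurable.comp hW).aestronglyMeasurable)
    (fun ω => mul_nonneg (hX0 ω) (Psi_pos ht _).le) (mul_nonneg h1 h2) ?_
  rw [ENNReal.ofReal_mul h1, ← lintegral_Psi hW ht]
  refine le_trans (le_of_eq ?_) h
  exact lintegral_congr fun ω => ENNReal.ofReal_mul (hX0 ω)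

/-- Real form, over a product space, of a weighted bound for a random integral. -/
lemma WeightedBound.integral_prod_le (hW : Measurable W) {ν : Measure ℝ} [SFinite ν]
    {F : Ω × ℝ → ℝ} (hF : Measurable F) (hF0 : ∀ p, 0 ≤ F p) {β t r τ : ℝ} (ht : 0 ≤ t)
    (hr : 0 ≤ r)
    (h : WeightedBound μ W (fun ω => ∫⁻ u, ENNReal.ofReal (F (ω, u)) ∂ν) β t r τ) :
    Integrable (fun p => F p * Psi β t (W p.1)) (μ.prod ν) ∧
      ∫ p, F p * Psi β t (W p.1) ∂(μ.prod ν)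
        ≤ r * (1 + t ^ τ) * ∫ ω, Psi β t (W ω) ∂μ := by
  have h1 : 0 ≤ r * (1 + t ^ τ) := mul_nonneg hr (by have := Real.rpow_nonneg ht τ; linarith)
  have h2 : 0 ≤ ∫ ω, Psi β t (W ω) ∂μ := integral_nonneg fun _ => (Psi_pos ht _).le
  have hm : Measurable fun p : Ω × ℝ => F p * Psi β t (W p.1) :=
    hF.mul ((continuous_Psi β t).measurable.comp (hW.comp measurable_fst))
  refine integrable_and_integral_le_of_lintegral_le hm.aestronglyMeasurable
    (fun ω => mul_nonneg (hF0 ω) (Psi_pos ht _).le) (mul_nonneg h1 h2) ?_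
  rw [ENNReal.ofReal_mul h1, ← lintegral_Psi hW ht, lintegral_prod _ hm.ennreal_ofReal.aemeasurable]
  refine le_trans (le_of_eq ?_) h
  refine lintegral_congr fun ω => ?_
  rw [← lintegral_mul_const _ (by fun_prop)]
  exact lintegral_congr fun u => ENNReal.ofReal_mul (hF0 _)

lemma WeightedBound.lintegral_lt_top {X : Ω → ℝ≥0∞} {β r τ : ℝ}
    (h : WeightedBound μ W X β 0 r τ) : ∫⁻ ω, X ω ∂μ < ∞ := by
  have h2 : ∫⁻ ω, X ω ∂μ ≤ ∫⁻ ω, X ω * ENNReal.ofReal (Psi β 0 (W ω)) ∂μ := by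
    refine lintegral_mono fun ω => ?_
    rw [Psi_zero]
    exact le_mul_of_one_le_right (zero_le) (by norm_num)
  refine (h2.trans h).trans_lt ?_
  simp only [Psi_zero, lintegral_const, measure_univ, mul_one]
  exact ENNReal.mul_lt_top ENNReal.ofReal_lt_top ENNReal.ofReal_lt_top

lemma measurable_meanK (hK : Measurable (Function.uncurry Khat)) : Measurable (meanK μ Khat) := by
  have : StronglyMeasurable (fun u : ℝ => ∫ ω, Function.uncurry Khat (ω, u) ∂μ) :=
    StronglyMeasurable.integral_prod_right (f := fun u ω => Khat ω u)
      (hK.comp measurable_swap).stronglyMeasurable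
  exact this.measurable

/-- At `t = 0` the weight `Ψ` is constant, so the bounds become plain expectations. For `|u| > 1`,
`|K̂| ≤ |u| |K̂|`; for `|u| ≤ 1`, `|K̂| ≤ |K| + 1 + (K̂ - K)²`. -/
lemma integrable_Khat (hK : Measurable (Function.uncurry Khat)) {β ρ r₂ τ₂ r₃ τ₃ : ℝ}
    (h2 : WeightedBound μ W (K2 Khat 0) β 0 r₂ τ₂) (h3 : WeightedBound μ W (K3 μ Khat 0) β 0 r₃ τ₃)
    (hM : M μ Khat 0 ≤ ENNReal.ofReal ρ) :
    Integrable (fun p : Ω × ℝ => Khat p.1 p.2) (μ.prod volume) := by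
  have hK' : Measurable fun p : Ω × ℝ => Khat p.1 p.2 := hK
  have hKb := measurable_meanK (μ := μ) hK
  refine ⟨hK'.aestronglyMeasurable, ?_⟩
  rw [hasFiniteIntegral_iff_norm, lintegral_prod _ (by fun_prop)]
  have key : ∀ ω, ∫⁻ u, ENNReal.ofReal ‖Khat ω u‖
      ≤ K2 Khat 0 ω + (M μ Khat 0 + volume (Set.Icc (-1 : ℝ) 1) + K3 μ Khat 0 ω) := by
    intro ω
    have hω : Measurable (Khat ω) := hK.of_uncurry_left
    rw [← lintegral_add_compl _ (measurableSet_Icc : MeasurableSet (Set.Icc (-1 : ℝ) 1)), add_comm]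
    refine add_le_add ?_ ?_
    · refine (lintegral_mono_ae ?_).trans (setLIntegral_le_lintegral _ _)
      refine (ae_restrict_mem measurableSet_Icc.compl).mono fun u hu => ENNReal.ofReal_le_ofReal ?_
      have : 1 ≤ |u| := by
        by_contra hlt
        exact hu (Set.mem_Icc.2 (abs_le.1 (not_le.1 hlt).le))
      rw [zero_mul, Real.exp_zero, mul_one, Real.norm_eq_abs]
      exact le_mul_of_one_le_left (abs_nonneg _) this
    · unfold M K3
      rw [← setLIntegral_one, ← lintegral_add_left (by fun_prop), ← lintegral_add_left (by fun_prop)]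
      refine lintegral_mono fun u => ?_
      rw [← ENNReal.ofReal_one, ← ENNReal.ofReal_add (by positivity) (by positivity),
        ← ENNReal.ofReal_add (by positivity) (by positivity)]
      refine ENNReal.ofReal_le_ofReal ?_
      simp only [zero_mul, mul_zero, Real.exp_zero, one_mul, Real.norm_eq_abs]
      have h1 : |Khat ω u| ≤ |Khat ω u - meanK μ Khat u| + |meanK μ Khat u| := by
        simpa using abs_add_le (Khat ω u - meanK μ Khat u) (meanK μ Khat u)
      nlinarith [sq_abs (Khat ω u - meanK μ Khat u),
        sq_nonneg (|Khat ω u - meanK μ Khat u| - 1), sq_nonneg (Khat ω u - meanK μ Khat u)]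
  refine (lintegral_mono key).trans_lt ?_
  have hK2 : Measurable (K2 Khat 0) := by
    unfold K2
    exact Measurable.lintegral_prod_right' (f := fun p : Ω × ℝ =>
      ENNReal.ofReal (|p.2| * Real.exp (0 * |p.2|) * |Khat p.1 p.2|)) (by fun_prop)
  rw [lintegral_add_left hK2, lintegral_add_left measurable_const, lintegral_const, measure_univ,
    mul_one]
  refine ENNReal.add_lt_top.2 ⟨h2.lintegral_lt_top, ENNReal.add_lt_top.2 ⟨?_, h3.lintegral_lt_top⟩⟩
  exact ENNReal.add_lt_top.2 ⟨hM.trans_lt ENNReal.ofReal_lt_top, by simp⟩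

/-- For a bounded Lipschitz `f` the integrability of `K̂` and `R` makes two of the three
expectations exist. The one with `W` stays a hypothesis, since `W` is not yet known to be
integrable. -/
lemma stein_identity_of_lipschitz (hW : Measurable W)
    (hS : SteinIdentity μ W R Khat)
    (hKi : Integrable (fun p : Ω × ℝ => Khat p.1 p.2) (μ.prod volume)) (hRi : Integrable R μ)
    {f : ℝ → ℝ} {L : NNReal} (hf : LipschitzWith L f) {b : ℝ} (hb : ∀ x, |f x| ≤ b)
    (hWf : Integrable (fun ω => W ω * f (W ω)) μ) :
    Integrable (fun p : Ω × ℝ => deriv f (W p.1 + p.2) * Khat p.1 p.2) (μ.prod volume) ∧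
    ∫ ω, W ω * f (W ω) ∂μ = (∫ p : Ω × ℝ, deriv f (W p.1 + p.2) * Khat p.1 p.2 ∂(μ.prod volume))
      + ∫ ω, R ω * f (W ω) ∂μ := by
  have hd : Integrable (fun p : Ω × ℝ => deriv f (W p.1 + p.2) * Khat p.1 p.2)
      (μ.prod volume) := by
    refine hKi.bdd_mul (c := L) ?_ (ae_of_all _ fun p => norm_deriv_le_of_lipschitz hf)
    exact ((measurable_deriv f).comp ((hW.comp measurable_fst).add
      measurable_snd)).aestronglyMeasurable
  refine ⟨hd, ?_⟩
  rw [hS f (absCont_of_lipschitzWith hf) hWf hd ?_, integral_prod _ hd]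
  exact hRi.mul_bdd (c := b) (hf.continuous.measurable.comp hW).aestronglyMeasurable
    (ae_of_all _ fun p => hb _)

/-! ### Integrability of `W` -/

/-- A compactly supported truncation of `w ↦ max (-1) (min w 1)`. -/
noncomputable def clip (n w : ℝ) : ℝ :=
  max 0 (min w (min 1 (n + 1 - w))) - max 0 (min (-w) (min 1 (n + 1 + w)))

lemma lipschitzWith_clip (n : ℝ) : LipschitzWith 2 (clip n) := by
  have hid : LipschitzWith 1 (fun w : ℝ => w) := LipschitzWith.id
  have h1 : LipschitzWith 1 (fun w : ℝ => max 0 (min w (min 1 (n + 1 - w)))) := by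
    have h : LipschitzWith 1 fun w : ℝ => n + 1 - w :=
      LipschitzWith.of_dist_le_mul fun x y => by
        rw [Real.dist_eq, Real.dist_eq, abs_sub_comm x y]; simp
    have := (hid.min ((h.const_min 1))).const_max 0
    simpa using this
  have h2 : LipschitzWith 1 (fun w : ℝ => max 0 (min (-w) (min 1 (n + 1 + w)))) := by
    have h : LipschitzWith 1 fun w : ℝ => n + 1 + w :=
      LipschitzWith.of_dist_le_mul fun x y => by
        rw [Real.dist_eq, Real.dist_eq]; simp
    have h' : LipschitzWith 1 fun w : ℝ => -w :=
      LipschitzWith.of_dist_le_mul fun x y => by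
        rw [Real.dist_eq, Real.dist_eq, abs_sub_comm x y]; simp [neg_add_eq_sub]
    have := (h'.min ((h.const_min 1))).const_max 0
    simpa using this
  have := h1.sub h2
  rw [one_add_one_eq_two] at this
  exact this

lemma clip_of_nonneg {n w : ℝ} (hw : 0 ≤ w) : clip n w = max 0 (min w (min 1 (n + 1 - w))) := by
  have : min (-w) (min 1 (n + 1 + w)) ≤ 0 := (min_le_left _ _).trans (by linarith)
  rw [clip, max_eq_left this, sub_zero]

lemma clip_neg (n w : ℝ) : clip n (-w) = -clip n w := by
  simp only [clip, neg_neg, sub_neg_eq_add, ← sub_eq_add_neg]; ring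

lemma abs_clip_le (n w : ℝ) : |clip n w| ≤ 1 := by
  wlog h : 0 ≤ w generalizing w with H
  · have := H (-w) (by linarith); rwa [clip_neg, abs_neg] at this
  rw [clip_of_nonneg h, abs_of_nonneg (le_max_left _ _)]
  exact max_le zero_le_one ((min_le_right _ _).trans (min_le_left _ _))

lemma mul_clip_nonneg (n w : ℝ) : 0 ≤ w * clip n w := by
  wlog h : 0 ≤ w generalizing w with H
  · have := H (-w) (by linarith); rwa [clip_neg, neg_mul_neg] at this
  rw [clip_of_nonneg h]
  exact mul_nonneg h (le_max_left _ _)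

lemma mul_clip_le {n : ℝ} (hn : 0 ≤ n) (w : ℝ) : w * clip n w ≤ n + 1 := by
  wlog h : 0 ≤ w generalizing w with H
  · have := H (-w) (by linarith); rwa [clip_neg, neg_mul_neg] at this
  rcases le_total w (n + 1) with h1 | h1
  · nlinarith [abs_le.1 (abs_clip_le n w)]
  · have : min w (min 1 (n + 1 - w)) ≤ 0 :=
      (min_le_right _ _).trans ((min_le_right _ _).trans (by linarith))
    rw [clip_of_nonneg h, max_eq_left this]; linarith

lemma abs_sub_one_le_mul_clip {n w : ℝ} (hw : |w| ≤ n) : |w| - 1 ≤ w * clip n w := by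
  wlog h : 0 ≤ w generalizing w with H
  · have := H (w := -w) (by rwa [abs_neg]) (by linarith); rwa [clip_neg, neg_mul_neg, abs_neg] at this
  rw [abs_of_nonneg h] at hw ⊢
  rw [clip_of_nonneg h, min_eq_left (a := (1 : ℝ)) (by linarith)]
  rcases le_total w 1 with h1 | h1
  · exact le_trans (by linarith) (mul_nonneg h (le_max_left _ _))
  · rw [min_eq_right h1]
    nlinarith [le_max_right (0 : ℝ) 1]

/-- The test functions `clip n` vanish far out, so `W * clip n W` is bounded and the Stein identity
applies without prior knowledge of `W`. They share a bound and a Lipschitz constant, so `E[W * clip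
n W]` is bounded uniformly in `n`; on `{|W| ≤ n}` the integrand dominates `|W| - 1`. -/
lemma integrable_W (hW : Measurable W)
    (hS : SteinIdentity μ W R Khat)
    (hKi : Integrable (fun p : Ω × ℝ => Khat p.1 p.2) (μ.prod volume)) (hRi : Integrable R μ) :
    Integrable W μ := by
  have hcl : ∀ n : ℕ, Integrable (fun ω => W ω * clip n (W ω)) μ := fun n =>
    Integrable.of_bound (hW.mul ((lipschitzWith_clip n).continuous.measurable.comp
      hW)).aestronglyMeasurable (n + 1) (ae_of_all _ fun ω => by
        rw [Real.norm_eq_abs, abs_of_nonneg (mul_clip_nonneg _ _)]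
        exact mul_clip_le (Nat.cast_nonneg n) _)
  have hc : AECover μ Filter.atTop (fun n : ℕ => {ω | |W ω| ≤ n}) :=
    { ae_eventually_mem := ae_of_all _ fun ω => by
        obtain ⟨N, hN⟩ := exists_nat_ge |W ω|
        filter_upwards [Filter.eventually_ge_atTop N] with n hn
        exact hN.trans (Nat.cast_le.2 hn)
      measurableSet := fun n => measurableSet_le hW.norm measurable_const }
  refine hc.integrable_of_integral_norm_bounded
    (2 * (∫ p : Ω × ℝ, |Khat p.1 p.2| ∂(μ.prod volume)) + (∫ ω, |R ω| ∂μ) + 1) (fun n => ?_)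
    (Filter.Eventually.of_forall fun n => ?_)
  · refine Measure.integrableOn_of_bounded (M := n) (measure_ne_top _ _) hW.aestronglyMeasurable ?_
    exact (ae_restrict_mem (hc.measurableSet n)).mono fun ω hω => hω
  · obtain ⟨hd, hid⟩ := stein_identity_of_lipschitz hW hS hKi hRi (lipschitzWith_clip n)
      (abs_clip_le n) (hcl n)
    have h1 : ∫ ω in {ω | |W ω| ≤ n}, ‖W ω‖ ∂μ ≤ ∫ ω, (W ω * clip n (W ω) + 1) ∂μ := by
      rw [← integral_indicator (hc.measurableSet n)]
      refine integral_mono_of_nonneg (ae_of_all _ fun ω => Set.indicator_nonneg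
        (fun _ _ => norm_nonneg _) _) ((hcl n).add (integrable_const 1)) (ae_of_all _ fun ω => ?_)
      refine Set.indicator_le' (f := fun ω => ‖W ω‖) (g := fun ω => W ω * clip n (W ω) + 1)
        (fun ω hω => ?_) (fun ω _ => ?_) ω
      · have := abs_sub_one_le_mul_clip (n := n) hω
        rw [Real.norm_eq_abs]; linarith
      · have := mul_clip_nonneg n (W ω); linarith
    rw [integral_add (hcl n) (integrable_const 1), integral_const, probReal_univ, one_smul,
      hid] at h1
    have h2 : ∫ p : Ω × ℝ, deriv (clip n) (W p.1 + p.2) * Khat p.1 p.2 ∂(μ.prod volume)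
        ≤ 2 * (∫ p : Ω × ℝ, |Khat p.1 p.2| ∂(μ.prod volume)) := by
      rw [← integral_const_mul]
      refine integral_mono hd (hKi.abs.const_mul 2) fun p => ?_
      have := norm_deriv_le_of_lipschitz (lipschitzWith_clip n) (x₀ := W p.1 + p.2)
      refine (le_abs_self _).trans ?_
      rw [abs_mul]
      exact mul_le_mul_of_nonneg_right this (abs_nonneg _)
    have h3 : ∫ ω, R ω * clip n (W ω) ∂μ ≤ ∫ ω, |R ω| ∂μ := by
      refine integral_mono (hRi.mul_bdd (c := 1) ((lipschitzWith_clip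
        n).continuous.measurable.comp hW).aestronglyMeasurable
        (ae_of_all _ fun p => abs_clip_le n _)) hRi.abs fun ω => (le_abs_self _).trans ?_
      rw [abs_mul]
      exact mul_le_of_le_one_right (abs_nonneg _) (abs_clip_le n _)
    linarith

/-- Since `g (W)` is measurable for the conditioning σ-algebra, it can be pulled out; this is how
`E[K̂₁ | W]` replaces `K̂₁`. -/
lemma integral_mul_Khat_eq_condK1 (hW : Measurable W)
    (hKi : Integrable (fun p : Ω × ℝ => Khat p.1 p.2) (μ.prod volume)) {g : ℝ → ℝ}
    (hg : Measurable g) {b : ℝ} (hb : ∀ x, |g x| ≤ b) :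
    ∫ p : Ω × ℝ, g (W p.1) * Khat p.1 p.2 ∂(μ.prod volume)
      = ∫ ω, g (W ω) * condK1 μ W Khat ω ∂μ := by
  have hK1 : Integrable (K1 Khat) μ := hKi.integral_prod_left
  have hgK : Integrable (fun p : Ω × ℝ => g (W p.1) * Khat p.1 p.2) (μ.prod volume) :=
    hKi.bdd_mul (c := b) (hg.comp (hW.comp measurable_fst)).aestronglyMeasurable
      (ae_of_all _ fun p => hb _)
  have hgK1 : Integrable (fun ω => g (W ω) * K1 Khat ω) μ :=
    hK1.bdd_mul (c := b) (hg.comp hW).aestronglyMeasurable (ae_of_all _ fun p => hb _)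
  have hm : MeasurableSpace.comap W inferInstance ≤ (inferInstance : MeasurableSpace Ω) :=
    hW.comap_le
  rw [integral_prod _ hgK]
  calc _ = ∫ ω, g (W ω) * K1 Khat ω ∂μ := integral_congr_ae (ae_of_all _ fun ω => by
        exact integral_const_mul (g (W ω)) (Khat ω))
    _ = ∫ ω, (μ[fun ω => g (W ω) * K1 Khat ω | MeasurableSpace.comap W inferInstance]) ω ∂μ :=
        (integral_condExp hm).symm
    _ = _ := by
        refine integral_congr_ae ?_
        exact condExp_mul_of_stronglyMeasurable_left (f := fun ω => g (W ω))
          ((hg.comp (comap_measurable W)).stronglyMeasurable) hgK1 hK1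

end

/-! ### Condition (A1) at a fixed level `z` -/

/-- The consequences of (A1) at a fixed level `z`, with real integrals, and with the numbers
`e j = r j * (1 + z ^ τ j)` in place of the constants of (A1). -/
structure LevelBounds {Ω : Type*} [MeasurableSpace Ω] (μ : Measure Ω) (W R : Ω → ℝ)
    (Khat : Ω → ℝ → ℝ) (z ρ : ℝ) (e : Fin 5 → ℝ) : Prop where
  meas_W : Measurable W
  meas_R : Measurable R
  meas_K : Measurable (Function.uncurry Khat)
  stein : SteinIdentity μ W R Khat
  int_K : Integrable (fun p : Ω × ℝ => Khat p.1 p.2) (μ.prod volume)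
  int_R : Integrable R μ
  z_nonneg : 0 ≤ z
  ρ_nonneg : 0 ≤ ρ
  e_nonneg : ∀ j, 0 ≤ e j
  small_R : (1 + z) * e 0 ≤ 1
  small_K1 : (1 + z) ^ 2 * e 1 ≤ 1
  small_K2 : (1 + z) ^ 3 * e 2 ≤ 1
  bound_R : ∀ t ∈ Set.Icc 0 z, Integrable (fun ω => |R ω| * Psi z t (W ω)) μ ∧
    ∫ ω, |R ω| * Psi z t (W ω) ∂μ ≤ e 0 * ∫ ω, Psi z t (W ω) ∂μ
  bound_K1 : ∀ t ∈ Set.Icc 0 z,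
    Integrable (fun ω => |condK1 μ W Khat ω - 1| * Psi z t (W ω)) μ ∧
    ∫ ω, |condK1 μ W Khat ω - 1| * Psi z t (W ω) ∂μ ≤ e 1 * ∫ ω, Psi z t (W ω) ∂μ
  bound_K2 : ∀ t ∈ Set.Icc 0 z,
    Integrable (fun p : Ω × ℝ =>
      (|p.2| * Real.exp (t * |p.2|) * |Khat p.1 p.2|) * Psi z t (W p.1)) (μ.prod volume) ∧
    ∫ p : Ω × ℝ, (|p.2| * Real.exp (t * |p.2|) * |Khat p.1 p.2|) * Psi z t (W p.1)
      ∂(μ.prod volume) ≤ e 2 * ∫ ω, Psi z t (W ω) ∂μ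
  bound_K2_unweighted :
    Integrable (fun p : Ω × ℝ =>
      |p.2| * Real.exp (z * |p.2|) * |Khat p.1 p.2|) (μ.prod volume) ∧
    ∫ p : Ω × ℝ, |p.2| * Real.exp (z * |p.2|) * |Khat p.1 p.2| ∂(μ.prod volume) ≤ 3 * e 2
  bound_K3 :
    Integrable (fun p : Ω × ℝ =>
      (Real.exp (2 * z * |p.2|) * (Khat p.1 p.2 - meanK μ Khat p.2) ^ 2) * Psi z z (W p.1))
      (μ.prod (volume.restrict (Set.Icc (-1) 1))) ∧
    ∫ p : Ω × ℝ,
      (Real.exp (2 * z * |p.2|) * (Khat p.1 p.2 - meanK μ Khat p.2) ^ 2) * Psi z z (W p.1)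
      ∂(μ.prod (volume.restrict (Set.Icc (-1) 1))) ≤ e 3 * ∫ ω, Psi z z (W ω) ∂μ
  bound_K4 :
    Integrable (fun p : Ω × ℝ =>
      (|p.2| * Real.exp (2 * z * |p.2|) * (Khat p.1 p.2 - meanK μ Khat p.2) ^ 2) * Psi z z (W p.1))
      (μ.prod (volume.restrict (Set.Icc (-1) 1))) ∧
    ∫ p : Ω × ℝ,
      (|p.2| * Real.exp (2 * z * |p.2|) * (Khat p.1 p.2 - meanK μ Khat p.2) ^ 2) * Psi z z (W p.1)
      ∂(μ.prod (volume.restrict (Set.Icc (-1) 1))) ≤ e 4 * ∫ ω, Psi z z (W ω) ∂μ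
  bound_M : IntegrableOn (fun u => Real.exp (z * |u|) * |meanK μ Khat u|) (Set.Icc (-1) 1) ∧
    ∫ u in Set.Icc (-1 : ℝ) 1, Real.exp (z * |u|) * |meanK μ Khat u| ≤ ρ

section

variable {Ω : Type*} [MeasurableSpace Ω] {μ : Measure Ω} [IsProbabilityMeasure μ]
  {W R : Ω → ℝ} {Khat : Ω → ℝ → ℝ}

/-- Almost every bound is taken at `β = z`. Since `t ≤ z` and `τ j ≥ 0`, the factor `1 + t ^ τ j`
can be frozen at `t = z`. -/
lemma CondA1.levelBounds (hW : Measurable W) (hR : Measurable R)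
    (hK : Measurable (Function.uncurry Khat)) (hS : SteinIdentity μ W R Khat)
    {m₀ ρ : ℝ} {r τ : Fin 5 → ℝ} (hA : CondA1 μ W R Khat m₀ ρ r τ) {z : ℝ} (hz : 0 ≤ z)
    (hzm : z ≤ m₀) (h0 : (1 + z) * (r 0 * (1 + z ^ τ 0)) ≤ 1)
    (h1 : (1 + z) ^ 2 * (r 1 * (1 + z ^ τ 1)) ≤ 1) (h2 : (1 + z) ^ 3 * (r 2 * (1 + z ^ τ 2)) ≤ 1) :
    LevelBounds μ W R Khat z ρ (fun j => r j * (1 + z ^ τ j)) := by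
  have hK' : Measurable fun p : Ω × ℝ => Khat p.1 p.2 := hK
  have hKb := measurable_meanK (μ := μ) hK
  have m0 : (0 : ℝ) ∈ Set.Icc 0 m₀ := ⟨le_rfl, hA.m₀_pos.le⟩
  have mz : z ∈ Set.Icc 0 m₀ := ⟨hz, hzm⟩
  have mono : ∀ j, ∀ t ∈ Set.Icc 0 z, r j * (1 + t ^ τ j) * (∫ ω, Psi z t (W ω) ∂μ)
      ≤ r j * (1 + z ^ τ j) * (∫ ω, Psi z t (W ω) ∂μ) := fun j t ht => by
    refine mul_le_mul_of_nonneg_right (mul_le_mul_of_nonneg_left ?_ (hA.r_nonneg j))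
      (integral_nonneg fun _ => (Psi_pos ht.1 _).le)
    have := Real.rpow_le_rpow ht.1 ht.2 (hA.τ_nonneg j)
    linarith
  have hK1i : Integrable (condK1 μ W Khat) μ := integrable_condExp
  have hRi : Integrable R μ := by
    have := ((hA.bound_R 0 m0 0 m0).integral_le hW hR.norm.aestronglyMeasurable
      (fun _ => abs_nonneg _) le_rfl (hA.r_nonneg 0)).1
    simp only [Psi_zero] at this
    have h := this.const_mul (1 / 2)
    refine (integrable_norm_iff hR.aestronglyMeasurable).1 (h.congr (ae_of_all _ fun ω => ?_))
    simp only [Real.norm_eq_abs]; ring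
  refine
  { meas_W := hW
    meas_R := hR
    meas_K := hK
    stein := hS
    int_K := integrable_Khat hK (hA.bound_K2 0 m0 0 m0) (hA.bound_K3 0 m0 0 m0) (hA.bound_M 0 m0)
    int_R := hRi
    z_nonneg := hz
    ρ_nonneg := hA.ρ_pos.le
    e_nonneg := fun j => mul_nonneg (hA.r_nonneg j) (by have := Real.rpow_nonneg hz (τ j); linarith)
    small_R := h0
    small_K1 := h1
    small_K2 := h2
    bound_R := fun t ht => ?_
    bound_K1 := fun t ht => ?_
    bound_K2 := fun t ht => ?_
    bound_K2_unweighted := ?_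
    bound_K3 := ?_
    bound_K4 := ?_
    bound_M := ?_ }
  · have := (hA.bound_R z mz t ⟨ht.1, ht.2.trans hzm⟩).integral_le hW hR.norm.aestronglyMeasurable
      (fun _ => abs_nonneg _) ht.1 (hA.r_nonneg 0)
    exact ⟨this.1, this.2.trans (mono 0 t ht)⟩
  · have := (hA.bound_K1 z mz t ⟨ht.1, ht.2.trans hzm⟩).integral_le hW
      (hK1i.aestronglyMeasurable.sub aestronglyMeasurable_const).norm
      (fun _ => abs_nonneg _) ht.1 (hA.r_nonneg 1)
    exact ⟨this.1, this.2.trans (mono 1 t ht)⟩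
  · have := WeightedBound.integral_prod_le hW (ν := volume)
      (F := fun p => |p.2| * Real.exp (t * |p.2|) * |Khat p.1 p.2|) (by fun_prop)
      (fun p => by positivity) ht.1 (hA.r_nonneg 2) (hA.bound_K2 z mz t ⟨ht.1, ht.2.trans hzm⟩)
    exact ⟨this.1, this.2.trans (mono 2 t ht)⟩
  -- Here `β = 0`: then `1 ≤ Ψ_{0,z} ≤ 3`, so the weight can be dropped on the left and costs the
  -- factor 3 on the right.
  · have := WeightedBound.integral_prod_le hW (ν := volume)
      (F := fun p => |p.2| * Real.exp (z * |p.2|) * |Khat p.1 p.2|) (by fun_prop)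
      (fun p => by positivity) hz (hA.r_nonneg 2) (hA.bound_K2 0 m0 z mz)
    have hle : ∀ p : Ω × ℝ, |p.2| * Real.exp (z * |p.2|) * |Khat p.1 p.2|
        ≤ (|p.2| * Real.exp (z * |p.2|) * |Khat p.1 p.2|) * Psi 0 z (W p.1) := fun p =>
      le_mul_of_one_le_right (by positivity) (one_le_Psi hz _)
    have hi : Integrable (fun p : Ω × ℝ =>
        |p.2| * Real.exp (z * |p.2|) * |Khat p.1 p.2|) (μ.prod volume) := by
      refine this.1.mono' (by fun_prop) (ae_of_all _ fun p => ?_)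
      rw [Real.norm_eq_abs, abs_of_nonneg (by positivity)]
      exact hle p
    refine ⟨hi, (integral_mono hi this.1 hle).trans (this.2.trans ?_)⟩
    have h3 : ∫ ω, Psi 0 z (W ω) ∂μ ≤ 3 := by
      have := integral_mono (integrable_Psi (μ := μ) hW hz) (integrable_const 3)
        (fun ω => (Psi_le_const (β := 0) hz (W ω)).trans (by norm_num))
      simpa using this
    have := mul_nonneg (hA.r_nonneg 2)
      (by have := Real.rpow_nonneg hz (τ 2); linarith : 0 ≤ 1 + z ^ τ 2)
    nlinarith
  · exact WeightedBound.integral_prod_le hW (ν := volume.restrict (Set.Icc (-1) 1))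
      (F := fun p => Real.exp (2 * z * |p.2|) * (Khat p.1 p.2 - meanK μ Khat p.2) ^ 2)
      (by fun_prop) (fun p => by positivity) hz (hA.r_nonneg 3) (hA.bound_K3 z mz z mz)
  · exact WeightedBound.integral_prod_le hW (ν := volume.restrict (Set.Icc (-1) 1))
      (F := fun p => |p.2| * Real.exp (2 * z * |p.2|) * (Khat p.1 p.2 - meanK μ Khat p.2) ^ 2)
      (by fun_prop) (fun p => by positivity) hz (hA.r_nonneg 4) (hA.bound_K4 z mz z mz)
  · exact integrable_and_integral_le_of_lintegral_le (by fun_prop) (fun u => by positivity)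
      hA.ρ_pos.le (hA.bound_M z mz)

variable {z ρ : ℝ} {e : Fin 5 → ℝ}

namespace LevelBounds

lemma int_W (H : LevelBounds μ W R Khat z ρ e) : Integrable W μ := integrable_W H.meas_W H.stein H.int_K H.int_R

end LevelBounds

end

/-! ### The three Stein errors -/

namespace LevelBounds

variable {Ω : Type*} [MeasurableSpace Ω] {μ : Measure Ω} {W R : Ω → ℝ}
  {Khat : Ω → ℝ → ℝ} {z ρ : ℝ} {e : Fin 5 → ℝ}

lemma e_zero_le (H : LevelBounds μ W R Khat z ρ e) : e 0 ≤ 1 := by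
  nlinarith [H.small_R, H.e_nonneg 0, H.z_nonneg, mul_nonneg H.z_nonneg (H.e_nonneg 0)]

lemma mul_e_zero_le (H : LevelBounds μ W R Khat z ρ e) : z * e 0 ≤ 1 := by
  nlinarith [H.small_R, H.e_nonneg 0]

lemma pow_mul_e_one_le (H : LevelBounds μ W R Khat z ρ e) {n : ℕ} (hn : n ≤ 2) :
    z ^ n * e 1 ≤ 1 := by
  refine le_trans (mul_le_mul_of_nonneg_right ?_ (H.e_nonneg 1)) H.small_K1
  have hz := H.z_nonneg
  exact (pow_le_pow_left₀ hz (by linarith) n).trans (pow_le_pow_right₀ (by linarith) hn)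

lemma pow_mul_e_two_le (H : LevelBounds μ W R Khat z ρ e) {n : ℕ} (hn : n ≤ 3) :
    z ^ n * e 2 ≤ 1 := by
  refine le_trans (mul_le_mul_of_nonneg_right ?_ (H.e_nonneg 2)) H.small_K2
  have hz := H.z_nonneg
  exact (pow_le_pow_left₀ hz (by linarith) n).trans (pow_le_pow_right₀ (by linarith) hn)

section Errors

variable {ι : Type*} {s : Finset ι} {c t : ι → ℝ}

/-- This and the next two lemmas allow a finite combination of weights with different `t`, because
the Stein solution is later dominated by such a sum rather than by one weight. -/
lemma abs_integral_R_le (H : LevelBounds μ W R Khat z ρ e) (hc : ∀ i ∈ s, 0 ≤ c i)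
    (ht : ∀ i ∈ s, t i ∈ Set.Icc 0 z) {f : ℝ → ℝ} (hf : ∀ w, |f w| ≤ ∑ i ∈ s, c i * Psi z (t i) w) :
    |∫ ω, R ω * f (W ω) ∂μ| ≤ e 0 * ∑ i ∈ s, c i * ∫ ω, Psi z (t i) (W ω) ∂μ := by
  have hi : ∀ i ∈ s, Integrable (fun ω => c i * (|R ω| * Psi z (t i) (W ω))) μ := fun i his =>
    (H.bound_R (t i) (ht i his)).1.const_mul (c i)
  rw [← Real.norm_eq_abs]
  refine (norm_integral_le_of_norm_le (integrable_finsetSum s hi) (ae_of_all _ fun ω => ?_)).trans ?_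
  · rw [norm_mul, Real.norm_eq_abs, Real.norm_eq_abs]
    refine (mul_le_mul_of_nonneg_left (hf (W ω)) (abs_nonneg _)).trans (le_of_eq ?_)
    rw [Finset.mul_sum]
    exact Finset.sum_congr rfl fun i _ => by ring
  · rw [integral_finsetSum s hi, Finset.mul_sum]
    refine Finset.sum_le_sum fun i his => ?_
    rw [integral_const_mul]
    refine (mul_le_mul_of_nonneg_left (H.bound_R (t i) (ht i his)).2 (hc i his)).trans
      (le_of_eq (by ring))

lemma abs_integral_condK1_le (H : LevelBounds μ W R Khat z ρ e) (hc : ∀ i ∈ s, 0 ≤ c i)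
    (ht : ∀ i ∈ s, t i ∈ Set.Icc 0 z) {f : ℝ → ℝ} (hf : ∀ w, |f w| ≤ ∑ i ∈ s, c i * Psi z (t i) w) :
    |∫ ω, (condK1 μ W Khat ω - 1) * f (W ω) ∂μ|
      ≤ e 1 * ∑ i ∈ s, c i * ∫ ω, Psi z (t i) (W ω) ∂μ := by
  have hi : ∀ i ∈ s, Integrable (fun ω =>
      c i * (|condK1 μ W Khat ω - 1| * Psi z (t i) (W ω))) μ := fun i his =>
    (H.bound_K1 (t i) (ht i his)).1.const_mul (c i)
  rw [← Real.norm_eq_abs]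
  refine (norm_integral_le_of_norm_le (integrable_finsetSum s hi) (ae_of_all _ fun ω => ?_)).trans ?_
  · rw [norm_mul, Real.norm_eq_abs, Real.norm_eq_abs]
    refine (mul_le_mul_of_nonneg_left (hf (W ω)) (abs_nonneg _)).trans (le_of_eq ?_)
    rw [Finset.mul_sum]
    exact Finset.sum_congr rfl fun i _ => by ring
  · rw [integral_finsetSum s hi, Finset.mul_sum]
    refine Finset.sum_le_sum fun i his => ?_
    rw [integral_const_mul]
    refine (mul_le_mul_of_nonneg_left (H.bound_K1 (t i) (ht i his)).2 (hc i his)).trans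
      (le_of_eq (by ring))

lemma abs_integral_Khat_le (H : LevelBounds μ W R Khat z ρ e) (hc : ∀ i ∈ s, 0 ≤ c i)
    (ht : ∀ i ∈ s, t i ∈ Set.Icc 0 z) {d : ℝ → ℝ → ℝ}
    (hd : ∀ w u, |d w u| ≤ |u| * ∑ i ∈ s, c i * (Real.exp (t i * |u|) * Psi z (t i) w)) :
    |∫ p : Ω × ℝ, d (W p.1) p.2 * Khat p.1 p.2 ∂(μ.prod volume)|
      ≤ e 2 * ∑ i ∈ s, c i * ∫ ω, Psi z (t i) (W ω) ∂μ := by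
  have hi : ∀ i ∈ s, Integrable (fun p : Ω × ℝ => c i * ((|p.2| * Real.exp (t i * |p.2|) *
      |Khat p.1 p.2|) * Psi z (t i) (W p.1))) (μ.prod volume) := fun i his =>
    (H.bound_K2 (t i) (ht i his)).1.const_mul (c i)
  rw [← Real.norm_eq_abs]
  refine (norm_integral_le_of_norm_le (integrable_finsetSum s hi) (ae_of_all _ fun p => ?_)).trans ?_
  · rw [norm_mul, Real.norm_eq_abs, Real.norm_eq_abs]
    refine (mul_le_mul_of_nonneg_right (hd (W p.1) p.2) (abs_nonneg _)).trans (le_of_eq ?_)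
    rw [Finset.mul_sum, Finset.sum_mul]
    exact Finset.sum_congr rfl fun i _ => by ring
  · rw [integral_finsetSum s hi, Finset.mul_sum]
    refine Finset.sum_le_sum fun i his => ?_
    rw [integral_const_mul]
    refine (mul_le_mul_of_nonneg_left (H.bound_K2 (t i) (ht i his)).2 (hc i his)).trans
      (le_of_eq (by ring))

end Errors

section SingleErrors

variable {c t : ℝ}

lemma abs_integral_R_le_single (H : LevelBounds μ W R Khat z ρ e) (hc : 0 ≤ c)
    (ht : t ∈ Set.Icc 0 z) {f : ℝ → ℝ} (hf : ∀ w, |f w| ≤ c * Psi z t w) :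
    |∫ ω, R ω * f (W ω) ∂μ| ≤ e 0 * (c * ∫ ω, Psi z t (W ω) ∂μ) := by
  simpa using H.abs_integral_R_le (s := {()}) (c := fun _ => c) (t := fun _ => t)
    (fun _ _ => hc) (fun _ _ => ht) (f := f) (by simpa using hf)

lemma abs_integral_condK1_le_single (H : LevelBounds μ W R Khat z ρ e) (hc : 0 ≤ c)
    (ht : t ∈ Set.Icc 0 z) {f : ℝ → ℝ} (hf : ∀ w, |f w| ≤ c * Psi z t w) :
    |∫ ω, (condK1 μ W Khat ω - 1) * f (W ω) ∂μ| ≤ e 1 * (c * ∫ ω, Psi z t (W ω) ∂μ) := by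
  simpa using H.abs_integral_condK1_le (s := {()}) (c := fun _ => c) (t := fun _ => t)
    (fun _ _ => hc) (fun _ _ => ht) (f := f) (by simpa using hf)

lemma abs_integral_Khat_le_single (H : LevelBounds μ W R Khat z ρ e) (hc : 0 ≤ c)
    (ht : t ∈ Set.Icc 0 z) {d : ℝ → ℝ → ℝ}
    (hd : ∀ w u, |d w u| ≤ c * (|u| * Real.exp (t * |u|) * Psi z t w)) :
    |∫ p : Ω × ℝ, d (W p.1) p.2 * Khat p.1 p.2 ∂(μ.prod volume)|
      ≤ e 2 * (c * ∫ ω, Psi z t (W ω) ∂μ) := by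
  simpa using H.abs_integral_Khat_le (s := {()}) (c := fun _ => c) (t := fun _ => t)
    (fun _ _ => hc) (fun _ _ => ht) (d := d) (fun w u => (hd w u).trans (le_of_eq (by
      simp; ring)))

end SingleErrors

variable [IsProbabilityMeasure μ]

/-- Add and subtract `g (W) K̂` inside the kernel integral, then condition on `W`. One exceptional
point `x₀` is harmless, because `W + u ≠ x₀` for almost every `u`; this admits the kink of the Stein
solution. -/
lemma stein_error (H : LevelBounds μ W R Khat z ρ e) {f g : ℝ → ℝ} {L : NNReal}
    (hf : LipschitzWith L f) {b b' : ℝ} (hb : ∀ x, |f x| ≤ b) (hg : Measurable g)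
    (hb' : ∀ x, |g x| ≤ b') (x₀ : ℝ) (hfg : ∀ x, x ≠ x₀ → HasDerivAt f (g x) x) :
    ∫ ω, W ω * f (W ω) ∂μ - ∫ ω, g (W ω) ∂μ = ∫ ω, R ω * f (W ω) ∂μ
      + ∫ ω, (condK1 μ W Khat ω - 1) * g (W ω) ∂μ
      + ∫ p : Ω × ℝ, (g (W p.1 + p.2) - g (W p.1)) * Khat p.1 p.2 ∂(μ.prod volume) := by
  have hWf : Integrable (fun ω => W ω * f (W ω)) μ :=
    H.int_W.mul_bdd (c := b) (hf.continuous.measurable.comp H.meas_W).aestronglyMeasurable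
      (ae_of_all _ fun _ => hb _)
  obtain ⟨hd, hid⟩ := stein_identity_of_lipschitz H.meas_W H.stein H.int_K H.int_R hf hb hWf
  have hae : (fun p : Ω × ℝ => deriv f (W p.1 + p.2) * Khat p.1 p.2) =ᵐ[μ.prod volume]
      fun p => g (W p.1 + p.2) * Khat p.1 p.2 := by
    have hms : MeasurableSet {p : Ω × ℝ | W p.1 + p.2 ≠ x₀} :=
      (((H.meas_W.comp measurable_fst).add measurable_snd) (measurableSet_singleton x₀)).compl
    have : ∀ᵐ p : Ω × ℝ ∂(μ.prod volume), W p.1 + p.2 ≠ x₀ := by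
      rw [Measure.ae_prod_iff_ae_ae hms]
      refine ae_of_all _ fun ω => ?_
      have : ∀ᵐ u : ℝ, u ≠ x₀ - W ω := Measure.ae_ne volume _
      filter_upwards [this] with u hu h
      exact hu (by linarith)
    filter_upwards [this] with p hp
    rw [(hfg _ hp).deriv]
  have hgu : Integrable (fun p : Ω × ℝ => g (W p.1 + p.2) * Khat p.1 p.2) (μ.prod volume) :=
    hd.congr hae
  have hgw : Integrable (fun p : Ω × ℝ => g (W p.1) * Khat p.1 p.2) (μ.prod volume) :=
    H.int_K.bdd_mul (c := b') (hg.comp (H.meas_W.comp measurable_fst)).aestronglyMeasurable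
      (ae_of_all _ fun p => hb' _)
  have hgW : Integrable (fun ω => g (W ω)) μ :=
    Integrable.of_bound (hg.comp H.meas_W).aestronglyMeasurable b' (ae_of_all _ fun _ => hb' _)
  have hgk : Integrable (fun ω => g (W ω) * condK1 μ W Khat ω) μ :=
    Integrable.bdd_mul (c := b') integrable_condExp (hg.comp H.meas_W).aestronglyMeasurable
      (ae_of_all _ fun _ => hb' _)
  rw [hid, integral_congr_ae hae]
  have e1 : ∫ p : Ω × ℝ, (g (W p.1 + p.2) - g (W p.1)) * Khat p.1 p.2 ∂(μ.prod volume)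
      = ∫ p : Ω × ℝ, g (W p.1 + p.2) * Khat p.1 p.2 ∂(μ.prod volume)
        - ∫ ω, g (W ω) * condK1 μ W Khat ω ∂μ := by
    rw [← integral_mul_Khat_eq_condK1 H.meas_W H.int_K hg hb', ← integral_sub hgu hgw]
    simp only [sub_mul]
  have e2 : ∫ ω, (condK1 μ W Khat ω - 1) * g (W ω) ∂μ
      = ∫ ω, g (W ω) * condK1 μ W Khat ω ∂μ - ∫ ω, g (W ω) ∂μ := by
    rw [← integral_sub hgk hgW]
    congr 1; ext ω; ring
  rw [e1, e2]; ring

/-! ### First moment and growth of `E Ψ` -/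

/-- Test with `arctan` at `t = 0`, where `Ψ = 2`: this gives `E[W arctan W] ≤ 1 + 2 (e 0 + e 1 + e
2) ≤ 7`, and `4/3 · 7 + 1 ≤ 11`. -/
lemma integral_abs_W_le (H : LevelBounds μ W R Khat z ρ e) : ∫ ω, |W ω| ∂μ ≤ 11 := by
  have m0 : (0 : ℝ) ∈ Set.Icc 0 z := ⟨le_rfl, H.z_nonneg⟩
  have hder : ∀ x : ℝ, HasDerivAt Real.arctan (1 / (1 + x ^ 2)) x := Real.hasDerivAt_arctan
  have hg1 : ∀ x : ℝ, |1 / (1 + x ^ 2)| ≤ 1 := fun x => by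
    rw [abs_of_pos (by positivity), div_le_one (by positivity)]; nlinarith [sq_nonneg x]
  have hf2 : ∀ x : ℝ, |Real.arctan x| ≤ 2 := fun x => by
    rw [abs_le]
    constructor <;> linarith [Real.neg_pi_div_two_lt_arctan x, Real.arctan_lt_pi_div_two x,
      Real.pi_lt_four]
  have hlip : LipschitzWith 1 Real.arctan := by
    refine lipschitzWith_of_nnnorm_deriv_le Real.differentiable_arctan fun x => ?_
    rw [← NNReal.coe_le_coe, coe_nnnorm, (hder x).deriv]
    exact hg1 x
  have hs := H.stein_error hlip hf2 (g := fun x => 1 / (1 + x ^ 2)) (by fun_prop) hg1 0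
    (fun x _ => hder x)
  have h0 := H.abs_integral_R_le_single (c := 1) zero_le_one m0 (f := Real.arctan)
    (fun w => by rw [Psi_zero]; linarith [hf2 w])
  have h1 := H.abs_integral_condK1_le_single (c := 1) zero_le_one m0
    (f := fun x => 1 / (1 + x ^ 2)) (fun w => by rw [Psi_zero]; linarith [hg1 w])
  have h2 := H.abs_integral_Khat_le_single (c := 1) zero_le_one m0
    (d := fun w u => 1 / (1 + (w + u) ^ 2) - 1 / (1 + w ^ 2)) (fun w u => by
      rw [Psi_zero, zero_mul, Real.exp_zero, div_sub_div _ _ (by positivity) (by positivity),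
        abs_div, abs_of_pos (a := (1 + (w + u) ^ 2) * (1 + w ^ 2)) (by positivity),
        div_le_iff₀ (by positivity),
        show 1 * (1 + w ^ 2) - (1 + (w + u) ^ 2) * 1 = -(u * (2 * w + u)) by ring, abs_neg, abs_mul,
        mul_one, one_mul, mul_assoc]
      refine mul_le_mul_of_nonneg_left (abs_le.2 ⟨?_, ?_⟩) (abs_nonneg u) <;>
        nlinarith [sq_nonneg (w + u), sq_nonneg w, sq_nonneg (w + u + 1), sq_nonneg (w + 1),
          sq_nonneg (w + u - 1), sq_nonneg (w - 1), mul_nonneg (sq_nonneg (w + u)) (sq_nonneg w)])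
  simp only [Psi_zero, integral_const, probReal_univ, one_smul, one_mul] at h0 h1 h2
  have he1 := H.pow_mul_e_one_le (n := 0) (by norm_num)
  have he2 := H.pow_mul_e_two_le (n := 0) (by norm_num)
  have he0 := H.e_zero_le
  have hg : ∫ ω, 1 / (1 + W ω ^ 2) ∂μ ≤ 1 := by
    have := integral_mono (μ := μ) (f := fun ω => 1 / (1 + W ω ^ 2)) (g := fun _ => 1)
      (Integrable.of_bound ((by fun_prop : Measurable fun x : ℝ => 1 / (1 + x ^ 2)).comp
        H.meas_W).aestronglyMeasurable 1 (ae_of_all _ fun ω => hg1 _))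
      (integrable_const 1) (fun ω => (le_abs_self _).trans (hg1 _))
    simpa using this
  have hWf : Integrable (fun ω => W ω * Real.arctan (W ω)) μ :=
    H.int_W.mul_bdd (c := 2) (Real.measurable_arctan.comp H.meas_W).aestronglyMeasurable
      (ae_of_all _ fun _ => hf2 _)
  -- For `|w| ≥ 1`, `arctan |w| ≥ π/4 > 3/4`; smaller `|w|` is absorbed by the summand 1.
  have hlow : ∀ w : ℝ, |w| ≤ 4 / 3 * (w * Real.arctan w) + 1 := by
    intro w
    wlog h : 0 ≤ w generalizing w with H
    · have := H (-w) (by linarith); rwa [Real.arctan_neg, neg_mul_neg, abs_neg] at this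
    rw [abs_of_nonneg h]
    have h0 : 0 ≤ Real.arctan w := Real.arctan_nonneg.2 h
    rcases le_total w 1 with h1 | h1
    · nlinarith
    · have : Real.pi / 4 ≤ Real.arctan w := by
        rw [← Real.arctan_one]; exact Real.arctan_strictMono.monotone h1
      nlinarith [Real.pi_gt_three]
  have := integral_mono H.int_W.abs ((hWf.const_mul (4 / 3)).add (integrable_const 1)) fun ω => hlow (W ω)
  simp only [Pi.add_apply] at this
  rw [integral_add (hWf.const_mul _) (integrable_const 1), integral_const_mul, integral_const,
    probReal_univ, one_smul] at this
  rw [abs_le] at h0 h1 h2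
  linarith

lemma lipschitzWith_Psi {β t : ℝ} (ht : 0 ≤ t) :
    LipschitzWith (Real.toNNReal (t * Real.exp (t * β))) (Psi β t) := by
  refine lipschitzWith_of_nnnorm_deriv_le (fun x => (hasDerivAt_Psi β t x).differentiableAt)
    fun x => ?_
  rw [← NNReal.coe_le_coe, coe_nnnorm, (hasDerivAt_Psi β t x).deriv, Real.coe_toNNReal',
    Real.norm_eq_abs, abs_of_nonneg (dPsi_nonneg ht x)]
  exact (dPsi_le_const ht x).trans (le_max_left _ _)

/-- The shift `a` serves two uses: `a = 1` in the differential inequality for `E Ψ`, and `a = 0` in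
the bound for `W Ψ - Ψ'`. It changes neither the derivative nor the bound `|Ψ - a| ≤ Ψ`, as `Ψ ≥ 1`.
-/
lemma integral_W_mul_Psi_sub_le (H : LevelBounds μ W R Khat z ρ e) {t : ℝ} (ht : t ∈ Set.Icc 0 z)
    {a : ℝ} (ha0 : 0 ≤ a) (ha1 : a ≤ 1) :
    ∫ ω, W ω * (Psi z t (W ω) - a) ∂μ - ∫ ω, dPsi z t (W ω) ∂μ
      ≤ (e 0 + z * e 1 + z ^ 2 * e 2) * ∫ ω, Psi z t (W ω) ∂μ := by
  have hf : LipschitzWith (Real.toNNReal (t * Real.exp (t * z))) fun w => Psi z t w - a := by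
    have := (lipschitzWith_Psi (β := z) ht.1).sub (LipschitzWith.const a)
    rwa [add_zero] at this
  have hfb : ∀ w, |Psi z t w - a| ≤ Psi z t w := fun w => by
    rw [abs_of_nonneg (by linarith [one_le_Psi (β := z) ht.1 w])]; linarith
  have hgb : ∀ w, |dPsi z t w| ≤ t * Psi z t w := fun w => by
    rw [abs_of_nonneg (dPsi_nonneg ht.1 w)]; exact dPsi_le ht.1 w
  have hs := H.stein_error hf (fun w => (hfb w).trans (Psi_le_const ht.1 w))
    (continuous_dPsi z t).measurable
    (fun w => (abs_of_nonneg (dPsi_nonneg ht.1 w)).le.trans (dPsi_le_const ht.1 w)) 0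
    (fun x _ => (hasDerivAt_Psi z t x).sub_const a)
  have h0 := H.abs_integral_R_le_single (c := 1) zero_le_one ht (f := fun w => Psi z t w - a)
    (fun w => by rw [one_mul]; exact hfb w)
  have h1 := H.abs_integral_condK1_le_single ht.1 ht hgb
  have h2 := H.abs_integral_Khat_le_single (sq_nonneg t) ht
    (d := fun w u => dPsi z t (w + u) - dPsi z t w) (fun w u => abs_dPsi_sub_le ht.1 w u)
  have hh : 0 ≤ ∫ ω, Psi z t (W ω) ∂μ := integral_nonneg fun _ => (Psi_pos ht.1 _).le
  rw [hs]
  have l1 : e 1 * (t * ∫ ω, Psi z t (W ω) ∂μ) ≤ z * e 1 * ∫ ω, Psi z t (W ω) ∂μ := by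
    rw [← mul_assoc, mul_comm (e 1)]
    exact mul_le_mul_of_nonneg_right (mul_le_mul_of_nonneg_right ht.2 (H.e_nonneg 1)) hh
  have l2 : e 2 * (t ^ 2 * ∫ ω, Psi z t (W ω) ∂μ) ≤ z ^ 2 * e 2 * ∫ ω, Psi z t (W ω) ∂μ := by
    rw [← mul_assoc, mul_comm (e 2)]
    exact mul_le_mul_of_nonneg_right (mul_le_mul_of_nonneg_right
      (pow_le_pow_left₀ ht.1 ht.2 2) (H.e_nonneg 2)) hh
  rw [abs_le] at h0 h1 h2
  linarith

/-- Grönwall's argument for `h(t) = E Ψ_{z,t}(W)`: `h' ≤ E[W (Ψ - 1)] ≤ E Ψ' + E h ≤ (t + E) h`,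
where the factor `E` is `e 0 + z * e 1 + z ^ 2 * e 2`. As `h(0) = 2` and `z E ≤ 3`, the result is at
most `2 e³ e^{t²/2}`, and `2 e³ ≤ 41`. -/
lemma integral_Psi_le (H : LevelBounds μ W R Khat z ρ e) {t : ℝ} (ht : t ∈ Set.Icc 0 z) :
    ∫ ω, Psi z t (W ω) ∂μ ≤ 41 * Real.exp (t ^ 2 / 2) := by
  have hz := H.z_nonneg
  set E := e 0 + z * e 1 + z ^ 2 * e 2 with hE
  have hE0 : 0 ≤ E := by
    have := H.e_nonneg 0; have := H.e_nonneg 1; have := H.e_nonneg 2; positivity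
  have hzE : z * E ≤ 3 := by
    have h0 := H.mul_e_zero_le
    have h1 := H.pow_mul_e_one_le (n := 2) le_rfl
    have h2 := H.pow_mul_e_two_le (n := 3) le_rfl
    rw [hE]; nlinarith
  have hmeas : ∀ t, AEStronglyMeasurable (fun ω => Psi z t (W ω)) μ := fun t =>
    ((continuous_Psi z t).measurable.comp H.meas_W).aestronglyMeasurable
  have hcont : ContinuousOn (fun t => ∫ ω, Psi z t (W ω) ∂μ) (Set.Icc 0 z) := by
    refine continuousOn_of_dominated (bound := fun _ => 2 * Real.exp (z * z) + 1)
      (fun t _ => hmeas t) (fun t ht => ae_of_all _ fun ω => ?_) (integrable_const _)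
      (ae_of_all _ fun ω => (continuous_Psi_param z (W ω)).continuousOn)
    rw [Real.norm_eq_abs, abs_of_pos (Psi_pos ht.1 _)]
    refine (Psi_le_const ht.1 _).trans ?_
    gcongr
    exact ht.2
  have hder : ∀ t ∈ Set.Ioo 0 z, Integrable (fun ω => dtPsi z t (W ω)) μ ∧
      HasDerivAt (fun t => ∫ ω, Psi z t (W ω) ∂μ) (∫ ω, dtPsi z t (W ω) ∂μ) t := fun t ht => by
    refine hasDerivAt_integral_of_dominated_loc_of_deriv_le (s := Set.Ioo 0 z)
      (bound := fun ω => (4 * z + |W ω|) * Real.exp (z * z)) (Ioo_mem_nhds ht.1 ht.2)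
      (Filter.Eventually.of_forall hmeas) (integrable_Psi H.meas_W ht.1.le)
      ((measurable_dtPsi z t).comp H.meas_W).aestronglyMeasurable
      (ae_of_all _ fun ω x hx => ?_)
      (((integrable_const _).add H.int_W.abs).mul_const _)
      (ae_of_all _ fun ω x _ => hasDerivAt_Psi_param z x (W ω))
    refine (abs_dtPsi_le hz hx.1.le _).trans ?_
    gcongr
    exact hx.2.le
  have hle : ∀ t ∈ Set.Ioo 0 z, ∫ ω, dtPsi z t (W ω) ∂μ ≤ (t + E) * ∫ ω, Psi z t (W ω) ∂μ := by
    intro t ht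
    have ht' : t ∈ Set.Icc 0 z := ⟨ht.1.le, ht.2.le⟩
    have h1 := H.integral_W_mul_Psi_sub_le ht' zero_le_one le_rfl
    have hi : Integrable (fun ω => W ω * (Psi z t (W ω) - 1)) μ := by
      refine H.int_W.mul_bdd (c := 2 * Real.exp (t * z) + 1)
        ((hmeas t).sub aestronglyMeasurable_const) (ae_of_all _ fun ω => ?_)
      have := one_le_Psi (β := z) ht.1.le (W ω)
      have := Psi_le_const (β := z) ht.1.le (W ω)
      rw [Real.norm_eq_abs, abs_of_nonneg (by linarith)]; linarith
    have h2 := integral_mono (hder t ht).1 hi fun ω => dtPsi_le ht.1.le (W ω)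
    have h3 : ∫ ω, dPsi z t (W ω) ∂μ ≤ t * ∫ ω, Psi z t (W ω) ∂μ := by
      rw [← integral_const_mul]
      refine integral_mono_of_nonneg (ae_of_all _ fun ω => dPsi_nonneg ht.1.le _)
        ((integrable_Psi H.meas_W ht.1.le).const_mul t) (ae_of_all _ fun ω => dPsi_le ht.1.le _)
    linarith
  -- The integrating factor turns the differential inequality into monotonicity, to be compared with
  -- `t = 0`.
  have hanti : AntitoneOn (fun t => (∫ ω, Psi z t (W ω) ∂μ) * Real.exp (-(t ^ 2 / 2 + E * t)))
      (Set.Icc 0 z) := by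
    have hd : ∀ t ∈ Set.Ioo 0 z,
        HasDerivAt (fun t => (∫ ω, Psi z t (W ω) ∂μ) * Real.exp (-(t ^ 2 / 2 + E * t)))
        ((∫ ω, dtPsi z t (W ω) ∂μ) * Real.exp (-(t ^ 2 / 2 + E * t)) +
          (∫ ω, Psi z t (W ω) ∂μ) * (Real.exp (-(t ^ 2 / 2 + E * t)) * -(t + E))) t := by
      intro t ht
      refine (hder t ht).2.mul (HasDerivAt.exp (HasDerivAt.neg ?_))
      have h1 := ((hasDerivAt_pow 2 t).div_const 2).add ((hasDerivAt_id t).const_mul E)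
      refine h1.congr_deriv ?_
      norm_num
    refine antitoneOn_of_deriv_nonpos (convex_Icc 0 z) (hcont.mul (by fun_prop)) ?_ ?_
    · rw [interior_Icc]
      exact fun t ht => (hd t ht).differentiableAt.differentiableWithinAt
    · rw [interior_Icc]
      intro t ht
      rw [(hd t ht).deriv]
      have := mul_le_mul_of_nonneg_right (hle t ht) (Real.exp_pos (-(t ^ 2 / 2 + E * t))).le
      linarith
  have h := hanti ⟨le_rfl, hz⟩ ht ht.1
  simp only [Psi_zero, integral_const, probReal_univ, one_smul] at h
  norm_num at h
  have hexp : Real.exp (t ^ 2 / 2 + E * t) ≤ Real.exp (t ^ 2 / 2) * (41 / 2) := by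
    rw [Real.exp_add]
    refine mul_le_mul_of_nonneg_left ?_ (Real.exp_pos _).le
    have h3 : E * t ≤ 3 := by nlinarith [ht.2]
    refine (Real.exp_le_exp.2 h3).trans ?_
    have : Real.exp 3 = Real.exp 1 ^ 3 := by rw [← Real.exp_nat_mul]; norm_num
    rw [this]
    calc Real.exp 1 ^ 3 ≤ 2.7182818286 ^ 3 :=
          pow_le_pow_left₀ (Real.exp_pos 1).le Real.exp_one_lt_d9.le 3
      _ ≤ 41 / 2 := by norm_num
  have h4 : (∫ ω, Psi z t (W ω) ∂μ) =
      ((∫ ω, Psi z t (W ω) ∂μ) * Real.exp (-(E * t) + -(t ^ 2 / 2)))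
        * Real.exp (t ^ 2 / 2 + E * t) := by
    rw [mul_assoc, ← Real.exp_add]; simp
  rw [h4]
  nlinarith [Real.exp_pos (t ^ 2 / 2 + E * t)]

end LevelBounds

/-! ### Replacing the random kernel by its mean -/

lemma integrable_indicator_prod {Ω : Type*} [MeasurableSpace Ω] {μ : Measure Ω} [SFinite μ]
    {S : Set ℝ} (hS : MeasurableSet S) {F : Ω × ℝ → ℝ}
    (hF : Integrable F (μ.prod (volume.restrict S))) :
    Integrable ((Set.univ ×ˢ S).indicator F) (μ.prod volume) ∧
    ∫ p, (Set.univ ×ˢ S).indicator F p ∂(μ.prod volume)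
      = ∫ p, F p ∂(μ.prod (volume.restrict S)) := by
  have h : μ.prod (volume.restrict S) = (μ.prod volume).restrict (Set.univ ×ˢ S) := by
    rw [← Measure.prod_restrict, Measure.restrict_univ]
  have hm : MeasurableSet ((Set.univ : Set Ω) ×ˢ S) := MeasurableSet.univ.prod hS
  rw [h] at hF ⊢
  exact ⟨(integrable_indicator_iff hm).2 hF, integral_indicator hm⟩

namespace LevelBounds

variable {Ω : Type*} [MeasurableSpace Ω] {μ : Measure Ω} {W R : Ω → ℝ}
  {Khat : Ω → ℝ → ℝ} {z ρ : ℝ} {e : Fin 5 → ℝ} [IsProbabilityMeasure μ]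

/-- `|K(u)| ≤ E|K̂(u)|` and Fubini reduce this to the second-kernel bound without the weight `Ψ`,
which is why that bound is kept separately. -/
lemma integral_mul_abs_meanK_le (H : LevelBounds μ W R Khat z ρ e) :
    IntegrableOn (fun u => |u| * Real.exp (z * |u|) * |meanK μ Khat u|) (Set.Icc (-1) 1) ∧
    ∫ u in Set.Icc (-1 : ℝ) 1, |u| * Real.exp (z * |u|) * |meanK μ Khat u| ≤ 3 * e 2 := by
  have hKb := measurable_meanK (μ := μ) H.meas_K
  obtain ⟨hi, hle⟩ := H.bound_K2_unweighted
  have hS := hi.integral_prod_right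
  have hpt : ∀ u, |u| * Real.exp (z * |u|) * |meanK μ Khat u|
      ≤ ∫ ω, |u| * Real.exp (z * |u|) * |Khat ω u| ∂μ := fun u => by
    rw [integral_const_mul]
    exact mul_le_mul_of_nonneg_left (abs_integral_le_integral_abs) (by positivity)
  have hi2 : Integrable (fun u => |u| * Real.exp (z * |u|) * |meanK μ Khat u|) := by
    refine hS.mono' (by fun_prop) (ae_of_all _ fun u => ?_)
    rw [Real.norm_eq_abs, abs_of_nonneg (by positivity)]
    exact hpt u
  refine ⟨hi2.integrableOn, ?_⟩
  calc _ ≤ ∫ u, |u| * Real.exp (z * |u|) * |meanK μ Khat u| :=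
        setIntegral_le_integral hi2 (ae_of_all _ fun u => by positivity)
    _ ≤ ∫ u, ∫ ω, |u| * Real.exp (z * |u|) * |Khat ω u| ∂μ := integral_mono hi2 hS hpt
    _ = _ := (integral_prod_symm _ hi).symm
    _ ≤ _ := hle

/-- The error from replacing `Khat` by its mean near the origin, for a bounded kernel `d`. -/
lemma abs_integral_kernel_le (H : LevelBounds μ W R Khat z ρ e) {d : ℝ → ℝ → ℝ}
    (hd : Measurable (Function.uncurry d)) {b : ℝ} (hb : ∀ w u, |d w u| ≤ b) {a : ℝ} (ha : 0 ≤ a)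
    (hfar : ∀ w u, 1 < |u| → |d w u| ≤ a * (|u| * Real.exp (z * |u|) * Psi z z w))
    {θ : ℝ → ℝ} (hθ : Measurable θ) (hθ0 : ∀ u, 0 < θ u) {A₃ A₄ bθ : ℝ} (hθb : ∀ u, θ u ≤ bθ)
    (hA₃ : 0 ≤ A₃) (hA₄ : 0 ≤ A₄)
    (hnear : ∀ w u, |u| ≤ 1 →
      |d w u| ≤ θ u * ((A₃ + A₄ * |u|) * (Real.exp (2 * z * |u|) * Psi z z w)))
    {j : ℝ → ℝ} (hj : ∀ u, |u| ≤ 1 → ∫ ω, |d (W ω) u| ∂μ ≤ j u)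
    (hji : IntegrableOn (fun u => (|meanK μ Khat u| + θ u / 2) * j u) (Set.Icc (-1) 1)) :
    |∫ p : Ω × ℝ, d (W p.1) p.2 * Khat p.1 p.2 ∂(μ.prod volume)|
      ≤ a * (e 2 * ∫ ω, Psi z z (W ω) ∂μ)
        + (∫ u in Set.Icc (-1 : ℝ) 1, (|meanK μ Khat u| + θ u / 2) * j u)
        + (A₃ * (e 3 * ∫ ω, Psi z z (W ω) ∂μ) + A₄ * (e 4 * ∫ ω, Psi z z (W ω) ∂μ)) / 2 := by
  have hW := H.meas_W
  have hK : Measurable fun p : Ω × ℝ => Khat p.1 p.2 := H.meas_K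
  have hKb := measurable_meanK (μ := μ) H.meas_K
  have mz : z ∈ Set.Icc 0 z := ⟨H.z_nonneg, le_rfl⟩
  obtain ⟨hi2, hl2⟩ := H.bound_K2 z mz
  obtain ⟨hi3, hl3⟩ := H.bound_K3
  obtain ⟨hi4, hl4⟩ := H.bound_K4
  set ν := volume.restrict (Set.Icc (-1 : ℝ) 1) with hν
  have hdm : Measurable fun p : Ω × ℝ => d (W p.1) p.2 :=
    hd.comp ((hW.comp measurable_fst).prodMk measurable_snd)
  have hMi : Integrable (fun u => |meanK μ Khat u| + θ u / 2) ν := by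
    refine Integrable.add ?_ (Integrable.of_bound (by fun_prop) (bθ / 2) (ae_of_all _ fun u => ?_))
    · refine H.bound_M.1.mono' (by fun_prop) (ae_of_all _ fun u => ?_)
      rw [Real.norm_eq_abs, abs_abs]
      exact le_mul_of_one_le_left (abs_nonneg _)
        (Real.one_le_exp (mul_nonneg H.z_nonneg (abs_nonneg u)))
    · rw [Real.norm_eq_abs, abs_of_pos (by have := hθ0 u; positivity)]
      linarith [hθb u]
  have hdi : Integrable (fun p : Ω × ℝ => (|meanK μ Khat p.2| + θ p.2 / 2) * |d (W p.1) p.2|)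
      (μ.prod ν) :=
    (hMi.comp_snd μ).mul_bdd (c := b) hdm.norm.aestronglyMeasurable
      (ae_of_all _ fun p => by rw [Real.norm_eq_abs, abs_abs]; exact hb _ _)
  have hdl : ∫ p : Ω × ℝ, (|meanK μ Khat p.2| + θ p.2 / 2) * |d (W p.1) p.2| ∂(μ.prod ν)
      ≤ ∫ u, (|meanK μ Khat u| + θ u / 2) * j u ∂ν := by
    rw [integral_prod_symm _ hdi]
    refine integral_mono_ae hdi.integral_prod_right hji ?_
    refine (ae_restrict_mem measurableSet_Icc).mono fun u hu => ?_
    simp only [integral_const_mul]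
    exact mul_le_mul_of_nonneg_left (hj u (abs_le.2 hu)) (by have := hθ0 u; positivity)
  -- Integrable majorant for `|u| ≤ 1`. It is extended by zero so that it can be added to the
  -- majorant for `|u| > 1` on the full product space.
  have hall := hdi.add (((hi3.const_mul A₃).add (hi4.const_mul A₄)).const_mul (1 / 2))
  obtain ⟨hI, hII⟩ := integrable_indicator_prod measurableSet_Icc hall
  have hbound := (hi2.const_mul a).add hI
  rw [← Real.norm_eq_abs]
  refine (norm_integral_le_of_norm_le hbound (ae_of_all _ fun p => ?_)).trans ?_
  · obtain ⟨ω, u⟩ := p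
    have hΨ := Psi_pos (β := z) H.z_nonneg (W ω)
    have hfst : 0 ≤ a * ((|u| * Real.exp (z * |u|) * |Khat ω u|) * Psi z z (W ω)) := by positivity
    rw [Real.norm_eq_abs, abs_mul]
    by_cases hu : u ∈ Set.Icc (-1 : ℝ) 1
    · have hmem : ((ω, u) : Ω × ℝ) ∈ (Set.univ : Set Ω) ×ˢ Set.Icc (-1 : ℝ) 1 := ⟨trivial, hu⟩
      simp only [Pi.add_apply, Set.indicator_of_mem hmem]
      refine le_add_of_nonneg_of_le hfst ?_
      have hn := hnear (W ω) u (abs_le.2 hu)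
      set Y := Khat ω u - meanK μ Khat u with hY
      have h1 : |Khat ω u| ≤ |Y| + |meanK μ Khat u| := by
        simpa [hY] using abs_add_le (Khat ω u - meanK μ Khat u) (meanK μ Khat u)
      have hθu := hθ0 u
      set B := (A₃ + A₄ * |u|) * (Real.exp (2 * z * |u|) * Psi z z (W ω)) with hB
      -- Young's inequality with weight `θ u`. The bound `|d| ≤ θ u * B` cancels the `θ u` in the
      -- denominator, so the fluctuation leaves exactly the integrands of `K3` and `K4`.
      have h2 : |Y| ≤ θ u / 2 + Y ^ 2 / (2 * θ u) := by
        rw [div_add_div _ _ two_ne_zero (by positivity), le_div_iff₀ (by positivity), ← sq_abs Y]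
        nlinarith [sq_nonneg (θ u - |Y|)]
      have h3 : |d (W ω) u| * (Y ^ 2 / (2 * θ u)) ≤ B * Y ^ 2 / 2 := by
        refine (mul_le_mul_of_nonneg_right hn (by positivity)).trans (le_of_eq ?_)
        field_simp
      have h4 : |d (W ω) u| * |Khat ω u|
          ≤ |d (W ω) u| * (θ u / 2 + Y ^ 2 / (2 * θ u) + |meanK μ Khat u|) :=
        mul_le_mul_of_nonneg_left (by linarith) (abs_nonneg _)
      have h5 : B * Y ^ 2 / 2 = 1 / 2 * (A₃ * (Real.exp (2 * z * |u|) * Y ^ 2 * Psi z z (W ω))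
          + A₄ * (|u| * Real.exp (2 * z * |u|) * Y ^ 2 * Psi z z (W ω))) := by
        rw [hB]; ring
      linarith
    · have hmem : ((ω, u) : Ω × ℝ) ∉ (Set.univ : Set Ω) ×ˢ Set.Icc (-1 : ℝ) 1 := fun h => hu h.2
      simp only [Pi.add_apply, Set.indicator_of_notMem hmem, add_zero]
      have h1 : 1 < |u| := by
        by_contra hlt
        exact hu (Set.mem_Icc.2 (abs_le.1 (not_lt.1 hlt)))
      refine (mul_le_mul_of_nonneg_right (hfar (W ω) u h1) (abs_nonneg _)).trans (le_of_eq ?_)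
      ring
  · rw [integral_add' (hi2.const_mul a) hI, hII, integral_add' hdi
      (((hi3.const_mul A₃).add (hi4.const_mul A₄)).const_mul (1 / 2)), integral_const_mul (1 / 2),
      integral_add' (hi3.const_mul A₃) (hi4.const_mul A₄), integral_const_mul, integral_const_mul,
      integral_const_mul]
    have k2 := mul_le_mul_of_nonneg_left hl2 ha
    have k3 := mul_le_mul_of_nonneg_left hl3 hA₃
    have k4 := mul_le_mul_of_nonneg_left hl4 hA₄
    linarith

end LevelBounds

/-! ### Concentration of the tilted law -/

/-- The trapezoidal bump centred at `c`, equal to `1` at distance at most `l / 2` and to `0` at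
distance at least `3 * l / 2`. -/
noncomputable def trap (c l w : ℝ) : ℝ := max 0 (min 1 (3 / 2 - |w - c| / l))

/-- The antiderivative of `trap c l` that vanishes at `c`. -/
noncomputable def trapInt (c l w : ℝ) : ℝ := ∫ s in c..w, trap c l s

lemma continuous_trap (c l : ℝ) : Continuous (trap c l) := by
  unfold trap; fun_prop

lemma trap_nonneg (c l w : ℝ) : 0 ≤ trap c l w := le_max_left _ _

lemma trap_le_one (c l w : ℝ) : trap c l w ≤ 1 := max_le zero_le_one (min_le_left _ _)

lemma trap_eq_one {c l w : ℝ} (hl : 0 < l) (h : |w - c| ≤ l / 2) : trap c l w = 1 := by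
  have h1 : |w - c| / l ≤ 1 / 2 := by rw [div_le_iff₀ hl]; linarith
  rw [trap, min_eq_left (by linarith), max_eq_right zero_le_one]

lemma trap_eq_zero {c l w : ℝ} (hl : 0 < l) (h : 3 * l / 2 ≤ |w - c|) : trap c l w = 0 := by
  have h1 : 3 / 2 ≤ |w - c| / l := by rw [le_div_iff₀ hl]; linarith
  exact max_eq_left ((min_le_right _ _).trans (by linarith))

lemma abs_trap_sub_le_one (c l x y : ℝ) : |trap c l x - trap c l y| ≤ 1 := by
  have := trap_nonneg c l x; have := trap_nonneg c l y
  have := trap_le_one c l x; have := trap_le_one c l y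
  rw [abs_le]; constructor <;> linarith

lemma abs_trap_sub_le {c l : ℝ} (hl : 0 < l) (x y : ℝ) :
    |trap c l x - trap c l y| ≤ |x - y| / l := by
  have h1 := abs_max_sub_max_le_abs (min 1 (3 / 2 - |x - c| / l)) (min 1 (3 / 2 - |y - c| / l)) 0
  have h2 := abs_min_sub_min_le_max 1 (3 / 2 - |x - c| / l) 1 (3 / 2 - |y - c| / l)
  rw [sub_self, abs_zero, max_eq_right (abs_nonneg _)] at h2
  have h3 : |3 / 2 - |x - c| / l - (3 / 2 - |y - c| / l)| ≤ |x - y| / l := by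
    rw [show 3 / 2 - |x - c| / l - (3 / 2 - |y - c| / l) = (|y - c| - |x - c|) / l by ring,
      abs_div, abs_of_pos hl]
    refine div_le_div_of_nonneg_right ?_ hl.le
    have := abs_abs_sub_abs_le_abs_sub (y - c) (x - c)
    rwa [show y - c - (x - c) = -(x - y) by ring, abs_neg] at this
  rw [max_comm _ (0 : ℝ), max_comm _ (0 : ℝ)] at h1
  exact h1.trans (h2.trans h3)

lemma hasDerivAt_trapInt (c l w : ℝ) : HasDerivAt (trapInt c l) (trap c l w) w :=
  intervalIntegral.integral_hasDerivAt_right ((continuous_trap c l).intervalIntegrable _ _)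
    ((continuous_trap c l).stronglyMeasurableAtFilter _ _) (continuous_trap c l).continuousAt

lemma abs_trapInt_sub_le (c l x y : ℝ) : |trapInt c l x - trapInt c l y| ≤ |x - y| := by
  have := Convex.norm_image_sub_le_of_norm_hasDerivWithin_le (f := trapInt c l)
    (f' := trap c l) (C := 1) (s := Set.univ) (x := y) (y := x)
    (fun x _ => (hasDerivAt_trapInt c l x).hasDerivWithinAt)
    (fun x _ => by rw [Real.norm_eq_abs, abs_of_nonneg (trap_nonneg _ _ _)]; exact trap_le_one _ _ _)
    convex_univ trivial trivial
  simpa using this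

lemma abs_trapInt_le {c l : ℝ} (hl : 0 < l) (w : ℝ) : |trapInt c l w| ≤ 3 * l := by
  set S := Set.Icc (c - 3 * l / 2) (c + 3 * l / 2)
  have hle : ∀ x, trap c l x ≤ S.indicator (fun _ => (1 : ℝ)) x := fun x => by
    by_cases hx : x ∈ S
    · rw [Set.indicator_of_mem hx]; exact trap_le_one _ _ _
    · rw [Set.indicator_of_notMem hx, trap_eq_zero hl]
      by_contra h
      have := abs_lt.1 (not_le.1 h)
      exact hx ⟨by linarith, by linarith⟩
  have hSi : Integrable (S.indicator (fun _ => (1 : ℝ))) :=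
    (integrable_indicator_iff measurableSet_Icc).2 (integrableOn_const measure_Icc_lt_top.ne)
  have hti : Integrable (trap c l) := hSi.mono' (continuous_trap c l).aestronglyMeasurable
    (ae_of_all _ fun x => by
      rw [Real.norm_eq_abs, abs_of_nonneg (trap_nonneg _ _ _)]; exact hle x)
  calc |trapInt c l w| ≤ ∫ x in Set.uIoc c w, ‖trap c l x‖ :=
        intervalIntegral.norm_integral_le_integral_norm_uIoc (f := trap c l) (a := c) (b := w)
    _ ≤ ∫ x, ‖trap c l x‖ := setIntegral_le_integral hti.norm (ae_of_all _ fun _ => norm_nonneg _)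
    _ ≤ ∫ x, S.indicator (fun _ => (1 : ℝ)) x := integral_mono hti.norm hSi fun x => by
        simpa only [Real.norm_eq_abs, abs_of_nonneg (trap_nonneg c l x)] using hle x
    _ = 3 * l := by
        rw [integral_indicator measurableSet_Icc, setIntegral_const, smul_eq_mul, mul_one,
          Real.volume_real_Icc_of_le (by linarith)]
        ring

namespace LevelBounds

variable {Ω : Type*} [MeasurableSpace Ω] {μ : Measure Ω} {W R : Ω → ℝ}
  {Khat : Ω → ℝ → ℝ} {z ρ : ℝ} {e : Fin 5 → ℝ} [IsProbabilityMeasure μ]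

/-- Bounding `Ψ'` by `z Ψ` would lose a factor `z`, so the absolute value is written as `D + 2 D⁻`
with `D = W Ψ - Ψ'`. The Stein identity bounds `E D` by `3 E Ψ`. The negative part lives on `w ≤ z`,
where it is at most `(z - w) Ψ`. -/
lemma integral_abs_tilt_le (H : LevelBounds μ W R Khat z ρ e) :
    Integrable (fun ω => |W ω * Psi z z (W ω) - dPsi z z (W ω)|) μ ∧
    ∫ ω, |W ω * Psi z z (W ω) - dPsi z z (W ω)| ∂μ ≤ 311 * Real.exp (z ^ 2 / 2) := by
  have hz := H.z_nonneg
  have mz : z ∈ Set.Icc 0 z := ⟨hz, le_rfl⟩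
  have hWi := H.int_W
  have hWΨ : Integrable (fun ω => W ω * Psi z z (W ω)) μ :=
    hWi.mul_bdd (c := 2 * Real.exp (z * z) + 1)
      ((continuous_Psi z z).measurable.comp H.meas_W).aestronglyMeasurable
      (ae_of_all _ fun ω => by
        rw [Real.norm_eq_abs, abs_of_pos (Psi_pos hz _)]; exact Psi_le_const hz _)
  have hdΨ : Integrable (fun ω => dPsi z z (W ω)) μ :=
    Integrable.of_bound ((continuous_dPsi z z).measurable.comp H.meas_W).aestronglyMeasurable
      (z * Real.exp (z * z)) (ae_of_all _ fun ω => by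
        rw [Real.norm_eq_abs, abs_of_nonneg (dPsi_nonneg hz _)]; exact dPsi_le_const hz _)
  have hD := hWΨ.sub hdΨ
  refine ⟨hD.abs, ?_⟩
  set X := Real.exp (z ^ 2 / 2) with hX
  have hX1 : 1 ≤ X := Real.one_le_exp (by positivity)
  have hzX : z ≤ X := by nlinarith [Real.add_one_le_exp (z ^ 2 / 2), sq_nonneg (z - 1)]
  have hEW := H.integral_abs_W_le
  have hEW0 : 0 ≤ ∫ ω, |W ω| ∂μ := integral_nonneg fun _ => abs_nonneg _
  -- For `z ≥ 1`, `(z - w) e^{zw} ≤ e^z e^{(z-1)w}`: lowering the tilt by one absorbs the linear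
  -- factor, and `e^z e^{(z-1)²/2} = e^{1/2} e^{z²/2}`. For `z ≤ 1` the exponential is at most 3 and
  -- the first moment suffices.
  obtain ⟨B, hBi, hBle, hB0, hB⟩ : ∃ B : ℝ → ℝ, Integrable (fun ω => B (W ω)) μ ∧
      ∫ ω, B (W ω) ∂μ ≤ 82 * X ∧ (∀ w, 0 ≤ B w) ∧
      ∀ w ≤ z, (z - w) * Real.exp (z * w) ≤ B w := by
    rcases le_total 1 z with h1 | h1
    · have mz1 : z - 1 ∈ Set.Icc 0 z := ⟨by linarith, by linarith⟩
      refine ⟨fun w => Real.exp z * Psi z (z - 1) w,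
        (integrable_Psi H.meas_W mz1.1).const_mul _, ?_,
        fun w => mul_nonneg (Real.exp_pos _).le (Psi_pos mz1.1 _).le, fun w hw => ?_⟩
      · rw [integral_const_mul]
        refine (mul_le_mul_of_nonneg_left (H.integral_Psi_le mz1) (Real.exp_pos _).le).trans ?_
        have : Real.exp z * (41 * Real.exp ((z - 1) ^ 2 / 2)) = 41 * (X * Real.exp (1 / 2)) := by
          rw [hX, ← Real.exp_add, mul_left_comm, ← Real.exp_add]; ring_nf
        rw [this]
        have h2 : Real.exp (1 / 2) ≤ 2 := by
          have : Real.exp (1 / 2) ^ 2 = Real.exp 1 := by rw [← Real.exp_nat_mul]; norm_num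
          nlinarith [Real.exp_one_lt_d9, Real.exp_pos (1 / 2)]
        nlinarith
      · have h2 := exp_min_le_Psi (β := z) mz1.1 w
        rw [min_eq_left hw] at h2
        have h3 := Real.add_one_le_exp (z - w)
        calc (z - w) * Real.exp (z * w) ≤ Real.exp (z - w) * Real.exp (z * w) := by
              gcongr; linarith
          _ = Real.exp z * Real.exp ((z - 1) * w) := by
              rw [← Real.exp_add, ← Real.exp_add]; ring_nf
          _ ≤ _ := mul_le_mul_of_nonneg_left h2 (Real.exp_pos _).le
    · refine ⟨fun w => 3 * (1 + |w|), ((integrable_const 1).add hWi.abs).const_mul 3, ?_,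
        fun w => by positivity, fun w hw => ?_⟩
      · rw [integral_const_mul, integral_add (integrable_const 1) hWi.abs, integral_const,
          probReal_univ, one_smul]
        linarith
      · have h2 : Real.exp (z * w) ≤ 3 := by
          refine (Real.exp_le_exp.2 (by nlinarith : z * w ≤ 1)).trans ?_
          linarith [Real.exp_one_lt_d9]
        have h3 : z - w ≤ 1 + |w| := by linarith [neg_abs_le w]
        nlinarith [Real.exp_pos (z * w), sub_nonneg.2 hw]
  have hpt : ∀ w, |w * Psi z z w - dPsi z z w|
      ≤ (w * Psi z z w - dPsi z z w) + 2 * (B w + (z + |w|)) := by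
    intro w
    have h1 := dPsi_le (β := z) hz w
    have h2 := one_le_Psi (β := z) hz w
    rcases le_total z w with hw | hw
    · rw [abs_of_nonneg (by nlinarith)]
      linarith [hB0 w, abs_nonneg w]
    · have h3 := hB w hw
      have h4 : (z - w) * Psi z z w ≤ B w + (z + |w|) := by
        rw [Psi_of_le hw, mul_add, mul_one]; linarith [neg_abs_le w]
      rw [abs_le]
      constructor
      · nlinarith
      · linarith [hB0 w, abs_nonneg w]
  have hi2 : Integrable (fun ω => 2 * (B (W ω) + (z + |W ω|))) μ :=
    (hBi.add ((integrable_const z).add hWi.abs)).const_mul 2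
  have hs := integral_mono hD.abs (hD.add hi2) fun ω => hpt (W ω)
  have e1 : ∫ ω, 2 * (B (W ω) + (z + |W ω|)) ∂μ
      = 2 * ((∫ ω, B (W ω) ∂μ) + (z + ∫ ω, |W ω| ∂μ)) := by
    have hzW : Integrable (fun ω => z + |W ω|) μ := (integrable_const z).add hWi.abs
    rw [integral_const_mul, integral_add hBi hzW, integral_add (integrable_const z) hWi.abs, integral_const, probReal_univ, one_smul]
  rw [integral_add' hD hi2, integral_sub' hWΨ hdΨ, e1] at hs
  have h3 := H.integral_W_mul_Psi_sub_le mz (a := 0) le_rfl zero_le_one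
  simp only [sub_zero] at h3
  have h4 := H.integral_Psi_le mz
  have h5 : 0 ≤ ∫ ω, Psi z z (W ω) ∂μ := integral_nonneg fun _ => (Psi_pos hz _).le
  have h6 : e 0 + z * e 1 + z ^ 2 * e 2 ≤ 3 := by
    have := H.e_zero_le
    have := H.pow_mul_e_one_le (n := 1) (by norm_num)
    have := H.pow_mul_e_two_le (n := 2) (by norm_num)
    rw [pow_one] at *
    linarith
  have h7 := mul_le_mul_of_nonneg_right h6 h5
  refine hs.trans ?_
  linarith

lemma integrable_indicator_Psi (H : LevelBounds μ W R Khat z ρ e) {S : Set ℝ}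
    (hS : MeasurableSet S) : Integrable (fun ω => S.indicator (Psi z z) (W ω)) μ := by
  refine (integrable_Psi (β := z) H.meas_W H.z_nonneg).mono'
    (((continuous_Psi z z).measurable.indicator hS).comp H.meas_W).aestronglyMeasurable
    (ae_of_all _ fun ω => ?_)
  rw [Real.norm_eq_abs, abs_of_nonneg (Set.indicator_nonneg (fun _ _ => (Psi_pos H.z_nonneg _).le) _)]
  exact Set.indicator_le_self' (fun _ _ => (Psi_pos H.z_nonneg _).le) _

/-- Concentration inequality for the tilted law of `W`. -/
lemma integral_indicator_Psi_le (H : LevelBounds μ W R Khat z ρ e) {l : ℝ} (hl : 0 < l)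
    (hle : 72 * e 2 ≤ l) (x : ℝ) :
    ∫ ω, (Set.Icc x (x + l)).indicator (Psi z z) (W ω) ∂μ
      ≤ 2604 * ((l + e 1 + (1 + z) * e 2 + e 3) * Real.exp (z ^ 2 / 2)) := by
  have hz := H.z_nonneg
  have mz : z ∈ Set.Icc 0 z := ⟨hz, le_rfl⟩
  have hW := H.meas_W
  have hP0 : ∀ w, 0 < Psi z z w := Psi_pos hz
  set h := ∫ ω, Psi z z (W ω) ∂μ with hh
  have hh0 : 0 ≤ h := integral_nonneg fun _ => (hP0 _).le
  set X := Real.exp (z ^ 2 / 2) with hX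
  have hX0 : 0 < X := Real.exp_pos _
  have hhX : h ≤ 41 * X := H.integral_Psi_le mz
  set q : ℝ → ℝ := fun x => ∫ ω, (Set.Icc x (x + l)).indicator (Psi z z) (W ω) ∂μ with hq
  have hqh : ∀ x, q x ≤ h := fun x =>
    integral_mono (H.integrable_indicator_Psi measurableSet_Icc) (integrable_Psi hW hz)
      fun ω => Set.indicator_le_self' (fun _ _ => (hP0 _).le) _
  have hqb : BddAbove (Set.range q) := ⟨h, by rintro _ ⟨x, rfl⟩; exact hqh x⟩
  -- The largest window mass over all positions. It is finite because `q ≤ h`, which is what permits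
  -- absorbing `κ / 2` at the end.
  set κ := ⨆ x, q x with hκ
  have hqκ : ∀ x, q x ≤ κ := fun x => le_ciSup hqb x
  have hκ0 : 0 ≤ κ := le_trans
    (integral_nonneg fun _ => Set.indicator_nonneg (fun _ _ => (hP0 _).le) _) (hqκ 0)
  -- The support of the bump has length `3 l` and is covered by three windows of length `l`.
  have h3κ : ∀ a, ∫ ω, (Set.Icc (a - 3 * l / 2) (a + 3 * l / 2)).indicator (Psi z z) (W ω) ∂μ
      ≤ 3 * κ := by
    intro a
    have hi : ∀ y, Integrable (fun ω => (Set.Icc y (y + l)).indicator (Psi z z) (W ω)) μ :=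
      fun y => H.integrable_indicator_Psi measurableSet_Icc
    have hpt : ∀ w, (Set.Icc (a - 3 * l / 2) (a + 3 * l / 2)).indicator (Psi z z) w
        ≤ (Set.Icc (a - 3 * l / 2) (a - 3 * l / 2 + l)).indicator (Psi z z) w
          + (Set.Icc (a - l / 2) (a - l / 2 + l)).indicator (Psi z z) w
          + (Set.Icc (a + l / 2) (a + l / 2 + l)).indicator (Psi z z) w := by
      intro w
      have hn : ∀ S : Set ℝ, 0 ≤ S.indicator (Psi z z) w := fun S =>
        Set.indicator_nonneg (fun _ _ => (hP0 _).le) _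
      by_cases hw : w ∈ Set.Icc (a - 3 * l / 2) (a + 3 * l / 2)
      · rw [Set.indicator_of_mem hw]
        rcases le_total w (a - l / 2) with h1 | h1
        · rw [Set.indicator_of_mem (s := Set.Icc (a - 3 * l / 2) _) ⟨hw.1, by linarith⟩]
          linarith [hn (Set.Icc (a - l / 2) (a - l / 2 + l)),
            hn (Set.Icc (a + l / 2) (a + l / 2 + l))]
        rcases le_total w (a + l / 2) with h2 | h2
        · rw [Set.indicator_of_mem (s := Set.Icc (a - l / 2) _) ⟨h1, by linarith⟩]
          linarith [hn (Set.Icc (a - 3 * l / 2) (a - 3 * l / 2 + l)),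
            hn (Set.Icc (a + l / 2) (a + l / 2 + l))]
        · rw [Set.indicator_of_mem (s := Set.Icc (a + l / 2) _) ⟨h2, by linarith [hw.2]⟩]
          linarith [hn (Set.Icc (a - 3 * l / 2) (a - 3 * l / 2 + l)),
            hn (Set.Icc (a - l / 2) (a - l / 2 + l))]
      · rw [Set.indicator_of_notMem hw]
        exact add_nonneg (add_nonneg (hn _) (hn _)) (hn _)
    have := integral_mono (H.integrable_indicator_Psi measurableSet_Icc)
      (((hi _).add (hi _)).add (hi _)) fun ω => hpt (W ω)
    rw [integral_add' ((hi _).add (hi _)) (hi _), integral_add' (hi _) (hi _)] at this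
    have := hqκ (a - 3 * l / 2)
    have := hqκ (a - l / 2)
    have := hqκ (a + l / 2)
    simp only [hq] at *
    linarith
  have main : ∀ y, q y ≤ 1302 * ((l + e 1 + (1 + z) * e 2 + e 3) * X) + κ / 2 := by
    intro y
    set c := y + l / 2 with hc
    set φ := trap c l with hφ
    set F := trapInt c l with hF
    have hφ0 : ∀ w, 0 ≤ φ w := trap_nonneg c l
    have hφ1 : ∀ w, φ w ≤ 1 := trap_le_one c l
    have hFb : ∀ w, |F w| ≤ 3 * l := abs_trapInt_le hl
    have hφc : Continuous φ := continuous_trap c l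
    have hFc : Continuous F :=
      continuous_iff_continuousAt.2 fun w => (hasDerivAt_trapInt c l w).continuousAt
    have hΨc := continuous_Psi z z
    have hdc := continuous_dPsi z z
    have hΨM : ∀ w, Psi z z w ≤ 2 * Real.exp (z * z) + 1 := Psi_le_const hz
    set M₀ := 2 * Real.exp (z * z) + 1 with hM₀
    have hM0 : 0 ≤ M₀ := by positivity
    -- The test function is `Ψ F` with `F' = φ`, so `Ψ φ = (w Ψ - Ψ') F - (w Ψ F - g)`. The first
    -- term is small because `|F| ≤ 3 l`, the second by `stein_error`.
    set g : ℝ → ℝ := fun w => dPsi z z w * F w + Psi z z w * φ w with hg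
    have hfg : ∀ w, HasDerivAt (fun w => Psi z z w * F w) (g w) w := fun w =>
      (hasDerivAt_Psi z z w).mul (hasDerivAt_trapInt c l w)
    have hgΨ : ∀ w, |g w| ≤ (3 * l * z + 1) * Psi z z w := fun w => by
      refine (abs_add_le _ _).trans ?_
      rw [abs_mul, abs_mul, abs_of_nonneg (dPsi_nonneg hz w), abs_of_pos (hP0 w),
        abs_of_nonneg (hφ0 w)]
      have h1 := mul_le_mul (dPsi_le (β := z) hz w) (hFb w) (abs_nonneg _)
        (mul_nonneg hz (hP0 w).le)
      have h2 := mul_le_mul_of_nonneg_left (hφ1 w) (hP0 w).le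
      linarith
    have hgM : ∀ w, |g w| ≤ (3 * l * z + 1) * M₀ := fun w =>
      (hgΨ w).trans (mul_le_mul_of_nonneg_left (hΨM w) (by positivity))
    have hfL : LipschitzWith (Real.toNNReal ((3 * l * z + 1) * M₀))
        (fun w => Psi z z w * F w) := by
      refine lipschitzWith_of_nnnorm_deriv_le (fun x => (hfg x).differentiableAt) fun x => ?_
      rw [← NNReal.coe_le_coe, coe_nnnorm, (hfg x).deriv, Real.coe_toNNReal']
      exact (hgM x).trans (le_max_left _ _)
    have hfΨ : ∀ w, |Psi z z w * F w| ≤ 3 * l * Psi z z w := fun w => by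
      rw [abs_mul, abs_of_pos (hP0 w), mul_comm]
      exact mul_le_mul_of_nonneg_right (hFb w) (hP0 w).le
    have hgm : Measurable g := by rw [hg]; fun_prop
    have hs := H.stein_error hfL
      (fun w => (hfΨ w).trans (mul_le_mul_of_nonneg_left (hΨM w) (by positivity)))
      hgm hgM 0 (fun w _ => hfg w)
    have t0 := H.abs_integral_R_le_single (by positivity) mz hfΨ
    have t1 := H.abs_integral_condK1_le_single (by positivity) mz hgΨ
    -- The slope of `φ` is of order `1 / l`, so only this part of the increment of `g` needs window
    -- masses. The remainder `d₁` is of order `|u|` without a factor `1 / l`.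
    set d₂ : ℝ → ℝ → ℝ := fun w u => Psi z z w * (φ (w + u) - φ w) with hd₂
    set d₁ : ℝ → ℝ → ℝ := fun w u => g (w + u) - g w - d₂ w u with hd₁
    have hd₂b : ∀ w u, |d₂ w u| ≤ Psi z z w := fun w u => by
      rw [hd₂, abs_mul, abs_of_pos (hP0 w)]
      exact mul_le_of_le_one_right (hP0 w).le (abs_trap_sub_le_one _ _ _ _)
    have hd₂m : Measurable (Function.uncurry d₂) := by
      rw [hd₂]; unfold Function.uncurry; fun_prop
    have hd₁b : ∀ w u, |d₁ w u|
        ≤ (3 * l * z ^ 2 + 2 * z) * (|u| * Real.exp (z * |u|) * Psi z z w) := fun w u => by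
      have he : d₁ w u = (dPsi z z (w + u) - dPsi z z w) * F (w + u)
          + dPsi z z w * (F (w + u) - F w) + (Psi z z (w + u) - Psi z z w) * φ (w + u) := by
        simp only [hd₁, hd₂, hg]; ring
      rw [he]
      refine (abs_add_le _ _).trans ((add_le_add_left (abs_add_le _ _) _).trans ?_)
      rw [abs_mul, abs_mul, abs_mul, abs_of_nonneg (dPsi_nonneg hz w),
        abs_of_nonneg (hφ0 (w + u))]
      have k1 := mul_le_mul (abs_dPsi_sub_le (β := z) hz w u) (hFb (w + u)) (abs_nonneg _)
        (mul_nonneg (sq_nonneg z) (by have := hP0 w; positivity))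
      have k2 : |F (w + u) - F w| ≤ |u| := by
        simpa using abs_trapInt_sub_le c l (w + u) w
      have k3 := mul_le_mul (dPsi_le (β := z) hz w) k2 (abs_nonneg _) (mul_nonneg hz (hP0 w).le)
      have k4 := mul_le_mul (abs_Psi_sub_le (β := z) hz w u) (hφ1 (w + u)) (hφ0 _)
        (mul_nonneg hz (by have := hP0 w; positivity))
      have k5 : z * Psi z z w * |u| ≤ z * (|u| * Real.exp (z * |u|) * Psi z z w) := by
        have : 1 ≤ Real.exp (z * |u|) := Real.one_le_exp (by positivity)
        have := mul_le_mul_of_nonneg_left this (by have := hP0 w; positivity :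
          0 ≤ z * Psi z z w * |u|)
        linarith
      linarith
    have t2 := H.abs_integral_Khat_le_single (by positivity) mz hd₁b
    have hd₂M : ∀ w u, |d₂ w u| ≤ M₀ := fun w u => (hd₂b w u).trans (hΨM w)
    have hWu : Measurable fun p : Ω × ℝ => W p.1 + p.2 :=
      (hW.comp measurable_fst).add measurable_snd
    have hW1 : Measurable fun p : Ω × ℝ => W p.1 := hW.comp measurable_fst
    have hi₂ : Integrable (fun p : Ω × ℝ => d₂ (W p.1) p.2 * Khat p.1 p.2) (μ.prod volume) :=
      H.int_K.bdd_mul (c := M₀) (hd₂m.comp (hW1.prodMk measurable_snd)).aestronglyMeasurable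
        (ae_of_all _ fun p => hd₂M _ _)
    have hi : Integrable (fun p : Ω × ℝ => (g (W p.1 + p.2) - g (W p.1)) * Khat p.1 p.2)
        (μ.prod volume) :=
      H.int_K.bdd_mul (c := (3 * l * z + 1) * M₀ + (3 * l * z + 1) * M₀)
        ((hgm.comp hWu).sub (hgm.comp hW1)).aestronglyMeasurable
        (ae_of_all _ fun p => (abs_sub _ _).trans (add_le_add (hgM _) (hgM _)))
    have hsplit : ∫ p : Ω × ℝ, d₁ (W p.1) p.2 * Khat p.1 p.2 ∂(μ.prod volume)
        = ∫ p : Ω × ℝ, (g (W p.1 + p.2) - g (W p.1)) * Khat p.1 p.2 ∂(μ.prod volume)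
          - ∫ p : Ω × ℝ, d₂ (W p.1) p.2 * Khat p.1 p.2 ∂(μ.prod volume) := by
      rw [← integral_sub hi hi₂]
      simp only [hd₁, sub_mul]
    -- The increment vanishes unless `w` or `w + u` lies in the support of the bump, that is, unless
    -- `w` lies in one of two sets of tilted mass at most `3 κ`.
    have hJ : ∀ u, ∫ ω, |d₂ (W ω) u| ∂μ ≤ min 1 (|u| / l) * (6 * κ) := by
      intro u
      have hpt : ∀ w, |d₂ w u| ≤ min 1 (|u| / l) *
          ((Set.Icc (c - 3 * l / 2) (c + 3 * l / 2)).indicator (Psi z z) w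
          + (Set.Icc (c - u - 3 * l / 2) (c - u + 3 * l / 2)).indicator (Psi z z) w) := by
        intro w
        have hn : ∀ S : Set ℝ, 0 ≤ S.indicator (Psi z z) w := fun S =>
          Set.indicator_nonneg (fun _ _ => (hP0 _).le) _
        have hmin : |φ (w + u) - φ w| ≤ min 1 (|u| / l) := by
          refine le_min (abs_trap_sub_le_one _ _ _ _) ?_
          simpa using abs_trap_sub_le (c := c) hl (w + u) w
        have hm0 : 0 ≤ min 1 (|u| / l) := le_min zero_le_one (by positivity)
        rw [hd₂, abs_mul, abs_of_pos (hP0 w), mul_comm]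
        by_cases h1 : w ∈ Set.Icc (c - 3 * l / 2) (c + 3 * l / 2)
        · rw [Set.indicator_of_mem h1]
          exact mul_le_mul hmin (le_add_of_nonneg_right (hn _)) (hP0 w).le hm0
        by_cases h2 : w ∈ Set.Icc (c - u - 3 * l / 2) (c - u + 3 * l / 2)
        · rw [Set.indicator_of_mem h2]
          exact mul_le_mul hmin (le_add_of_nonneg_left (hn _)) (hP0 w).le hm0
        · have z1 : φ w = 0 := by
            refine trap_eq_zero hl ?_
            by_contra hlt
            have := abs_lt.1 (not_le.1 hlt)
            exact h1 ⟨by linarith, by linarith⟩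
          have z2 : φ (w + u) = 0 := by
            refine trap_eq_zero hl ?_
            by_contra hlt
            have := abs_lt.1 (not_le.1 hlt)
            exact h2 ⟨by linarith, by linarith⟩
          rw [z1, z2, sub_zero, abs_zero, zero_mul]
          exact mul_nonneg hm0 (add_nonneg (hn _) (hn _))
      have hi1 := H.integrable_indicator_Psi
        (measurableSet_Icc : MeasurableSet (Set.Icc (c - 3 * l / 2) (c + 3 * l / 2)))
      have hi2 := H.integrable_indicator_Psi
        (measurableSet_Icc : MeasurableSet (Set.Icc (c - u - 3 * l / 2) (c - u + 3 * l / 2)))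
      refine (integral_mono_of_nonneg (ae_of_all _ fun ω => abs_nonneg _)
        ((hi1.add hi2).const_mul _) (ae_of_all _ fun ω => hpt (W ω))).trans ?_
      simp only [Pi.add_apply]
      rw [integral_const_mul, integral_add hi1 hi2]
      refine mul_le_mul_of_nonneg_left ?_ (le_min zero_le_one (by positivity))
      linarith [h3κ c, h3κ (c - u)]
    obtain ⟨hKi, hKl⟩ := H.integral_mul_abs_meanK_le
    have hKb := measurable_meanK (μ := μ) H.meas_K
    have hji : IntegrableOn (fun u => (|meanK μ Khat u| + (1 / 24) / 2) *
        (min 1 (|u| / l) * (6 * κ))) (Set.Icc (-1) 1) := by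
      refine Integrable.mul_bdd (c := 6 * κ) (Integrable.add ?_ (integrable_const _)) ?_ ?_
      · refine H.bound_M.1.mono' (by fun_prop) (ae_of_all _ fun u => ?_)
        rw [Real.norm_eq_abs, abs_abs]
        exact le_mul_of_one_le_left (abs_nonneg _)
          (Real.one_le_exp (mul_nonneg hz (abs_nonneg u)))
      · exact (by fun_prop : Measurable fun u : ℝ =>
          min 1 (|u| / l) * (6 * κ)).aestronglyMeasurable
      · refine ae_of_all _ fun u => ?_
        have hm0 : 0 ≤ min 1 (|u| / l) := le_min zero_le_one (by positivity)
        rw [Real.norm_eq_abs, abs_of_nonneg (by positivity)]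
        exact mul_le_of_le_one_left (by positivity) (min_le_left _ _)
    -- Each half contributes `κ / 4`: the mean kernel through `6 κ / l · 3 e₂` and `72 e₂ ≤ l`, and
    -- the choice `θ = 1/24` through `κ / 8` on an interval of length 2.
    have hjl : ∫ u in Set.Icc (-1 : ℝ) 1, (|meanK μ Khat u| + (1 / 24) / 2) *
        (min 1 (|u| / l) * (6 * κ)) ≤ κ / 2 := by
      have hptw : ∀ u, (|meanK μ Khat u| + (1 / 24) / 2) * (min 1 (|u| / l) * (6 * κ))
          ≤ 6 * κ / l * (|u| * Real.exp (z * |u|) * |meanK μ Khat u|) + κ / 8 := by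
        intro u
        have k1 : |meanK μ Khat u| * min 1 (|u| / l) ≤ |meanK μ Khat u| * (|u| / l) :=
          mul_le_mul_of_nonneg_left (min_le_right _ _) (abs_nonneg _)
        have k2 : min 1 (|u| / l) ≤ 1 := min_le_left _ _
        have k3 : 1 ≤ Real.exp (z * |u|) := Real.one_le_exp (by positivity)
        have k4 : |meanK μ Khat u| * (|u| / l)
            ≤ |u| * Real.exp (z * |u|) * |meanK μ Khat u| / l := by
          have := mul_le_mul_of_nonneg_left k3 (by positivity : 0 ≤ |meanK μ Khat u| * (|u| / l))
          rw [mul_one] at this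
          refine this.trans (le_of_eq (by ring))
        have k5 := mul_le_mul_of_nonneg_right (k1.trans k4) (by positivity : 0 ≤ 6 * κ)
        have k6 := mul_le_mul_of_nonneg_right k2 (by positivity : 0 ≤ κ / 8)
        calc _ = |meanK μ Khat u| * min 1 (|u| / l) * (6 * κ) + min 1 (|u| / l) * (κ / 8) := by
              ring
          _ ≤ |u| * Real.exp (z * |u|) * |meanK μ Khat u| / l * (6 * κ) + 1 * (κ / 8) :=
              add_le_add k5 k6
          _ = _ := by ring
      refine (integral_mono hji ((hKi.const_mul _).add (integrable_const _)) hptw).trans ?_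
      rw [integral_add' (hKi.const_mul _) (integrable_const _), integral_const_mul,
        setIntegral_const, Real.volume_real_Icc_of_le (by norm_num), smul_eq_mul]
      have k1 : 6 * κ / l * (∫ u in Set.Icc (-1 : ℝ) 1,
          |u| * Real.exp (z * |u|) * |meanK μ Khat u|) ≤ 6 * κ / l * (l / 24) :=
        mul_le_mul_of_nonneg_left (hKl.trans (by linarith)) (by positivity)
      have k2 : 6 * κ / l * (l / 24) = κ / 4 := by field_simp; ring
      linarith
    have t3 := H.abs_integral_kernel_le hd₂m hd₂M (a := 1) zero_le_one
      (fun w u hu => (hd₂b w u).trans (by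
        have k3 : 1 ≤ Real.exp (z * |u|) := Real.one_le_exp (by positivity)
        have : 1 ≤ |u| * Real.exp (z * |u|) := by nlinarith
        rw [one_mul]
        exact le_mul_of_one_le_left (hP0 w).le this))
      (θ := fun _ => 1 / 24) measurable_const (fun _ => by norm_num) (A₃ := 24) (A₄ := 0)
      (bθ := 1 / 24) (fun _ => le_rfl) (by norm_num) le_rfl
      (fun w u _ => (hd₂b w u).trans (by
        have k3 : 1 ≤ Real.exp (2 * z * |u|) := Real.one_le_exp (by positivity)
        have := le_mul_of_one_le_left (hP0 w).le k3
        linarith))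
      (fun u _ => hJ u) hji
    obtain ⟨hDi, hDl⟩ := H.integral_abs_tilt_le
    have hqφ : q y ≤ ∫ ω, Psi z z (W ω) * φ (W ω) ∂μ := by
      refine integral_mono (H.integrable_indicator_Psi measurableSet_Icc)
        ((integrable_Psi hW hz).mul_bdd (c := 1) (hφc.measurable.comp hW).aestronglyMeasurable
        (ae_of_all _ fun ω => by
          rw [Real.norm_eq_abs, abs_of_nonneg (hφ0 _)]; exact hφ1 _)) fun ω => ?_
      by_cases hw : W ω ∈ Set.Icc y (y + l)
      · have : φ (W ω) = 1 := trap_eq_one hl (abs_le.2 ⟨by linarith [hw.1], by linarith [hw.2]⟩)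
        simp only [Set.indicator_of_mem hw, this, mul_one, le_refl]
      · simp only [Set.indicator_of_notMem hw]
        exact mul_nonneg (hP0 _).le (hφ0 _)
    have hΨφi : Integrable (fun ω => Psi z z (W ω) * φ (W ω)) μ :=
      (integrable_Psi hW hz).mul_bdd (c := 1) (hφc.measurable.comp hW).aestronglyMeasurable
        (ae_of_all _ fun ω => by rw [Real.norm_eq_abs, abs_of_nonneg (hφ0 _)]; exact hφ1 _)
    have hgi : Integrable (fun ω => g (W ω)) μ :=
      Integrable.of_bound (hgm.comp hW).aestronglyMeasurable _ (ae_of_all _ fun ω => hgM _)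
    have hWfi : Integrable (fun ω => W ω * (Psi z z (W ω) * F (W ω))) μ :=
      H.int_W.mul_bdd (c := 3 * l * M₀) (hfL.continuous.measurable.comp hW).aestronglyMeasurable
        (ae_of_all _ fun ω =>
          (hfΨ _).trans (mul_le_mul_of_nonneg_left (hΨM _) (by positivity)))
    have hid : ∫ ω, Psi z z (W ω) * φ (W ω) ∂μ
        = ∫ ω, (W ω * Psi z z (W ω) - dPsi z z (W ω)) * F (W ω) ∂μ
          - (∫ ω, W ω * (Psi z z (W ω) * F (W ω)) ∂μ - ∫ ω, g (W ω) ∂μ) := by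
      rw [← integral_sub hWfi hgi,
        ← integral_sub (g := fun ω => W ω * (Psi z z (W ω) * F (W ω)) - g (W ω)) ?_
          (hWfi.sub hgi)]
      · congr 1; ext ω; simp only [hg]; ring
      · refine ((hWfi.sub hgi).add hΨφi).congr (ae_of_all _ fun ω => ?_)
        simp only [hg, Pi.sub_apply, Pi.add_apply]; ring
    have t4 : ∫ ω, (W ω * Psi z z (W ω) - dPsi z z (W ω)) * F (W ω) ∂μ ≤ 3 * l * (311 * X) := by
      refine (le_abs_self _).trans ?_
      rw [← Real.norm_eq_abs]
      refine (norm_integral_le_of_norm_le (hDi.const_mul (3 * l)) (ae_of_all _ fun ω => ?_)).trans ?_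
      · rw [norm_mul, mul_comm]
        exact mul_le_mul_of_nonneg_right (hFb _) (abs_nonneg _)
      · rw [integral_const_mul]
        exact mul_le_mul_of_nonneg_left hDl (by positivity)
    rw [← hh] at t0 t1 t2 t3
    rw [abs_le] at t0 t1 t2 t3
    have he0 := H.e_zero_le
    have he1 := H.pow_mul_e_one_le (n := 1) (by norm_num)
    have he2 := H.pow_mul_e_two_le (n := 2) (by norm_num)
    rw [pow_one] at he1
    have n1 := H.e_nonneg 1
    have n2 := H.e_nonneg 2
    have n3 := H.e_nonneg 3
    have b0 : e 0 * (3 * l * h) ≤ 3 * l * (41 * X) := by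
      have := mul_le_mul_of_nonneg_right he0 (by positivity : 0 ≤ 3 * l * h)
      have := mul_le_mul_of_nonneg_left hhX (by positivity : 0 ≤ 3 * l)
      linarith
    have b1 : e 1 * ((3 * l * z + 1) * h) ≤ (3 * l + e 1) * (41 * X) := by
      have k := mul_le_mul_of_nonneg_right he1 (by positivity : 0 ≤ 3 * l * h)
      have k' := mul_le_mul_of_nonneg_left hhX (by positivity : 0 ≤ 3 * l + e 1)
      linarith
    have b2 : e 2 * ((3 * l * z ^ 2 + 2 * z) * h) ≤ (3 * l + 2 * z * e 2) * (41 * X) := by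
      have k := mul_le_mul_of_nonneg_right he2 (by positivity : 0 ≤ 3 * l * h)
      have k' := mul_le_mul_of_nonneg_left hhX (by positivity : 0 ≤ 3 * l + 2 * z * e 2)
      linarith
    have b3 : 1 * (e 2 * h) + (24 * (e 3 * h) + 0 * (e 4 * h)) / 2
        ≤ (e 2 + 12 * e 3) * (41 * X) := by
      have k' := mul_le_mul_of_nonneg_left hhX (by positivity : 0 ≤ e 2 + 12 * e 3)
      linarith
    have p1 : 0 ≤ e 1 * X := by positivity
    have p2 : 0 ≤ e 2 * X := by positivity
    have p3 : 0 ≤ e 3 * X := by positivity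
    have p4 : 0 ≤ z * (e 2 * X) := by positivity
    have p5 : 0 ≤ l * X := by positivity
    linarith
  -- Taking the supremum over positions lets `κ / 2` be absorbed, which doubles the constant.
  have hκle : κ ≤ 1302 * ((l + e 1 + (1 + z) * e 2 + e 3) * X) + κ / 2 := ciSup_le main
  have := hqκ x
  simp only [hq] at this
  linarith

end LevelBounds

/-! ### Gaussian tail and Mills ratio -/

/-- The unnormalized Gaussian upper tail. -/
noncomputable def gaussTail (w : ℝ) : ℝ := ∫ s in Set.Ioi w, Real.exp (-(1 / 2) * s ^ 2)

/-- The Mills ratio of the standard normal law. -/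
noncomputable def mills (w : ℝ) : ℝ := Real.exp (w ^ 2 / 2) * gaussTail w

lemma integrable_gauss : Integrable fun s : ℝ => Real.exp (-(1 / 2) * s ^ 2) :=
  integrable_exp_neg_mul_sq (by norm_num)

lemma integrable_mul_gauss : Integrable fun s : ℝ => s * Real.exp (-(1 / 2) * s ^ 2) :=
  integrable_mul_exp_neg_mul_sq (by norm_num)

lemma integrable_sq_mul_gauss : Integrable fun s : ℝ => s ^ 2 * Real.exp (-(1 / 2) * s ^ 2) := by
  have := integrable_rpow_mul_exp_neg_mul_sq (b := 1 / 2) (by norm_num) (s := 2) (by norm_num)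
  simpa using this

lemma hasDerivAt_gauss (s : ℝ) : HasDerivAt (fun s : ℝ => Real.exp (-(1 / 2) * s ^ 2))
    (-(s * Real.exp (-(1 / 2) * s ^ 2))) s := by
  have := ((hasDerivAt_pow 2 s).const_mul (-(1 / 2) : ℝ)).exp
  refine this.congr_deriv ?_
  simp; ring

lemma setIntegral_Ioi_deriv {f f' : ℝ → ℝ} (hd : ∀ x, HasDerivAt f (f' x) x) (hf : Integrable f)
    (hf' : Integrable f') (w : ℝ) : ∫ s in Set.Ioi w, f' s = -f w := by
  rw [integral_Ioi_of_hasDerivAt_of_tendsto' (fun x _ => hd x) hf'.integrableOn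
    (tendsto_zero_of_hasDerivAt_of_integrableOn_Ioi (fun x _ => hd x) hf'.integrableOn
      (hf.integrableOn (s := Set.Ioi w))), zero_sub]

lemma gaussTail_pos (w : ℝ) : 0 < gaussTail w := by
  rw [gaussTail, setIntegral_pos_iff_support_of_nonneg_ae
    (ae_of_all _ fun _ => (Real.exp_pos _).le) integrable_gauss.integrableOn]
  have : Function.support (fun s : ℝ => Real.exp (-(1 / 2) * s ^ 2)) = Set.univ :=
    Function.support_eq_univ fun s => (Real.exp_pos _).ne'
  rw [this, Set.univ_inter]; simp

lemma mills_pos (w : ℝ) : 0 < mills w := mul_pos (Real.exp_pos _) (gaussTail_pos w)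

lemma mul_gaussTail_le (w : ℝ) : w * gaussTail w ≤ Real.exp (-(1 / 2) * w ^ 2) := by
  have h := setIntegral_Ioi_deriv hasDerivAt_gauss integrable_gauss integrable_mul_gauss.neg w
  rw [integral_neg, neg_inj] at h
  rw [← h, gaussTail, ← integral_const_mul]
  refine setIntegral_mono_on (integrable_gauss.const_mul w).integrableOn
    integrable_mul_gauss.integrableOn measurableSet_Ioi fun s hs => ?_
  exact mul_le_mul_of_nonneg_right (le_of_lt hs) (Real.exp_pos _).le

/-- Integrating `(s - w)² e^{-s²/2} ≥ 0` over `s > w` by parts gives the difference of the two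
sides. No sign of `w` is needed, and negative arguments do occur on the left branch of the Stein
solution. -/
lemma mul_exp_le_gaussTail (w : ℝ) :
    w * Real.exp (-(1 / 2) * w ^ 2) ≤ (1 + w ^ 2) * gaussTail w := by
  have hd : ∀ s : ℝ, HasDerivAt (fun s => (2 * w - s) * Real.exp (-(1 / 2) * s ^ 2))
      ((s ^ 2 - 2 * w * s - 1) * Real.exp (-(1 / 2) * s ^ 2)) s := fun s => by
    have := ((hasDerivAt_id s).const_sub (2 * w)).mul (hasDerivAt_gauss s)
    refine this.congr_deriv ?_
    simp only [id]; ring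
  have hi : Integrable fun s : ℝ => (2 * w - s) * Real.exp (-(1 / 2) * s ^ 2) := by
    refine ((integrable_gauss.const_mul (2 * w)).sub integrable_mul_gauss).congr
      (ae_of_all _ fun s => ?_)
    simp only [Pi.sub_apply]; ring
  have hi' : Integrable fun s : ℝ => (s ^ 2 - 2 * w * s - 1) * Real.exp (-(1 / 2) * s ^ 2) := by
    refine ((integrable_sq_mul_gauss.sub (integrable_mul_gauss.const_mul (2 * w))).sub
      integrable_gauss).congr (ae_of_all _ fun s => ?_)
    simp only [Pi.sub_apply]; ring
  have h := setIntegral_Ioi_deriv hd hi hi' w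
  have h2 : 0 ≤ ∫ s in Set.Ioi w, ((s ^ 2 - 2 * w * s - 1) * Real.exp (-(1 / 2) * s ^ 2)
      + (1 + w ^ 2) * Real.exp (-(1 / 2) * s ^ 2)) := by
    refine integral_nonneg fun s => ?_
    have : (s ^ 2 - 2 * w * s - 1) * Real.exp (-(1 / 2) * s ^ 2)
        + (1 + w ^ 2) * Real.exp (-(1 / 2) * s ^ 2)
        = (s - w) ^ 2 * Real.exp (-(1 / 2) * s ^ 2) := by ring
    simp only [Pi.zero_apply]
    rw [this]
    positivity
  rw [integral_add hi'.integrableOn (integrable_gauss.const_mul _).integrableOn, h,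
    integral_const_mul, ← gaussTail] at h2
  linarith

lemma gaussTail_add_neg (w : ℝ) : gaussTail w + gaussTail (-w) = √(2 * Real.pi) := by
  have h1 : gaussTail (-w) = ∫ s in Set.Iic w, Real.exp (-(1 / 2) * s ^ 2) := by
    have := integral_comp_neg_Ioi (-w) (fun s => Real.exp (-(1 / 2) * s ^ 2))
    simp only [neg_sq, neg_neg] at this
    exact this
  rw [h1, add_comm, gaussTail, intervalIntegral.integral_Iic_add_Ioi integrable_gauss.integrableOn
    integrable_gauss.integrableOn, integral_gaussian]
  congr 1; ring

lemma hasDerivAt_gaussTail (w : ℝ) :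
    HasDerivAt gaussTail (-Real.exp (-(1 / 2) * w ^ 2)) w := by
  have hc : Continuous fun s : ℝ => Real.exp (-(1 / 2) * s ^ 2) := by fun_prop
  have h : gaussTail = fun w => gaussTail 0 - ∫ s in (0 : ℝ)..w, Real.exp (-(1 / 2) * s ^ 2) := by
    ext w
    have := intervalIntegral.integral_Ioi_sub_Ioi' (f := fun s : ℝ => Real.exp (-(1 / 2) * s ^ 2))
      (μ := volume) (a := 0) (b := w) integrable_gauss.integrableOn integrable_gauss.integrableOn
    rw [← this]; simp [gaussTail]
  rw [h]
  exact (intervalIntegral.integral_hasDerivAt_right (hc.intervalIntegrable _ _)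
    (hc.stronglyMeasurableAtFilter _ _) hc.continuousAt).const_sub _

lemma exp_mul_exp_neg (w : ℝ) : Real.exp (w ^ 2 / 2) * Real.exp (-(1 / 2) * w ^ 2) = 1 := by
  rw [← Real.exp_add, show w ^ 2 / 2 + -(1 / 2) * w ^ 2 = 0 by ring, Real.exp_zero]

lemma hasDerivAt_mills (w : ℝ) : HasDerivAt mills (w * mills w - 1) w := by
  have h1 : HasDerivAt (fun w : ℝ => Real.exp (w ^ 2 / 2)) (w * Real.exp (w ^ 2 / 2)) w := by
    refine ((hasDerivAt_pow 2 w).div_const 2).exp.congr_deriv ?_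
    simp; ring
  refine (h1.mul (hasDerivAt_gaussTail w)).congr_deriv ?_
  rw [mills, mul_neg, exp_mul_exp_neg]; ring

lemma mul_mills_le_one (w : ℝ) : w * mills w ≤ 1 := by
  have := mul_le_mul_of_nonneg_left (mul_gaussTail_le w) (Real.exp_pos (w ^ 2 / 2)).le
  rw [exp_mul_exp_neg] at this
  rw [mills]; linarith

lemma le_mul_mills (w : ℝ) : w ≤ (1 + w ^ 2) * mills w := by
  have := mul_le_mul_of_nonneg_left (mul_exp_le_gaussTail w) (Real.exp_pos (w ^ 2 / 2)).le
  rw [mul_left_comm, exp_mul_exp_neg] at this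
  rw [mills]; linarith

lemma mills_antitone : Antitone mills :=
  antitone_of_deriv_nonpos (fun w => (hasDerivAt_mills w).differentiableAt) fun w => by
    rw [(hasDerivAt_mills w).deriv]; linarith [mul_mills_le_one w]

lemma sqrt_two_pi_le : √(2 * Real.pi) ≤ 3 := by
  rw [Real.sqrt_le_left (by norm_num)]; linarith [Real.pi_lt_d2]

lemma sqrt_two_pi_pos : 0 < √(2 * Real.pi) := Real.sqrt_pos.2 (by positivity)

lemma mills_le_two {w : ℝ} (hw : 0 ≤ w) : mills w ≤ 2 := by
  refine (mills_antitone hw).trans ?_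
  have := gaussTail_add_neg 0
  rw [neg_zero] at this
  simp [mills]
  linarith [sqrt_two_pi_le]

lemma mills_neg_le (w : ℝ) : mills (-w) ≤ 3 * Real.exp (w ^ 2 / 2) := by
  have := gaussTail_add_neg w
  rw [mills, neg_sq, mul_comm]
  refine mul_le_mul_of_nonneg_right ?_ (Real.exp_pos _).le
  linarith [gaussTail_pos w, sqrt_two_pi_le]

lemma one_le_mul_mills {w : ℝ} (hw : 0 ≤ w) : 1 ≤ 2 * (1 + w) * mills w := by
  rcases le_total 1 w with h | h
  · have h1 := le_mul_mills w
    have h2 := mills_pos w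
    have h3 : 1 + w ^ 2 ≤ 2 * w * (1 + w) := by nlinarith
    have h4 := mul_le_mul_of_nonneg_right h3 h2.le
    nlinarith
  · have h1 := le_mul_mills 1
    have h2 := mills_antitone h
    nlinarith [mills_pos w]

/-- The standard normal upper tail probability. -/
noncomputable def normTail (z : ℝ) : ℝ := gaussTail z / √(2 * Real.pi)

lemma one_sub_Phi (z : ℝ) : 1 - Phi z = normTail z := by
  have h1 : Phi z = (gaussianReal 0 1).real (Set.Iic z) := cdf_eq_real _ z
  have h2 : 1 - Phi z = (gaussianReal 0 1).real (Set.Ioi z) := by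
    rw [h1, ← Set.compl_Iic, probReal_compl_eq_one_sub measurableSet_Iic]
  rw [h2, measureReal_def, gaussianReal_apply_eq_integral 0 one_ne_zero, ENNReal.toReal_ofReal
    (integral_nonneg fun _ => gaussianPDFReal_nonneg _ _ _), normTail, gaussTail, div_eq_inv_mul,
    ← integral_const_mul]
  refine integral_congr_ae (ae_of_all _ fun s => ?_)
  simp only [gaussianPDFReal, NNReal.coe_one, mul_one, sub_zero]
  congr 2; ring

lemma normTail_pos (z : ℝ) : 0 < normTail z := div_pos (gaussTail_pos z) sqrt_two_pi_pos

lemma one_sub_normTail (z : ℝ) : 1 - normTail z = gaussTail (-z) / √(2 * Real.pi) := by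
  rw [normTail, ← gaussTail_add_neg z]
  have : gaussTail z + gaussTail (-z) ≠ 0 := by
    have := gaussTail_pos z; have := gaussTail_pos (-z); positivity
  field_simp; ring

lemma one_sub_normTail_pos (z : ℝ) : 0 < 1 - normTail z := by
  rw [one_sub_normTail]; exact div_pos (gaussTail_pos _) sqrt_two_pi_pos

lemma normTail_antitone : Antitone normTail := fun x y h => by
  have : gaussTail y ≤ gaussTail x :=
    setIntegral_mono_set integrable_gauss.integrableOn (ae_of_all _ fun _ => (Real.exp_pos _).le)
      (Set.Ioi_subset_Ioi h).eventuallyLE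
  exact div_le_div_of_nonneg_right this sqrt_two_pi_pos.le

lemma mills_le_normTail (z : ℝ) : mills z ≤ 3 * normTail z * Real.exp (z ^ 2 / 2) := by
  have h : gaussTail z ≤ 3 * normTail z := by
    rw [normTail, ← mul_div_assoc, le_div_iff₀ sqrt_two_pi_pos, mul_comm]
    exact mul_le_mul_of_nonneg_right sqrt_two_pi_le (gaussTail_pos z).le
  rw [mills, mul_comm]
  exact mul_le_mul_of_nonneg_right h (Real.exp_pos _).le

/-- This converts bounds with no Gaussian decay into multiples of the normal tail at the price of `1
+ z`, as a relative error requires. -/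
lemma one_le_normTail_mul {z : ℝ} (hz : 0 ≤ z) :
    1 ≤ 6 * (1 + z) * normTail z * Real.exp (z ^ 2 / 2) := by
  have h1 := one_le_mul_mills hz
  have h2 := mul_le_mul_of_nonneg_left (mills_le_normTail z) (by linarith : 0 ≤ 2 * (1 + z))
  linarith

lemma exp_neg_le_normTail {z : ℝ} (hz : 0 ≤ z) :
    Real.exp (-(z ^ 2 / 2)) ≤ 6 * (1 + z) * normTail z := by
  rw [Real.exp_neg, inv_le_iff_one_le_mul₀ (Real.exp_pos _)]
  exact one_le_normTail_mul hz

/-! ### The Stein solution and its weight -/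

/-- The bounded solution of the Stein equation `f' w - w f w = 1_{w ≤ z} - Φ z`. -/
noncomputable def steinSol (z w : ℝ) : ℝ :=
  if w ≤ z then normTail z * mills (-w) else (1 - normTail z) * mills w

/-- The derivative of `steinSol z`, with the left derivative at `z`. -/
noncomputable def steinDer (z w : ℝ) : ℝ :=
  w * steinSol z w + ((if w ≤ z then 1 else 0) - (1 - normTail z))

/-- The exponential weight bounding the Stein solution at level `z`. -/
noncomputable def steinWeight (z w : ℝ) : ℝ := Real.exp (max 0 (min w z) ^ 2 / 2)

lemma normTail_mul_mills_neg (z : ℝ) :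
    normTail z * mills (-z) = (1 - normTail z) * mills z := by
  rw [one_sub_normTail, normTail, mills, mills, neg_sq]; ring

lemma steinSol_of_le {z w : ℝ} (h : w ≤ z) : steinSol z w = normTail z * mills (-w) := if_pos h

lemma steinSol_of_ge {z w : ℝ} (h : z ≤ w) : steinSol z w = (1 - normTail z) * mills w := by
  rcases h.eq_or_lt with rfl | h
  · rw [steinSol_of_le le_rfl, normTail_mul_mills_neg]
  · exact if_neg h.not_ge

lemma continuous_mills : Continuous mills :=
  continuous_iff_continuousAt.2 fun w => (hasDerivAt_mills w).continuousAt

lemma continuous_steinSol (z : ℝ) : Continuous (steinSol z) := by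
  have h1 : Continuous fun w => normTail z * mills (-w) :=
    (continuous_mills.comp continuous_neg).const_mul _
  have h2 : Continuous fun w => (1 - normTail z) * mills w := continuous_mills.const_mul _
  refine Continuous.if_le h1 h2 continuous_id continuous_const fun w hw => ?_
  rw [hw, normTail_mul_mills_neg]

lemma measurable_steinDer (z : ℝ) : Measurable (steinDer z) := by
  have := (continuous_steinSol z).measurable
  unfold steinDer
  exact (measurable_id.mul this).add ((Measurable.ite measurableSet_Iic measurable_const
    measurable_const).sub measurable_const)

lemma hasDerivAt_left_branch (z w : ℝ) : HasDerivAt (fun w => normTail z * mills (-w))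
    (normTail z * (1 + w * mills (-w))) w := by
  have h1 : HasDerivAt (fun w : ℝ => -w) (-1) w := hasDerivAt_neg w
  refine (((hasDerivAt_mills (-w)).comp w h1).const_mul (normTail z)).congr_deriv ?_
  ring

lemma hasDerivAt_right_branch (z w : ℝ) : HasDerivAt (fun w => (1 - normTail z) * mills w)
    ((1 - normTail z) * (w * mills w - 1)) w :=
  (hasDerivAt_mills w).const_mul _

lemma hasDerivAt_steinSol {z w : ℝ} (h : w ≠ z) : HasDerivAt (steinSol z) (steinDer z w) w := by
  rcases lt_or_gt_of_ne h with h | h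
  · refine ((hasDerivAt_left_branch z w).congr_of_eventuallyEq ?_).congr_deriv ?_
    · filter_upwards [Iio_mem_nhds h] with x hx using steinSol_of_le (le_of_lt hx)
    · rw [steinDer, steinSol_of_le h.le, if_pos h.le]; ring
  · refine ((hasDerivAt_right_branch z w).congr_of_eventuallyEq ?_).congr_deriv ?_
    · filter_upwards [Ioi_mem_nhds h] with x hx using steinSol_of_ge (le_of_lt hx)
    · rw [steinDer, steinSol_of_ge h.le, if_neg h.not_ge]; ring

lemma steinWeight_mono (z : ℝ) : Monotone (steinWeight z) := fun x y h => by
  unfold steinWeight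
  gcongr

lemma one_le_steinWeight (z w : ℝ) : 1 ≤ steinWeight z w := Real.one_le_exp (by positivity)

lemma steinWeight_of_ge {z w : ℝ} (hz : 0 ≤ z) (h : z ≤ w) :
    steinWeight z w = Real.exp (z ^ 2 / 2) := by
  rw [steinWeight, min_eq_right h, max_eq_right hz]

lemma steinWeight_of_mem {z w : ℝ} (hw : 0 ≤ w) (h : w ≤ z) :
    steinWeight z w = Real.exp (w ^ 2 / 2) := by
  rw [steinWeight, min_eq_left h, max_eq_right hw]

lemma steinWeight_le {z : ℝ} (hz : 0 ≤ z) (w : ℝ) : steinWeight z w ≤ Real.exp (z ^ 2 / 2) := by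
  rw [← steinWeight_of_ge hz (le_max_right w z)]
  exact steinWeight_mono z (le_max_left _ _)

lemma steinSol_nonneg (z w : ℝ) : 0 ≤ steinSol z w := by
  unfold steinSol
  split_ifs
  · exact (mul_pos (normTail_pos z) (mills_pos _)).le
  · exact (mul_pos (one_sub_normTail_pos z) (mills_pos _)).le

lemma mills_neg_le_weight {z w : ℝ} (h : w ≤ z) : mills (-w) ≤ 3 * steinWeight z w := by
  rcases le_total w 0 with hw | hw
  · have := mills_le_two (neg_nonneg.2 hw)
    linarith [one_le_steinWeight z w]
  · rw [steinWeight_of_mem hw h]; exact mills_neg_le w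

lemma right_branch_le {z w : ℝ} (hz : 0 ≤ z) (h : z ≤ w) :
    (1 - normTail z) * mills w ≤ 3 * normTail z * steinWeight z w := by
  rw [steinWeight_of_ge hz h]
  refine le_trans ?_ (mills_le_normTail z)
  refine (mul_le_of_le_one_left (mills_pos w).le (by linarith [normTail_pos z])).trans
    (mills_antitone h)

/-- The factor `normTail z` is explicit on the left branch. On the right branch it comes from `mills
w ≤ mills z` together with `mills_le_normTail`. -/
lemma abs_steinSol_le {z : ℝ} (hz : 0 ≤ z) (w : ℝ) :
    |steinSol z w| ≤ 3 * normTail z * steinWeight z w := by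
  rw [abs_of_nonneg (steinSol_nonneg z w)]
  rcases le_total w z with h | h
  · rw [steinSol_of_le h]
    linarith [mul_le_mul_of_nonneg_left (mills_neg_le_weight h) (normTail_pos z).le]
  · rw [steinSol_of_ge h]; exact right_branch_le hz h

lemma abs_left_der_le {z w : ℝ} (hz : 0 ≤ z) (h : w ≤ z) :
    |normTail z * (1 + w * mills (-w))| ≤ 6 * (1 + z) * normTail z * steinWeight z w := by
  have hp := normTail_pos z
  have hE := one_le_steinWeight z w
  have h1 : 0 ≤ 1 + w * mills (-w) := by linarith [mul_mills_le_one (-w)]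
  rw [abs_mul, abs_of_pos hp, abs_of_nonneg h1]
  have h2 : 1 + w * mills (-w) ≤ 6 * (1 + z) * steinWeight z w := by
    rcases le_total w 0 with hw | hw
    · have : w * mills (-w) ≤ 0 := mul_nonpos_of_nonpos_of_nonneg hw (mills_pos _).le
      nlinarith
    · have h3 := mul_le_mul h (mills_neg_le_weight h) (mills_pos _).le hz
      nlinarith
  linarith [mul_le_mul_of_nonneg_left h2 hp.le]

lemma abs_right_der_le {z w : ℝ} (hz : 0 ≤ z) (h : z ≤ w) :
    |(1 - normTail z) * (w * mills w - 1)| ≤ 6 * (1 + z) * normTail z * steinWeight z w := by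
  rw [steinWeight_of_ge hz h]
  refine le_trans ?_ (one_le_normTail_mul hz)
  have hp := one_sub_normTail_pos z
  rw [abs_mul, abs_of_pos hp]
  have h1 : |w * mills w - 1| ≤ 1 := by
    have := mul_nonneg (hz.trans h) (mills_pos w).le
    rw [abs_le]; constructor <;> linarith [mul_mills_le_one w]
  have := normTail_pos z
  exact mul_le_one₀ (by linarith) (abs_nonneg _) h1

lemma abs_steinDer_le {z : ℝ} (hz : 0 ≤ z) (w : ℝ) :
    |steinDer z w| ≤ 6 * (1 + z) * normTail z * steinWeight z w := by
  rcases le_or_gt w z with h | h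
  · have : steinDer z w = normTail z * (1 + w * mills (-w)) := by
      rw [steinDer, steinSol_of_le h, if_pos h]; ring
    rw [this]; exact abs_left_der_le hz h
  · have : steinDer z w = (1 - normTail z) * (w * mills w - 1) := by
      rw [steinDer, steinSol_of_ge h.le, if_neg h.not_ge]; ring
    rw [this]; exact abs_right_der_le hz h.le

/-- A function glued from two differentiable branches at `z` is Lipschitz on a segment on which
both branch derivatives are bounded. -/
lemma abs_sub_le_of_branches {z : ℝ} {f a b a' b' : ℝ → ℝ} (hf : Continuous f)
    (hfa : ∀ x ≤ z, f x = a x) (hfb : ∀ x, z ≤ x → f x = b x)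
    (ha : ∀ x, HasDerivAt a (a' x) x) (hb : ∀ x, HasDerivAt b (b' x) x) {x y C : ℝ} (hxy : x ≤ y)
    (hCa : ∀ s ≤ y, s ≤ z → |a' s| ≤ C) (hCb : ∀ s ≤ y, z ≤ s → |b' s| ≤ C) :
    |f y - f x| ≤ C * (y - x) := by
  -- This form of the mean value inequality needs only right derivatives, so the kink at `z` causes
  -- no loss.
  have := norm_image_sub_le_of_norm_deriv_right_le_segment (f := f) (a := x) (b := y)
    (f' := fun s => if s < z then a' s else b' s) (C := C) hf.continuousOn (fun s _ => ?_)
    (fun s hs => ?_) y ⟨hxy, le_rfl⟩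
  · exact this
  · rcases lt_or_ge s z with h | h
    · rw [if_pos h]
      refine ((ha s).congr_of_eventuallyEq ?_).hasDerivWithinAt
      filter_upwards [Iio_mem_nhds h] with t ht using hfa t (le_of_lt ht)
    · rw [if_neg h.not_gt]
      exact (hb s).hasDerivWithinAt.congr (fun t ht => hfb t (h.trans ht)) (hfb s h)
  · rcases lt_or_ge s z with h | h
    · rw [if_pos h]; exact hCa s hs.2.le h.le
    · rw [if_neg h.not_gt]; exact hCb s hs.2.le h

lemma lipschitzWith_steinSol {z : ℝ} (hz : 0 ≤ z) :
    LipschitzWith (Real.toNNReal (6 * (1 + z) * normTail z * Real.exp (z ^ 2 / 2)))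
      (steinSol z) := by
  have hp := normTail_pos z
  have hw : ∀ w, 6 * (1 + z) * normTail z * steinWeight z w
      ≤ 6 * (1 + z) * normTail z * Real.exp (z ^ 2 / 2) := fun w =>
    mul_le_mul_of_nonneg_left (steinWeight_le hz w) (by positivity)
  have key : ∀ x y, x ≤ y → |steinSol z y - steinSol z x|
      ≤ 6 * (1 + z) * normTail z * Real.exp (z ^ 2 / 2) * (y - x) := fun x y hxy =>
    abs_sub_le_of_branches (continuous_steinSol z) (fun _ => steinSol_of_le)
      (fun _ => steinSol_of_ge) (hasDerivAt_left_branch z) (hasDerivAt_right_branch z) hxy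
      (fun s _ hs => (abs_left_der_le hz hs).trans (hw s))
      (fun s _ hs => (abs_right_der_le hz hs).trans (hw s))
  refine LipschitzWith.of_dist_le_mul fun x y => ?_
  rw [Real.coe_toNNReal _ (by positivity), Real.dist_eq, Real.dist_eq]
  rcases le_total x y with h | h
  · rw [abs_sub_comm, abs_sub_comm x, abs_of_nonneg (sub_nonneg.2 h)]; exact key x y h
  · rw [abs_of_nonneg (sub_nonneg.2 h)]; exact key y x h

/-- By the Stein equation, `w f(w)` is `f'` with its jump removed, hence Lipschitz. The branch
derivatives are bounded using both inequalities for the Mills ratio; the weight is taken at `w +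
|u|`, beyond every point of the segment. -/
lemma abs_mul_steinSol_sub_le {z : ℝ} (hz : 0 ≤ z) (w u : ℝ) :
    |(w + u) * steinSol z (w + u) - w * steinSol z w|
      ≤ |u| * (3 * (1 + z) ^ 2 * normTail z * steinWeight z (w + |u|)) := by
  have hp := normTail_pos z
  have hda : ∀ x, HasDerivAt (fun x => x * (normTail z * mills (-x)))
      (normTail z * ((1 + x ^ 2) * mills (-x) + x)) x := fun x => by
    refine ((hasDerivAt_id x).mul (hasDerivAt_left_branch z x)).congr_deriv ?_
    simp only [id]; ring
  have hdb : ∀ x, HasDerivAt (fun x => x * ((1 - normTail z) * mills x))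
      ((1 - normTail z) * ((1 + x ^ 2) * mills x - x)) x := fun x => by
    refine ((hasDerivAt_id x).mul (hasDerivAt_right_branch z x)).congr_deriv ?_
    simp only [id]; ring
  have hba : ∀ s ≤ z, |normTail z * ((1 + s ^ 2) * mills (-s) + s)|
      ≤ 3 * (1 + z) ^ 2 * normTail z * steinWeight z s := by
    intro s hs
    have hE := one_le_steinWeight z s
    have hm := mills_pos (-s)
    have h0 : 0 ≤ (1 + s ^ 2) * mills (-s) + s := by
      have := le_mul_mills (-s); rw [neg_sq] at this; linarith
    rw [abs_mul, abs_of_pos hp, abs_of_nonneg h0]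
    have h1 : (1 + s ^ 2) * mills (-s) + s ≤ 3 * (1 + z) ^ 2 * steinWeight z s := by
      have hmw := mills_neg_le_weight hs
      rcases le_total s 0 with h | h
      · have h2 := mul_le_mul_of_nonneg_left (mul_mills_le_one (-s)) (neg_nonneg.2 h)
        have h3 : 3 * steinWeight z s ≤ 3 * (1 + z) ^ 2 * steinWeight z s := by
          have : 1 ≤ (1 + z) ^ 2 := by nlinarith
          nlinarith
        linarith
      · have h2 : 1 + s ^ 2 ≤ 1 + z ^ 2 := by nlinarith
        have h3 := mul_le_mul h2 hmw hm.le (by positivity)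
        nlinarith [mul_le_mul_of_nonneg_left hE hz]
    linarith [mul_le_mul_of_nonneg_left h1 hp.le]
  have hbb : ∀ s, z ≤ s → |(1 - normTail z) * ((1 + s ^ 2) * mills s - s)|
      ≤ 3 * (1 + z) ^ 2 * normTail z * steinWeight z s := by
    intro s hs
    have hs0 := hz.trans hs
    have h0 : 0 ≤ (1 + s ^ 2) * mills s - s := by linarith [le_mul_mills s]
    have hq := one_sub_normTail_pos z
    rw [abs_mul, abs_of_pos hq, abs_of_nonneg h0]
    have h1 : (1 + s ^ 2) * mills s - s ≤ mills s := by
      nlinarith [mul_le_mul_of_nonneg_left (mul_mills_le_one s) hs0]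
    refine (mul_le_mul_of_nonneg_left h1 hq.le).trans ((right_branch_le hz hs).trans ?_)
    have h2 : 1 ≤ (1 + z) ^ 2 := by nlinarith
    have h3 : 0 ≤ 3 * normTail z * steinWeight z s := by
      have := one_le_steinWeight z s; positivity
    nlinarith
  have key : ∀ x y, x ≤ y → y ≤ w + |u| → |y * steinSol z y - x * steinSol z x|
      ≤ 3 * (1 + z) ^ 2 * normTail z * steinWeight z (w + |u|) * (y - x) := by
    intro x y hxy hy
    have hmono : ∀ s ≤ y, 3 * (1 + z) ^ 2 * normTail z * steinWeight z s
        ≤ 3 * (1 + z) ^ 2 * normTail z * steinWeight z (w + |u|) := fun s hs =>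
      mul_le_mul_of_nonneg_left (steinWeight_mono z (hs.trans hy)) (by positivity)
    exact abs_sub_le_of_branches (f := fun x => x * steinSol z x)
      (continuous_id.mul (continuous_steinSol z)) (fun s hs => by simp only [steinSol_of_le hs])
      (fun s hs => by simp only [steinSol_of_ge hs]) hda hdb hxy
      (fun s hsy hs => (hba s hs).trans (hmono s hsy))
      (fun s hsy hs => (hbb s hs).trans (hmono s hsy))
  rcases le_total 0 u with hu | hu
  · have := key w (w + u) (by linarith) (by linarith [le_abs_self u])
    refine this.trans (le_of_eq ?_)
    nth_rewrite 2 [abs_of_nonneg hu]; ring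
  · have := key (w + u) w (by linarith) (by linarith [abs_nonneg u])
    rw [abs_sub_comm]
    refine this.trans (le_of_eq ?_)
    nth_rewrite 2 [abs_of_nonpos hu]; ring

/-- With `m = max 0 (min w z)` and `k = ⌊m⌋`, `m²/2 = k m - k²/2 + (m - k)²/2 ≤ k m - k²/2 + 1/2`,
so one summand already suffices. Summing over `k` makes the bound independent of which one. -/
lemma steinWeight_le_sum {z : ℝ} (hz : 0 ≤ z) (w : ℝ) :
    steinWeight z w ≤ ∑ k ∈ Finset.range (⌊z⌋₊ + 1),
      2 * Real.exp (-((k : ℝ) ^ 2 / 2)) * Psi z k w := by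
  set m := max 0 (min w z) with hm
  have hm0 : 0 ≤ m := le_max_left _ _
  have hmz : m ≤ z := max_le hz (min_le_right _ _)
  have hk : ⌊m⌋₊ ∈ Finset.range (⌊z⌋₊ + 1) :=
    Finset.mem_range.2 (Nat.lt_succ_of_le (Nat.floor_mono hmz))
  refine le_trans ?_ (Finset.single_le_sum (f := fun k : ℕ =>
    2 * Real.exp (-((k : ℝ) ^ 2 / 2)) * Psi z k w) (fun k _ => ?_) hk)
  · have h1 := Nat.floor_le hm0
    have h2 := Nat.lt_floor_add_one m
    set k : ℝ := (⌊m⌋₊ : ℝ) with hkdef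
    have hk0 : 0 ≤ k := Nat.cast_nonneg _
    have h3 : Real.exp (k * m) ≤ Psi z k w := by
      rcases le_total 0 (min w z) with h | h
      · rw [hm, max_eq_right h]; exact exp_min_le_Psi hk0 w
      · have : m = 0 := max_eq_left h
        rw [this, mul_zero, Real.exp_zero]; exact one_le_Psi hk0 w
    have h4 : Real.exp (1 / 2) ≤ 2 := by
      have : Real.exp (1 / 2) ^ 2 = Real.exp 1 := by rw [← Real.exp_nat_mul]; norm_num
      nlinarith [Real.exp_one_lt_d9, Real.exp_pos (1 / 2)]
    calc steinWeight z w ≤ Real.exp (1 / 2 + (-(k ^ 2 / 2)) + k * m) := by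
          refine Real.exp_le_exp.2 ?_
          nlinarith
      _ = Real.exp (1 / 2) * Real.exp (-(k ^ 2 / 2)) * Real.exp (k * m) := by
          rw [Real.exp_add, Real.exp_add]
      _ ≤ 2 * Real.exp (-(k ^ 2 / 2)) * Psi z k w := by gcongr
  · have := Psi_pos (β := z) (Nat.cast_nonneg k) w
    positivity

/-! ### The jump of the Stein equation at `z` -/

/-- The increment of the indicator of `(-∞, z]` along `u`. -/
noncomputable def indDiff (z w u : ℝ) : ℝ :=
  (if w + u ≤ z then 1 else 0) - (if w ≤ z then 1 else 0)

lemma measurable_indDiff (z : ℝ) : Measurable (Function.uncurry (indDiff z)) := by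
  unfold Function.uncurry indDiff
  exact (Measurable.ite (measurableSet_le (by fun_prop) measurable_const) measurable_const
    measurable_const).sub (Measurable.ite (measurableSet_le (by fun_prop) measurable_const)
    measurable_const measurable_const)

lemma abs_indDiff_le_one (z w u : ℝ) : |indDiff z w u| ≤ 1 := by
  unfold indDiff; split_ifs <;> simp

lemma indDiff_eq_zero {z w u : ℝ} (h : w ∉ Set.Icc (z - |u|) (z + |u|)) : indDiff z w u = 0 := by
  unfold indDiff
  rcases le_or_gt w z with h1 | h1
  · have h2 : w < z - |u| := by
      by_contra h2; exact h ⟨not_lt.1 h2, by linarith [abs_nonneg u]⟩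
    rw [if_pos h1, if_pos (by linarith [le_abs_self u]), sub_self]
  · have h2 : z + |u| < w := by
      by_contra h2; exact h ⟨by linarith [abs_nonneg u], not_lt.1 h2⟩
    rw [if_neg h1.not_ge, if_neg (by linarith [neg_abs_le u]), sub_self]

/-- Where the increment is nonzero, `w ≥ z - |u|`, so `Ψ_{z,z}(w) ≥ e^{z² - z|u|}`. The gained
`e^{-z²}` against `E Ψ ≤ 41 e^{z²/2}` leaves `e^{-z²/2}`, the size of the normal tail up to `1 + z`.
-/
lemma abs_indDiff_le {z : ℝ} (hz : 0 ≤ z) (w u : ℝ) :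
    |indDiff z w u| ≤ Real.exp (-z ^ 2) * Real.exp (z * |u|) *
      (Set.Icc (z - |u|) (z + |u|)).indicator (Psi z z) w := by
  by_cases h : w ∈ Set.Icc (z - |u|) (z + |u|)
  · rw [Set.indicator_of_mem h]
    refine (abs_indDiff_le_one z w u).trans ?_
    have h1 := exp_min_le_Psi (β := z) hz w
    have h2 : z - |u| ≤ min w z := le_min h.1 (by linarith [abs_nonneg u])
    calc (1 : ℝ) = Real.exp (-z ^ 2) * Real.exp (z * |u|) * Real.exp (z * (z - |u|)) := by
          rw [← Real.exp_add, ← Real.exp_add, ← Real.exp_zero]; congr 1; ring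
      _ ≤ _ := by
          refine mul_le_mul_of_nonneg_left (le_trans (Real.exp_le_exp.2 ?_) h1) (by positivity)
          exact mul_le_mul_of_nonneg_left h2 hz
  · rw [Set.indicator_of_notMem h, indDiff_eq_zero h]; simp

namespace LevelBounds

variable {Ω : Type*} [MeasurableSpace Ω] {μ : Measure Ω} {W R : Ω → ℝ}
  {Khat : Ω → ℝ → ℝ} {z ρ : ℝ} {e : Fin 5 → ℝ} [IsProbabilityMeasure μ]

lemma integral_abs_indDiff_le (H : LevelBounds μ W R Khat z ρ e) (u : ℝ) :
    ∫ ω, |indDiff z (W ω) u| ∂μ ≤ 2604 * Real.exp (-(z ^ 2 / 2)) *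
      (Real.exp (z * |u|) * (2 * |u| + (e 1 + 73 * (1 + z) * e 2 + e 3))) := by
  have hz := H.z_nonneg
  have n1 := H.e_nonneg 1
  have n2 := H.e_nonneg 2
  have n3 := H.e_nonneg 3
  rcases eq_or_ne u 0 with rfl | hu
  · have : ∀ w, indDiff z w 0 = 0 := fun w => by simp [indDiff]
    simp only [this, abs_zero, integral_zero]
    positivity
  · have hu' : 0 < |u| := abs_pos.2 hu
    -- The window is lengthened by `72 e₂` to satisfy the lower bound on its length in the
    -- concentration inequality. The case `u = 0` is separate because the length must be positive.
    have h := H.integral_indicator_Psi_le (l := 2 * |u| + 72 * e 2) (by positivity)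
      (by linarith) (z - |u|)
    have hi := H.integrable_indicator_Psi
      (measurableSet_Icc : MeasurableSet (Set.Icc (z - |u|) (z + |u|)))
    have hi2 := H.integrable_indicator_Psi
      (measurableSet_Icc : MeasurableSet (Set.Icc (z - |u|) (z - |u| + (2 * |u| + 72 * e 2))))
    have h1 : ∫ ω, (Set.Icc (z - |u|) (z + |u|)).indicator (Psi z z) (W ω) ∂μ
        ≤ ∫ ω, (Set.Icc (z - |u|) (z - |u| + (2 * |u| + 72 * e 2))).indicator (Psi z z) (W ω) ∂μ :=
      integral_mono hi hi2 fun ω => Set.indicator_le_indicator_of_subset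
        (Set.Icc_subset_Icc le_rfl (by linarith)) (fun _ => (Psi_pos hz _).le) _
    have h2 : ∫ ω, |indDiff z (W ω) u| ∂μ ≤ Real.exp (-z ^ 2) * Real.exp (z * |u|) *
        ∫ ω, (Set.Icc (z - |u|) (z + |u|)).indicator (Psi z z) (W ω) ∂μ := by
      rw [← integral_const_mul]
      exact integral_mono_of_nonneg (ae_of_all _ fun ω => abs_nonneg _) (hi.const_mul _)
        (ae_of_all _ fun ω => abs_indDiff_le hz _ _)
    refine h2.trans ((mul_le_mul_of_nonneg_left (h1.trans h) (by positivity)).trans ?_)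
    have hY : Real.exp (-z ^ 2) * Real.exp (z ^ 2 / 2) = Real.exp (-(z ^ 2 / 2)) := by
      rw [← Real.exp_add]; congr 1; ring
    rw [← hY]
    have h3 : 2 * |u| + 72 * e 2 + e 1 + (1 + z) * e 2 + e 3
        ≤ 2 * |u| + (e 1 + 73 * (1 + z) * e 2 + e 3) := by nlinarith [mul_nonneg hz n2]
    calc _ = 2604 * (Real.exp (-z ^ 2) * Real.exp (z ^ 2 / 2)) * (Real.exp (z * |u|) *
          (2 * |u| + 72 * e 2 + e 1 + (1 + z) * e 2 + e 3)) := by ring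
      _ ≤ _ := by gcongr

/-- The contribution of the jump of the Stein equation at `z`. -/
lemma abs_integral_indDiff_le (H : LevelBounds μ W R Khat z ρ e) {s : ℝ} (hs : 0 < s)
    (hs4 : e 4 ≤ s ^ 2) :
    |∫ p : Ω × ℝ, indDiff z (W p.1) p.2 * Khat p.1 p.2 ∂(μ.prod volume)|
      ≤ 2604 * (1 + ρ) * (e 1 + 80 * (1 + z) * e 2 + 2 * e 3 + 3 * s)
        * Real.exp (-(z ^ 2 / 2)) := by
  have hz := H.z_nonneg
  have hρ := H.ρ_nonneg
  have n1 := H.e_nonneg 1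
  have n2 := H.e_nonneg 2
  have n3 := H.e_nonneg 3
  have n4 := H.e_nonneg 4
  have hKb := measurable_meanK (μ := μ) H.meas_K
  set Y := Real.exp (-(z ^ 2 / 2)) with hY
  have hY0 : 0 < Y := Real.exp_pos _
  set ε := e 1 + 73 * (1 + z) * e 2 + e 3 with hε
  have hε0 : 0 ≤ ε := by positivity
  -- The exponential cancels the `e^{z|u|}` of the concentration bound, and the denominator gives
  -- `(2|u| + ε) / (|u|/s + 1) ≤ 2 s + ε`. The price is the coefficient `1 + |u| / s`, whose second
  -- part contributes `e₄ / s ≤ s`; hence `s` of order `√e₄` balances the two.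
  set θ : ℝ → ℝ := fun u => Real.exp (-(z * |u|)) / (|u| / s + 1) with hθ
  have hθ0 : ∀ u, 0 < θ u := fun u => by rw [hθ]; positivity
  have hθ1 : ∀ u, θ u ≤ 1 := fun u => by
    rw [hθ]
    refine div_le_one_of_le₀ ?_ (by positivity)
    refine (Real.exp_le_one_iff.2 (neg_nonpos.2 (by positivity))).trans ?_
    have : 0 ≤ |u| / s := by positivity
    linarith
  have hθm : Measurable θ := by rw [hθ]; fun_prop
  obtain ⟨hKi, hKl⟩ := H.integral_mul_abs_meanK_le
  obtain ⟨hMi, hMl⟩ := H.bound_M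
  have hjint : IntegrableOn (fun u => 2604 * Y * (2 * (|u| * Real.exp (z * |u|) * |meanK μ Khat u|)
      + ε * (Real.exp (z * |u|) * |meanK μ Khat u|) + (s + ε / 2))) (Set.Icc (-1) 1) :=
    (((hKi.const_mul 2).add (hMi.const_mul ε)).add (integrable_const _)).const_mul _
  have hpt : ∀ u, (|meanK μ Khat u| + θ u / 2) *
      (2604 * Y * (Real.exp (z * |u|) * (2 * |u| + ε)))
      ≤ 2604 * Y * (2 * (|u| * Real.exp (z * |u|) * |meanK μ Khat u|)
      + ε * (Real.exp (z * |u|) * |meanK μ Khat u|) + (s + ε / 2)) := by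
    intro u
    have h1 : θ u * Real.exp (z * |u|) = 1 / (|u| / s + 1) := by
      rw [hθ]
      simp only
      rw [div_mul_eq_mul_div, ← Real.exp_add, neg_add_cancel, Real.exp_zero]
    have h2 : 1 / (|u| / s + 1) * (2 * |u| + ε) ≤ 2 * s + ε := by
      rw [one_div, inv_mul_le_iff₀ (by positivity)]
      have h3 : (|u| / s + 1) * (2 * s + ε) = 2 * |u| + ε + (2 * s + |u| / s * ε) := by
        field_simp; ring
      rw [h3]
      have : 0 ≤ 2 * s + |u| / s * ε := by positivity
      linarith
    have h4 : (|meanK μ Khat u| + θ u / 2) * (2604 * Y * (Real.exp (z * |u|) * (2 * |u| + ε)))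
        = 2604 * Y * (2 * (|u| * Real.exp (z * |u|) * |meanK μ Khat u|)
          + ε * (Real.exp (z * |u|) * |meanK μ Khat u|)
          + (θ u * Real.exp (z * |u|) * (2 * |u| + ε)) / 2) := by ring
    rw [h4, h1]
    refine mul_le_mul_of_nonneg_left ?_ (by positivity)
    linarith
  have hji : IntegrableOn (fun u => (|meanK μ Khat u| + θ u / 2) *
      (2604 * Y * (Real.exp (z * |u|) * (2 * |u| + ε)))) (Set.Icc (-1) 1) := by
    refine hjint.mono' (by fun_prop) (ae_of_all _ fun u => ?_)
    have := hθ0 u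
    rw [Real.norm_eq_abs, abs_of_nonneg (by positivity)]
    exact hpt u
  have hjl := integral_mono hji hjint hpt
  have hKM : Integrable (fun u => 2 * (|u| * Real.exp (z * |u|) * |meanK μ Khat u|)
      + ε * (Real.exp (z * |u|) * |meanK μ Khat u|)) (volume.restrict (Set.Icc (-1) 1)) :=
    (hKi.const_mul 2).add (hMi.const_mul ε)
  rw [integral_const_mul, integral_add hKM (integrable_const _),
    integral_add (hKi.const_mul 2) (hMi.const_mul ε), integral_const_mul,
    integral_const_mul, setIntegral_const, Real.volume_real_Icc_of_le (by norm_num),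
    smul_eq_mul] at hjl
  have hI : ∀ w u, |indDiff z w u| ≤ Real.exp (-z ^ 2) * (Real.exp (z * |u|) * Psi z z w) :=
    fun w u => by
      rw [← mul_assoc]
      exact (abs_indDiff_le hz w u).trans (mul_le_mul_of_nonneg_left
        (Set.indicator_le_self' (fun _ _ => (Psi_pos hz _).le) _) (by positivity))
  have key := H.abs_integral_kernel_le (measurable_indDiff z) (abs_indDiff_le_one z)
    (Real.exp_pos (-z ^ 2)).le (fun w u hu => (hI w u).trans (by
      refine mul_le_mul_of_nonneg_left ?_ (Real.exp_pos _).le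
      have := Psi_pos (β := z) hz w
      rw [mul_assoc]
      exact le_mul_of_one_le_left (by positivity) hu.le))
    hθm hθ0 hθ1 (A₃ := Real.exp (-z ^ 2)) (A₄ := Real.exp (-z ^ 2) / s)
    (Real.exp_pos _).le (by positivity) (fun w u _ => (hI w u).trans (le_of_eq (by
      have h1 : Real.exp (2 * z * |u|) = Real.exp (z * |u|) * Real.exp (z * |u|) := by
        rw [← Real.exp_add]; congr 1; ring
      have h2 : θ u * Real.exp (z * |u|) * (|u| / s + 1) = 1 := by
        rw [hθ]
        simp only
        rw [div_mul_eq_mul_div, ← Real.exp_add, neg_add_cancel, Real.exp_zero]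
        field_simp
      calc _ = Real.exp (-z ^ 2) * (Real.exp (z * |u|) * Psi z z w)
            * (θ u * Real.exp (z * |u|) * (|u| / s + 1)) := by rw [h2, mul_one]
        _ = _ := by rw [h1]; ring)))
    (fun u _ => H.integral_abs_indDiff_le u) hji
  have hh := H.integral_Psi_le (t := z) ⟨hz, le_rfl⟩
  set h := ∫ ω, Psi z z (W ω) ∂μ
  have hEh : Real.exp (-z ^ 2) * h ≤ 41 * Y := by
    refine (mul_le_mul_of_nonneg_left hh (Real.exp_pos _).le).trans (le_of_eq ?_)
    rw [mul_left_comm, ← Real.exp_add, hY]; congr 2; ring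
  refine key.trans ?_
  have b1 : Real.exp (-z ^ 2) * (e 2 * h) ≤ e 2 * (41 * Y) := by
    rw [mul_left_comm]; exact mul_le_mul_of_nonneg_left hEh n2
  have b2 : Real.exp (-z ^ 2) * (e 3 * h) ≤ e 3 * (41 * Y) := by
    rw [mul_left_comm]; exact mul_le_mul_of_nonneg_left hEh n3
  have b3 : Real.exp (-z ^ 2) / s * (e 4 * h) ≤ s * (41 * Y) := by
    have : e 4 / s ≤ s := by rw [div_le_iff₀ hs]; linarith [sq s]
    calc _ = e 4 / s * (Real.exp (-z ^ 2) * h) := by ring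
      _ ≤ s * (41 * Y) := mul_le_mul this hEh
        (mul_nonneg (Real.exp_pos _).le (integral_nonneg fun _ => (Psi_pos hz _).le)) hs.le
  have b4 : 2604 * Y * (2 * (∫ u in Set.Icc (-1 : ℝ) 1, |u| * Real.exp (z * |u|) * |meanK μ Khat u|)
      + ε * (∫ u in Set.Icc (-1 : ℝ) 1, Real.exp (z * |u|) * |meanK μ Khat u|)
      + (1 - -1) * (s + ε / 2)) ≤ 2604 * Y * (6 * e 2 + ε * ρ + (2 * s + ε)) := by
    refine mul_le_mul_of_nonneg_left ?_ (by positivity)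
    have := mul_le_mul_of_nonneg_left hMl hε0
    linarith
  have hfin : 2604 * Y * (6 * e 2 + ε * ρ + (2 * s + ε)) + e 2 * (41 * Y)
      + (e 3 * (41 * Y) + s * (41 * Y)) / 2
      ≤ 2604 * Y * ((1 + ρ) * (e 1 + 80 * (1 + z) * e 2 + 2 * e 3 + 3 * s)) := by
    have q1 : (1 + ρ) * (e 1 + 80 * (1 + z) * e 2 + 2 * e 3 + 3 * s)
        = ε * ρ + ε + (7 * (1 + z) * e 2 + e 3 + 3 * s)
          + ρ * (7 * (1 + z) * e 2 + e 3 + 3 * s) := by rw [hε]; ring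
    rw [q1]
    have q2 : 0 ≤ Y * (ρ * (7 * (1 + z) * e 2 + e 3 + 3 * s)) := by positivity
    have q3 : 0 ≤ Y * (z * e 2) := by positivity
    have q4 : 0 ≤ Y * e 2 := by positivity
    have q5 : 0 ≤ Y * e 3 := by positivity
    have q6 : 0 ≤ Y * s := by positivity
    linarith
  linarith

/-- Each `e^{-k²/2}` cancels the growth of `E Ψ_{z,k}`, so only the number of terms, at most `1 +
z`, remains. -/
lemma sum_weight_le (H : LevelBounds μ W R Khat z ρ e) {c : ℝ} (hc : 0 ≤ c) :
    ∑ k ∈ Finset.range (⌊z⌋₊ + 1), c * Real.exp (-((k : ℝ) ^ 2 / 2)) * ∫ ω, Psi z k (W ω) ∂μ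
      ≤ 41 * c * (1 + z) := by
  have hz := H.z_nonneg
  have h1 : ∀ k ∈ Finset.range (⌊z⌋₊ + 1),
      c * Real.exp (-((k : ℝ) ^ 2 / 2)) * ∫ ω, Psi z k (W ω) ∂μ ≤ 41 * c := by
    intro k hk
    have hkz : (k : ℝ) ≤ z := (Nat.le_floor_iff hz).1 (Nat.lt_succ_iff.1 (Finset.mem_range.1 hk))
    refine (mul_le_mul_of_nonneg_left (H.integral_Psi_le ⟨Nat.cast_nonneg k, hkz⟩)
      (by positivity)).trans (le_of_eq ?_)
    rw [mul_mul_mul_comm, ← Real.exp_add]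
    simp [mul_comm]
  refine (Finset.sum_le_card_nsmul _ _ _ h1).trans ?_
  rw [Finset.card_range, nsmul_eq_mul, mul_comm]
  refine mul_le_mul_of_nonneg_left ?_ (by positivity)
  push_cast
  linarith [Nat.floor_le hz]

/-! ### Assembly at a fixed level -/

/-- Relative error of the normal approximation at level `z`. -/
lemma abs_tail_sub_le (H : LevelBounds μ W R Khat z ρ e) :
    |μ.real {ω | z < W ω} - normTail z| ≤ 1300000 * (1 + ρ) * ((1 + z) * e 0 + (1 + z) ^ 2 * e 1
      + (1 + z) ^ 3 * e 2 + (1 + z) * e 3 + (1 + z) * √(e 4)) * normTail z := by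
  have hz := H.z_nonneg
  have hρ := H.ρ_nonneg
  have hW := H.meas_W
  have n0 := H.e_nonneg 0
  have n1 := H.e_nonneg 1
  have n2 := H.e_nonneg 2
  have n3 := H.e_nonneg 3
  have hp := normTail_pos z
  set p := normTail z with hpdef
  have hE0 : 0 < Real.exp (z ^ 2 / 2) := Real.exp_pos _
  have hfb : ∀ w, |steinSol z w| ≤ 3 * p * Real.exp (z ^ 2 / 2) := fun w =>
    (abs_steinSol_le hz w).trans (mul_le_mul_of_nonneg_left (steinWeight_le hz w) (by positivity))
  have hgb : ∀ w, |steinDer z w| ≤ 6 * (1 + z) * p * Real.exp (z ^ 2 / 2) := fun w =>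
    (abs_steinDer_le hz w).trans (mul_le_mul_of_nonneg_left (steinWeight_le hz w) (by positivity))
  have hid := H.stein_error (lipschitzWith_steinSol hz) hfb (measurable_steinDer z) hgb z
    (fun x hx => hasDerivAt_steinSol hx)
  have hWf : Integrable (fun ω => W ω * steinSol z (W ω)) μ :=
    H.int_W.mul_bdd (c := 3 * p * Real.exp (z ^ 2 / 2))
      ((continuous_steinSol z).measurable.comp hW).aestronglyMeasurable (ae_of_all _ fun ω => hfb _)
  have hgi : Integrable (fun ω => steinDer z (W ω)) μ :=
    Integrable.of_bound ((measurable_steinDer z).comp hW).aestronglyMeasurable _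
      (ae_of_all _ fun ω => hgb _)
  have hSm : MeasurableSet {ω | z < W ω} := measurableSet_lt measurable_const hW
  have htail : μ.real {ω | z < W ω} - p
      = ∫ ω, W ω * steinSol z (W ω) ∂μ - ∫ ω, steinDer z (W ω) ∂μ := by
    rw [← integral_sub hWf hgi]
    have : ∀ ω, W ω * steinSol z (W ω) - steinDer z (W ω)
        = {ω | z < W ω}.indicator (fun _ => (1 : ℝ)) ω - p := by
      intro ω
      rw [steinDer]
      by_cases h : z < W ω
      · rw [if_neg h.not_ge, Set.indicator_of_mem (show ω ∈ {ω | z < W ω} from h)]; ring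
      · rw [if_pos (not_lt.1 h), Set.indicator_of_notMem (show ω ∉ {ω | z < W ω} from h)]; ring
    simp only [this]
    rw [integral_sub ((integrable_indicator_iff hSm).2 (integrable_const 1).integrableOn)
      (integrable_const _), integral_indicator hSm, setIntegral_const, integral_const,
      probReal_univ, smul_eq_mul, mul_one, one_smul]
  have hts : ∀ k ∈ Finset.range (⌊z⌋₊ + 1), (k : ℝ) ∈ Set.Icc 0 z := fun k hk =>
    ⟨Nat.cast_nonneg k, (Nat.le_floor_iff hz).1 (Nat.lt_succ_iff.1 (Finset.mem_range.1 hk))⟩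
  have hwsum : ∀ c : ℝ, 0 ≤ c → ∀ w, c * steinWeight z w ≤ ∑ k ∈ Finset.range (⌊z⌋₊ + 1),
      (2 * c) * Real.exp (-((k : ℝ) ^ 2 / 2)) * Psi z k w := fun c hc w => by
    refine (mul_le_mul_of_nonneg_left (steinWeight_le_sum hz w) hc).trans (le_of_eq ?_)
    rw [Finset.mul_sum]
    exact Finset.sum_congr rfl fun k _ => by ring
  have t0 := H.abs_integral_R_le (s := Finset.range (⌊z⌋₊ + 1))
    (c := fun k => (2 * (3 * p)) * Real.exp (-((k : ℝ) ^ 2 / 2))) (t := fun k => (k : ℝ))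
    (fun k _ => by positivity) hts
    (fun w => (abs_steinSol_le hz w).trans (hwsum (3 * p) (by positivity) w))
  have t1 := H.abs_integral_condK1_le (s := Finset.range (⌊z⌋₊ + 1))
    (c := fun k => (2 * (6 * (1 + z) * p)) * Real.exp (-((k : ℝ) ^ 2 / 2))) (t := fun k => (k : ℝ))
    (fun k _ => by positivity) hts
    (fun w => (abs_steinDer_le hz w).trans (hwsum (6 * (1 + z) * p) (by positivity) w))
  -- The increment of `steinDer` equals `d` plus `indDiff`, since the constant in the Stein equation
  -- cancels.
  set d : ℝ → ℝ → ℝ := fun w u => (w + u) * steinSol z (w + u) - w * steinSol z w with hd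
  have t2 := H.abs_integral_Khat_le (s := Finset.range (⌊z⌋₊ + 1))
    (c := fun k => (2 * (2 * (3 * (1 + z) ^ 2 * p))) * Real.exp (-((k : ℝ) ^ 2 / 2)))
    (t := fun k => (k : ℝ)) (fun k _ => by positivity) hts (d := d) (fun w u => by
      refine (abs_mul_steinSol_sub_le hz w u).trans (mul_le_mul_of_nonneg_left ?_ (abs_nonneg u))
      refine (hwsum (3 * (1 + z) ^ 2 * p) (by positivity) (w + |u|)).trans
        (Finset.sum_le_sum fun k _ => ?_)
      have := Psi_add_le (β := z) (Nat.cast_nonneg k) (le_refl (w + |u|))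
      refine (mul_le_mul_of_nonneg_left this (by positivity)).trans (le_of_eq (by ring)))
  have s0 := mul_le_mul_of_nonneg_left
    (H.sum_weight_le (c := 2 * (3 * p)) (by positivity)) n0
  have s1 := mul_le_mul_of_nonneg_left
    (H.sum_weight_le (c := 2 * (6 * (1 + z) * p)) (by positivity)) n1
  have s2 := mul_le_mul_of_nonneg_left
    (H.sum_weight_le (c := 2 * (2 * (3 * (1 + z) ^ 2 * p))) (by positivity)) n2
  have hW1 : Measurable fun p : Ω × ℝ => W p.1 := hW.comp measurable_fst
  have hWu : Measurable fun p : Ω × ℝ => W p.1 + p.2 := hW1.add measurable_snd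
  have hiI : Integrable (fun p : Ω × ℝ => indDiff z (W p.1) p.2 * Khat p.1 p.2) (μ.prod volume) :=
    H.int_K.bdd_mul (c := 1) ((measurable_indDiff z).comp
      (hW1.prodMk measurable_snd)).aestronglyMeasurable
      (ae_of_all _ fun q => abs_indDiff_le_one _ _ _)
  have higg : Integrable (fun p : Ω × ℝ => (steinDer z (W p.1 + p.2) - steinDer z (W p.1))
      * Khat p.1 p.2) (μ.prod volume) :=
    H.int_K.bdd_mul (c := 6 * (1 + z) * p * Real.exp (z ^ 2 / 2)
        + 6 * (1 + z) * p * Real.exp (z ^ 2 / 2))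
      (((measurable_steinDer z).comp hWu).sub
        ((measurable_steinDer z).comp hW1)).aestronglyMeasurable
      (ae_of_all _ fun q => (abs_sub _ _).trans (add_le_add (hgb _) (hgb _)))
  have hsplit : ∫ p : Ω × ℝ, d (W p.1) p.2 * Khat p.1 p.2 ∂(μ.prod volume)
      = ∫ p : Ω × ℝ, (steinDer z (W p.1 + p.2) - steinDer z (W p.1)) * Khat p.1 p.2
          ∂(μ.prod volume)
        - ∫ p : Ω × ℝ, indDiff z (W p.1) p.2 * Khat p.1 p.2 ∂(μ.prod volume) := by
    rw [← integral_sub higg hiI]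
    refine integral_congr_ae (ae_of_all _ fun q => ?_)
    simp only [hd, steinDer, indDiff]; ring
  have hY := exp_neg_le_normTail hz
  -- The parameter must be positive while `e 4` may vanish, so a free `s` is kept and lowered to
  -- `√(e 4)` at the end.
  have hall : ∀ s : ℝ, 0 < s → e 4 ≤ s ^ 2 → |μ.real {ω | z < W ω} - p|
      ≤ 1300000 * (1 + ρ) * ((1 + z) * e 0 + (1 + z) ^ 2 * e 1
      + (1 + z) ^ 3 * e 2 + (1 + z) * e 3 + (1 + z) * s) * p := by
    intro s hs hs4
    have t3 := H.abs_integral_indDiff_le hs hs4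
    have s3 := mul_le_mul_of_nonneg_left hY (by positivity :
      0 ≤ 2604 * (1 + ρ) * (e 1 + 80 * (1 + z) * e 2 + 2 * e 3 + 3 * s))
    rw [htail, hid]
    have hsum : ∀ a b c d' : ℝ, |a + b + (c + d')| ≤ |a| + |b| + |c| + |d'| := fun a b c d' => by
      have := abs_add_le (a + b) (c + d')
      have := abs_add_le a b
      have := abs_add_le c d'
      linarith
    rw [show ∫ p : Ω × ℝ, (steinDer z (W p.1 + p.2) - steinDer z (W p.1)) * Khat p.1 p.2
          ∂(μ.prod volume) = ∫ p : Ω × ℝ, d (W p.1) p.2 * Khat p.1 p.2 ∂(μ.prod volume)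
        + ∫ p : Ω × ℝ, indDiff z (W p.1) p.2 * Khat p.1 p.2 ∂(μ.prod volume) by
      rw [hsplit]; ring]
    refine (hsum _ _ _ _).trans ?_
    have u0 : |∫ ω, R ω * steinSol z (W ω) ∂μ| ≤ 246 * ((1 + z) * e 0 * p) := by
      refine t0.trans (s0.trans (le_of_eq (by ring)))
    have u1 : |∫ ω, (condK1 μ W Khat ω - 1) * steinDer z (W ω) ∂μ|
        ≤ 492 * ((1 + z) ^ 2 * e 1 * p) := by
      refine t1.trans (s1.trans (le_of_eq (by ring)))
    have u2 : |∫ p : Ω × ℝ, d (W p.1) p.2 * Khat p.1 p.2 ∂(μ.prod volume)|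
        ≤ 492 * ((1 + z) ^ 3 * e 2 * p) := by
      refine t2.trans (s2.trans (le_of_eq (by ring)))
    have u3 : |∫ p : Ω × ℝ, indDiff z (W p.1) p.2 * Khat p.1 p.2 ∂(μ.prod volume)|
        ≤ 1249920 * ((1 + ρ) * ((1 + z) ^ 2 * e 1 + (1 + z) ^ 3 * e 2 + (1 + z) * e 3
          + (1 + z) * s) * p) := by
      refine t3.trans (s3.trans ?_)
      have v1 : (1 + z) * e 1 ≤ (1 + z) ^ 2 * e 1 :=
        mul_le_mul_of_nonneg_right (by nlinarith) n1
      have v2 : (1 + z) ^ 2 * e 2 ≤ (1 + z) ^ 3 * e 2 :=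
        mul_le_mul_of_nonneg_right (pow_le_pow_right₀ (by linarith) (by norm_num)) n2
      have v3 : (1 + z) * (e 1 + 80 * (1 + z) * e 2 + 2 * e 3 + 3 * s)
          ≤ 80 * ((1 + z) ^ 2 * e 1 + (1 + z) ^ 3 * e 2 + (1 + z) * e 3 + (1 + z) * s) := by
        have : 0 ≤ (1 + z) * e 1 := by positivity
        have : 0 ≤ (1 + z) * e 3 := by positivity
        have : 0 ≤ (1 + z) * s := by positivity
        linarith
      have v4 := mul_le_mul_of_nonneg_left v3 (by positivity : 0 ≤ 2604 * 6 * (1 + ρ) * p)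
      linarith
    have w0 : 0 ≤ (1 + z) * e 0 * p := by positivity
    have w1 : 0 ≤ (1 + z) ^ 2 * e 1 * p := by positivity
    have w2 : 0 ≤ (1 + z) ^ 3 * e 2 * p := by positivity
    have w3 : 0 ≤ (1 + z) * e 3 * p := by positivity
    have w4 : 0 ≤ (1 + z) * s * p := by positivity
    have x0 := mul_nonneg hρ w0
    have x1 := mul_nonneg hρ w1
    have x2 := mul_nonneg hρ w2
    have x3 := mul_nonneg hρ w3
    have x4 := mul_nonneg hρ w4
    linarith
  refine le_of_forall_pos_le_add fun η hη => ?_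
  set b := 1300000 * (1 + ρ) * (1 + z) * p with hb
  have hb0 : 0 < b := by positivity
  have hs4 : e 4 ≤ (√(e 4) + η / b) ^ 2 := by
    have h1 := Real.sq_sqrt (H.e_nonneg 4)
    have h2 : 0 < η / b := by positivity
    nlinarith [Real.sqrt_nonneg (e 4)]
  refine (hall (√(e 4) + η / b) (by positivity) hs4).trans (le_of_eq ?_)
  have : η = b * (η / b) := by field_simp
  nth_rewrite 2 [this]
  rw [hb]; ring

end LevelBounds

/-! ### Constants, the range of `z`, and `δ(z)` -/

lemma one_add_pow_mul_le {z a : ℝ} (hz : 0 ≤ z) (ha : 0 ≤ a) (k : ℕ) :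
    (1 + z) ^ k * (1 + z ^ a) ≤ 2 ^ (k + 1) * max 1 (z ^ (a + k)) := by
  rcases le_total z 1 with h | h
  · have h1 : (1 + z) ^ k ≤ 2 ^ k := pow_le_pow_left₀ (by linarith) (by linarith) k
    have h2 : 1 + z ^ a ≤ 2 := by linarith [Real.rpow_le_one hz h ha]
    have h3 : 0 ≤ z ^ a := Real.rpow_nonneg hz a
    calc (1 + z) ^ k * (1 + z ^ a) ≤ 2 ^ k * 2 := mul_le_mul h1 h2 (by linarith) (by positivity)
      _ = 2 ^ (k + 1) * 1 := by ring
      _ ≤ _ := mul_le_mul_of_nonneg_left (le_max_left _ _) (by positivity)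
  · have h1 : (1 + z) ^ k ≤ (2 * z) ^ k := pow_le_pow_left₀ (by linarith) (by linarith) k
    have h2 : 1 ≤ z ^ a := Real.one_le_rpow h ha
    calc (1 + z) ^ k * (1 + z ^ a) ≤ (2 * z) ^ k * (2 * z ^ a) :=
          mul_le_mul h1 (by linarith) (by linarith) (by positivity)
      _ = 2 ^ (k + 1) * z ^ (a + k) := by
          rw [Real.rpow_add (by linarith), Real.rpow_natCast, mul_pow]; ring
      _ ≤ _ := mul_le_mul_of_nonneg_left (le_max_right _ _) (by positivity)

lemma one_add_pow_mul_le' {z a : ℝ} (hz : 0 ≤ z) (ha : 0 ≤ a) (k : ℕ) :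
    (1 + z) ^ k * (1 + z ^ a) ≤ 2 ^ (k + 1) * (1 + z ^ (a + k)) := by
  refine (one_add_pow_mul_le hz ha k).trans (mul_le_mul_of_nonneg_left ?_ (by positivity))
  have := Real.rpow_nonneg hz (a + k)
  exact max_le (by linarith) (by linarith)

lemma mul_rpow_le_of_root_le {r z a c : ℝ} (hr : 0 ≤ r) (hz : 0 ≤ z) (ha : 1 ≤ a) (hc0 : 0 ≤ c)
    (hc : c ≤ 1) (h : z * r ^ (1 / a) ≤ c) : r * z ^ a ≤ c := by
  have ha0 : a ≠ 0 := by linarith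
  have h1 : r * z ^ a = (z * r ^ (1 / a)) ^ a := by
    rw [Real.mul_rpow hz (Real.rpow_nonneg hr _), ← Real.rpow_mul hr, one_div_mul_cancel ha0,
      Real.rpow_one, mul_comm]
  have h0 : 0 ≤ z * r ^ (1 / a) := mul_nonneg hz (Real.rpow_nonneg hr _)
  rw [h1]
  calc (z * r ^ (1 / a)) ^ a ≤ c ^ a := Real.rpow_le_rpow h0 h (by linarith)
    _ ≤ c ^ (1 : ℝ) := Real.rpow_le_rpow_of_exponent_ge' hc0 hc (by norm_num) ha
    _ = c := Real.rpow_one c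

section Constants

variable {r τ : Fin 5 → ℝ}

lemma tauMax_nonneg (hτ : ∀ j, 0 ≤ τ j) : 0 ≤ tauMax τ :=
  le_trans (by have := hτ 0; linarith) (le_max_left _ _)

lemma delta_nonneg (hr : ∀ j, 0 ≤ r j) {z : ℝ} (hz : 0 ≤ z) : 0 ≤ delta r τ z := by
  have h : ∀ a : ℝ, 0 ≤ 1 + z ^ a := fun a => by have := Real.rpow_nonneg hz a; linarith
  have := h (τ 0 + 1); have := h (τ 1 + 2); have := h (τ 2 + 3); have := h (τ 3 + 1)
  have := h (τ 4 + 1); have := hr 0; have := hr 1; have := hr 2; have := hr 3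
  unfold delta; positivity

lemma sum_le_delta (hr : ∀ j, 0 ≤ r j) {z : ℝ} (hz : 0 ≤ z) :
    r 0 + r 1 + r 2 ≤ delta r τ z := by
  have h : ∀ a b : ℝ, 0 ≤ b → b ≤ b * (1 + z ^ a) := fun a b hb => by
    have := mul_nonneg hb (Real.rpow_nonneg hz a); linarith
  have := h (τ 0 + 1) _ (hr 0)
  have := h (τ 1 + 2) _ (hr 1)
  have := h (τ 2 + 3) _ (hr 2)
  have := h (τ 3 + 1) _ (hr 3)
  have := h (τ 4 + 1) _ (Real.sqrt_nonneg (r 4))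
  have := hr 3
  have := Real.sqrt_nonneg (r 4)
  unfold delta; linarith

lemma level_sum_le_delta (hr : ∀ j, 0 ≤ r j) (hτ : ∀ j, 0 ≤ τ j) {z : ℝ} (hz : 0 ≤ z) :
    (1 + z) * (r 0 * (1 + z ^ τ 0)) + (1 + z) ^ 2 * (r 1 * (1 + z ^ τ 1))
      + (1 + z) ^ 3 * (r 2 * (1 + z ^ τ 2)) + (1 + z) * (r 3 * (1 + z ^ τ 3))
      + (1 + z) * √(r 4 * (1 + z ^ τ 4)) ≤ 16 * delta r τ z := by
  have key : ∀ (b a : ℝ) (k : ℕ), 0 ≤ b → 0 ≤ a → k ≤ 3 →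
      (1 + z) ^ k * (b * (1 + z ^ a)) ≤ 16 * (b * (1 + z ^ (a + k))) := fun b a k hb ha hk => by
    have h1 := mul_le_mul_of_nonneg_left (one_add_pow_mul_le' hz ha k) hb
    have h2 : (2 : ℝ) ^ (k + 1) ≤ 2 ^ 4 := pow_le_pow_right₀ (by norm_num) (by omega)
    have h3 : 0 ≤ b * (1 + z ^ (a + k)) :=
      mul_nonneg hb (by have := Real.rpow_nonneg hz (a + k); linarith)
    have h4 := mul_le_mul_of_nonneg_right h2 h3
    linarith
  have h0 := key (r 0) (τ 0) 1 (hr 0) (hτ 0) (by norm_num)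
  have h1 := key (r 1) (τ 1) 2 (hr 1) (hτ 1) (by norm_num)
  have h2 := key (r 2) (τ 2) 3 (hr 2) (hτ 2) (by norm_num)
  have h3 := key (r 3) (τ 3) 1 (hr 3) (hτ 3) (by norm_num)
  have h4 := key (√(r 4)) (τ 4) 1 (Real.sqrt_nonneg _) (hτ 4) (by norm_num)
  have h5 : √(r 4 * (1 + z ^ τ 4)) ≤ √(r 4) * (1 + z ^ τ 4) := by
    have h6 : 1 ≤ 1 + z ^ τ 4 := by have := Real.rpow_nonneg hz (τ 4); linarith
    rw [Real.sqrt_mul (hr 4)]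
    refine mul_le_mul_of_nonneg_left ?_ (Real.sqrt_nonneg _)
    exact Real.sqrt_le_iff.2 ⟨by linarith, by nlinarith⟩
  have h7 := mul_le_mul_of_nonneg_left h5 (by linarith : 0 ≤ 1 + z)
  push_cast at h0 h1 h2 h3 h4
  rw [pow_one] at h0 h3 h4
  unfold delta
  linarith

lemma mul_rpow_le_of_le_zRange (hr : ∀ j, 0 ≤ r j) (hτ : ∀ j, 0 ≤ τ j) {m₀ z : ℝ} (hz : 0 < z)
    (hzr : z ≤ zRange m₀ r τ) : r 0 * z ^ (τ 0 + 1) ≤ 0.02 ∧ r 1 * z ^ (τ 1 + 2) ≤ 0.02 ∧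
      r 2 * z ^ (τ 2 + 3) ≤ 0.02 := by
  have a0 := Real.rpow_nonneg (hr 0) (1 / (τ 0 + 1))
  have a1 := Real.rpow_nonneg (hr 1) (1 / (τ 1 + 2))
  have a2 := Real.rpow_nonneg (hr 2) (1 / (τ 2 + 3))
  set A := r 0 ^ (1 / (τ 0 + 1)) + r 1 ^ (1 / (τ 1 + 2)) + r 2 ^ (1 / (τ 2 + 3)) with hA
  have h1 : z ≤ 0.02 * Real.exp (-tauMax τ / 2) * A⁻¹ := hzr.trans (min_le_right _ _)
  have hA0 : 0 < A := by
    have hA0 : 0 ≤ A := by positivity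
    rcases hA0.eq_or_lt with h | h
    · rw [← h, inv_zero, mul_zero] at h1; linarith
    · exact h
  have h2 : Real.exp (-tauMax τ / 2) ≤ 1 :=
    Real.exp_le_one_iff.2 (by linarith [tauMax_nonneg hτ])
  have h3 : z * A ≤ 0.02 := by
    rw [← div_eq_mul_inv, le_div_iff₀ hA0] at h1
    linarith
  refine ⟨mul_rpow_le_of_root_le (hr 0) hz.le (by linarith [hτ 0]) (by norm_num) (by norm_num) ?_,
    mul_rpow_le_of_root_le (hr 1) hz.le (by linarith [hτ 1]) (by norm_num) (by norm_num) ?_,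
    mul_rpow_le_of_root_le (hr 2) hz.le (by linarith [hτ 2]) (by norm_num) (by norm_num) ?_⟩ <;>
  · refine le_trans (mul_le_mul_of_nonneg_left ?_ hz.le) h3
    rw [hA]; linarith

/-- The powers of `1 + z` and `1 + z ^ τ j` cost at most `16 max 1 (z ^ (τ j + k))`. For `z > 1` the
range of `z` bounds `r j` times this maximum by `16 · 0.02 < 1`; for `z ≤ 1` the maximum is 1 and
smallness of `r j` itself is needed. -/
lemma small_of_le_zRange (hr : ∀ j, 0 ≤ r j) (hτ : ∀ j, 0 ≤ τ j) {m₀ z : ℝ} (hz : 0 ≤ z)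
    (hzr : z ≤ zRange m₀ r τ) (h : 1 < z ∨ (r 0 ≤ 1 / 16 ∧ r 1 ≤ 1 / 16 ∧ r 2 ≤ 1 / 16)) :
    (1 + z) * (r 0 * (1 + z ^ τ 0)) ≤ 1 ∧ (1 + z) ^ 2 * (r 1 * (1 + z ^ τ 1)) ≤ 1 ∧
      (1 + z) ^ 3 * (r 2 * (1 + z ^ τ 2)) ≤ 1 := by
  have key : ∀ (b a : ℝ) (k : ℕ), 0 ≤ b → 0 ≤ a → k ≤ 3 → b * max 1 (z ^ (a + k)) ≤ 1 / 16 →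
      (1 + z) ^ k * (b * (1 + z ^ a)) ≤ 1 := fun b a k hb ha hk hle => by
    have h1 := mul_le_mul_of_nonneg_left (one_add_pow_mul_le hz ha k) hb
    have h2 : (2 : ℝ) ^ (k + 1) ≤ 2 ^ 4 := pow_le_pow_right₀ (by norm_num) (by omega)
    have h3 : 0 ≤ b * max 1 (z ^ (a + k)) :=
      mul_nonneg hb (zero_le_one.trans (le_max_left _ _))
    have h4 := mul_le_mul_of_nonneg_right h2 h3
    linarith
  have hmax : r 0 * max 1 (z ^ (τ 0 + (1 : ℕ))) ≤ 1 / 16 ∧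
      r 1 * max 1 (z ^ (τ 1 + (2 : ℕ))) ≤ 1 / 16 ∧
      r 2 * max 1 (z ^ (τ 2 + (3 : ℕ))) ≤ 1 / 16 := by
    push_cast
    rcases lt_or_ge 1 z with h1 | h1
    · obtain ⟨b0, b1, b2⟩ := mul_rpow_le_of_le_zRange hr hτ (by linarith) hzr
      rw [max_eq_right (Real.one_le_rpow h1.le (by linarith [hτ 0])),
        max_eq_right (Real.one_le_rpow h1.le (by linarith [hτ 1])),
        max_eq_right (Real.one_le_rpow h1.le (by linarith [hτ 2]))]
      norm_num at b0 b1 b2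
      exact ⟨by linarith, by linarith, by linarith⟩
    · rw [max_eq_left (Real.rpow_le_one hz h1 (by linarith [hτ 0])),
        max_eq_left (Real.rpow_le_one hz h1 (by linarith [hτ 1])),
        max_eq_left (Real.rpow_le_one hz h1 (by linarith [hτ 2])), mul_one, mul_one, mul_one]
      exact h.resolve_left h1.not_gt
  have h0 := key (r 0) (τ 0) 1 (hr 0) (hτ 0) (by norm_num) hmax.1
  rw [pow_one] at h0
  exact ⟨h0, key (r 1) (τ 1) 2 (hr 1) (hτ 1) (by norm_num) hmax.2.1,
    key (r 2) (τ 2) 3 (hr 2) (hτ 2) le_rfl hmax.2.2⟩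

end Constants

/-! ### Conclusion -/

lemma abs_ratio_sub_one_le {Ω : Type*} [MeasurableSpace Ω] {μ : Measure Ω} [IsProbabilityMeasure μ]
    {W R : Ω → ℝ} {Khat : Ω → ℝ → ℝ} {m₀ ρ : ℝ} {r τ : Fin 5 → ℝ} (hW : Measurable W)
    (hR : Measurable R) (hK : Measurable (Function.uncurry Khat)) (hS : SteinIdentity μ W R Khat)
    (hA : CondA1 μ W R Khat m₀ ρ r τ) {z : ℝ} (hz : 0 ≤ z) (hzr : z ≤ zRange m₀ r τ) :
    |μ.real {ω | z < W ω} / (1 - Phi z) - 1|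
      ≤ (20800000 + 16 * (1 + 1 / normTail 1)) * (1 + ρ) * delta r τ z := by
  have hp := normTail_pos z
  have hp1 := normTail_pos 1
  have hρ := hA.ρ_pos
  have hδ := delta_nonneg (τ := τ) hA.r_nonneg hz
  rw [one_sub_Phi]
  by_cases h : 1 < z ∨ (r 0 ≤ 1 / 16 ∧ r 1 ≤ 1 / 16 ∧ r 2 ≤ 1 / 16)
  · obtain ⟨h0, h1, h2⟩ := small_of_le_zRange hA.r_nonneg hA.τ_nonneg hz hzr h
    have H := hA.levelBounds hW hR hK hS hz (hzr.trans (min_le_left _ _)) h0 h1 h2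
    have h3 := H.abs_tail_sub_le
    have h4 := level_sum_le_delta hA.r_nonneg hA.τ_nonneg hz
    rw [div_sub_one hp.ne', abs_div, abs_of_pos hp, div_le_iff₀ hp]
    refine h3.trans (mul_le_mul_of_nonneg_right ?_ hp.le)
    refine (mul_le_mul_of_nonneg_left h4 (by positivity)).trans ?_
    have h5 : 0 ≤ 16 * (1 + 1 / normTail 1) * (1 + ρ) * delta r τ z := by positivity
    linarith
  · rw [not_or, not_lt] at h
    obtain ⟨hz1, hr⟩ := h
    -- Here `z ≤ 1` and one of `r 0, r 1, r 2` exceeds `1/16`, so the error term is bounded below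
    -- and the trivial bound on the ratio suffices.
    have hδ1 : 1 ≤ 16 * delta r τ z := by
      have hs := sum_le_delta (τ := τ) hA.r_nonneg hz
      have := hA.r_nonneg 0
      have := hA.r_nonneg 1
      have := hA.r_nonneg 2
      by_contra hlt
      exact hr ⟨by linarith, by linarith, by linarith⟩
    have hP0 : 0 ≤ μ.real {ω | z < W ω} := measureReal_nonneg
    have hP1 : μ.real {ω | z < W ω} ≤ 1 := measureReal_le_one
    have h1 : |μ.real {ω | z < W ω} / normTail z - 1| ≤ 1 + 1 / normTail 1 := by
      have h2 : μ.real {ω | z < W ω} / normTail z ≤ 1 / normTail 1 :=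
        div_le_div₀ zero_le_one hP1 hp1 (normTail_antitone hz1)
      have h3 : 0 ≤ μ.real {ω | z < W ω} / normTail z := by positivity
      have h4 : 0 < 1 / normTail 1 := by positivity
      rw [abs_le]; constructor <;> linarith
    have h5 : (1 + 1 / normTail 1) * 1 ≤ (1 + 1 / normTail 1) * (16 * delta r τ z) :=
      mul_le_mul_of_nonneg_left hδ1 (by positivity)
    have h6 : 0 ≤ 20800000 * (1 + ρ) * delta r τ z := by positivity
    have h7 : 0 ≤ ρ * (16 * (1 + 1 / normTail 1) * delta r τ z) := by positivity
    linarith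

end SteinModerate

theorem theorem4p1 :
    ∃ C : ℝ, 0 < C ∧
      ∀ {Ω : Type*} [MeasurableSpace Ω] (μ : Measure Ω) [IsProbabilityMeasure μ]
        (W R : Ω → ℝ) (Khat : Ω → ℝ → ℝ) (m₀ ρ : ℝ) (r τ : Fin 5 → ℝ),
        Measurable W → Measurable R → Measurable (Function.uncurry Khat) →
        SteinModerate.SteinIdentity μ W R Khat →
        SteinModerate.CondA1 μ W R Khat m₀ ρ r τ →
        ∀ z : ℝ, 0 ≤ z → z ≤ SteinModerate.zRange m₀ r τ →
          |μ.real {ω | z < W ω} / (1 - SteinModerate.Phi z) - 1|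
            ≤ (4 / SteinModerate.delta r τ m₀
                + C * (150 ^ SteinModerate.tauMax τ + ρ)
                    * Real.exp (SteinModerate.tauMax τ ^ 2 / 2))
              * SteinModerate.delta r τ z := by
  have hp := SteinModerate.normTail_pos 1
  refine ⟨20800000 + 16 * (1 + 1 / SteinModerate.normTail 1), by positivity, ?_⟩
  intro Ω _ μ _ W R Khat m₀ ρ r τ hW hR hK hS hA z hz hzr
  have hm := SteinModerate.delta_nonneg (τ := τ) hA.r_nonneg hA.m₀_pos.le
  have hδ := SteinModerate.delta_nonneg (τ := τ) hA.r_nonneg hz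
  have hρ := hA.ρ_pos
  have hτ := SteinModerate.tauMax_nonneg hA.τ_nonneg
  refine (SteinModerate.abs_ratio_sub_one_le hW hR hK hS hA hz hzr).trans
    (mul_le_mul_of_nonneg_right ?_ hδ)
  have h1 : (1 : ℝ) ≤ 150 ^ SteinModerate.tauMax τ := Real.one_le_rpow (by norm_num) hτ
  have h2 : 1 ≤ Real.exp (SteinModerate.tauMax τ ^ 2 / 2) := Real.one_le_exp (by positivity)
  -- The term `4 / δ(m₀)` is nonnegative (equal to 0 if `δ(m₀) = 0`) and is not needed; what remains
  -- is `1 + ρ ≤ (150^τ + ρ) e^{τ²/2}`.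
  refine le_add_of_nonneg_of_le (by positivity) ?_
  rw [mul_assoc]
  refine mul_le_mul_of_nonneg_left ?_ (by positivity)
  calc 1 + ρ ≤ (150 ^ SteinModerate.tauMax τ + ρ) * 1 := by linarith
    _ ≤ _ := mul_le_mul_of_nonneg_left h2 (by positivity)
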